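/- Conventions. $G=(V,E,w)$ is a complete undirected weighted graph, $|V|=n\ge 2$, $E=\binom V2$, with integer weights $w:E\to\{1,\dots,L\}$, where $L\le n^{k}$ for a fixed constant $k$. For a set $F$ of edges, $w(F)=\sum_{e\in F}w(e)$, and $\mathrm{hop}_F(u,v)$ is the minimum number of edges of a path between $u$ and $v$ that uses only edges of $F$ ($\infty$ if there is none). Weighted trees likewise have positive integer weights bounded by a polynomial in $n$. A rooted weighted tree is well-separated if all its edge weights are powers of $2$ and the weights strictly decrease along every path from the root to a leaf. An $h$-hop repetition tree embedding of $G$ with root $r\in V$, cost stretch $\alpha$ and hop stretch $\beta$ consists of a weighted tree $T=(V',E',w')$, an injective map $\phi:V\to 2^{V'}$ with non-empty values such that $\{\phi(v):v\in V\}$ is a partition of $V'$, and inclusion-monotone maps $\pi_{G\to T}:2^E\to 2^{E'}$ and $\pi_{T\to G}:2^{E'}\to 2^{E}$ such that 1. $w'(\pi_{G\to T}(F))\le\alpha\cdot w(F)$ for all $F\subseteq E$, and $w(\pi_{T\to G}(F'))\le w'(F')$ for all $F'\subseteq E'$; 2. for all $F\subseteq E$ and $u,v\in V$ with $\mathrm{hop}_F(u,v)\le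 h$, some vertex of $\phi(u)$ and some vertex of $\phi(v)$ are connected by $\pi_{G\to T}(F)$; and for all $F'\subseteq E'$ and $u'\in\phi(u)$, $v'\in\phi(v)$ that are connected by $F'$, $\mathrm{hop}_{\pi_{T\to G}(F')}(u,v)\le\beta h$; 3. $|\phi(r)|=1$. It is efficient if $\phi$, $\pi_{G\to T}$ and $\pi_{T\to G}$ are computable in deterministic polynomial time (from the output of the algorithm that constructs the embedding). Theorem. For all constants $k,c\in\mathbb N$ there are a constant $C>0$ and a randomized algorithm which, given $h\ge1$, a complete weighted graph $G$ on $n\ge2$ vertices with weights in $\{1,\dots,n^k\}$ and a root $r\in V$ (numbers written in binary), always halts in time polynomial in the size of its input and, with probability at least $1-n^{-c}$, outputs an efficient $h$-hop repetition tree embedding of $G$ into a weighted rooted tree $T$ with cost stretch $C\log^3 n$ and hop stretch $C\log^3 n$, such that moreover $T$ is well-separated, its weights are at most $n^{O(1)}$, its root is the single element of $\phi(r)$, and $|\phi(v)|\le C\log n$ for every $v\in V$. -/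

import Mathlib

namespace HopRepTree

/-! ### A machine model with a step count

Programs of a WHILE language over binary trees. Every elementary instruction is charged the full
size of the tree it is applied to, so that running times are polynomially related to those of
Turing machines (in particular no value can be larger than the time spent to produce it). -/

/-- Binary trees, the data on which programs operate. -/
inductive Data : Type
  | nil : Data
  | cons : Data → Data → Data

/-- The number of nodes of a binary tree. -/
def Data.size : Data → ℕ
  | .nil => 1
  | .cons a b => a.size + b.size + 1

/-- Programs. Each one describes a (partial) function from `Data` to `Data`. -/
inductive Prog : Type
  /-- return the input -/
  | id : Prog
  /-- return `nil` -/
  | nil : Prog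
  /-- the left subtree of the input (`nil` on input `nil`) -/
  | head : Prog
  /-- the right subtree of the input (`nil` on input `nil`) -/
  | tail : Prog
  /-- run both programs on the input and join the two results -/
  | cons : Prog → Prog → Prog
  /-- `seq p q` runs `p` and then runs `q` on the result -/
  | seq : Prog → Prog → Prog
  /-- `cond c p q` runs `p` if the result of `c` is not `nil`, and `q` otherwise -/
  | cond : Prog → Prog → Prog → Prog
  /-- `loop c p`: as long as `c` does not return `nil` on the current value, apply `p` to it -/
  | loop : Prog → Prog → Prog

/-- `Run p x y t`: the program `p` halts on input `x` with output `y` after time `t`. -/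
inductive Run : Prog → Data → Data → ℕ → Prop
  | id (x : Data) : Run .id x x x.size
  | nil (x : Data) : Run .nil x .nil x.size
  | head_nil : Run .head .nil .nil Data.nil.size
  | head_cons (a b : Data) : Run .head (.cons a b) a (Data.cons a b).size
  | tail_nil : Run .tail .nil .nil Data.nil.size
  | tail_cons (a b : Data) : Run .tail (.cons a b) b (Data.cons a b).size
  | cons {p q : Prog} {x a b : Data} {s t : ℕ} :
      Run p x a s → Run q x b t → Run (.cons p q) x (.cons a b) (s + t + 1)
  | seq {p q : Prog} {x y z : Data} {s t : ℕ} :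
      Run p x y s → Run q y z t → Run (.seq p q) x z (s + t + 1)
  | cond_true {c p q : Prog} {x a b y : Data} {s t : ℕ} :
      Run c x (.cons a b) s → Run p x y t → Run (.cond c p q) x y (s + t + 1)
  | cond_false {c p q : Prog} {x y : Data} {s t : ℕ} :
      Run c x .nil s → Run q x y t → Run (.cond c p q) x y (s + t + 1)
  | loop_stop {c p : Prog} {x : Data} {s : ℕ} :
      Run c x .nil s → Run (.loop c p) x x (s + 1)
  | loop_step {c p : Prog} {x a b y z : Data} {s t u : ℕ} :
      Run c x (.cons a b) s → Run p x y t → Run (.loop c p) y z u →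
        Run (.loop c p) x z (s + t + u + 1)

/-- `p` computes `y` from `x` in at most `time(|x|)` steps. -/
def ComputesIn (p : Prog) (time : Polynomial ℕ) (x y : Data) : Prop :=
  ∃ t, Run p x y t ∧ t ≤ time.eval x.size

/-! ### Encodings -/

def Data.ofBool : Bool → Data
  | false => .nil
  | true => .cons .nil .nil

def Data.ofList : List Data → Data
  | [] => .nil
  | a :: l => .cons a (Data.ofList l)

/-- Natural numbers are written in binary (least significant bit first). -/
def Data.ofNat (k : ℕ) : Data := .ofList (k.bits.map .ofBool)

def Data.ofVec {n : ℕ} (f : Fin n → Data) : Data := .ofList (List.ofFn f)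

def Data.ofMatrix {n : ℕ} (f : Fin n → Fin n → Data) : Data :=
  .ofVec fun i => .ofVec (f i)

/-- A set of vertices, as its characteristic vector. -/
def Data.ofVertexSet {n : ℕ} (U : Finset (Fin n)) : Data :=
  .ofVec fun i => .ofBool (decide (i ∈ U))

/-- A set of edges, as its adjacency matrix. -/
def Data.ofEdgeSet {n : ℕ} (F : Finset (Sym2 (Fin n))) : Data :=
  .ofMatrix fun i j => .ofBool (decide (s(i, j) ∈ F))

/-! ### Weighted graphs and rooted trees -/

/-- A complete weighted graph with vertex set `Fin n` and positive integer edge weights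
(the values of `weight` on the diagonal of `Sym2 (Fin n)` are never used). -/
structure WGraph (n : ℕ) where
  weight : Sym2 (Fin n) → ℕ
  weight_pos : ∀ e, ¬ e.IsDiag → 1 ≤ weight e

/-- The edges of the complete graph on `Fin n`. -/
def completeEdges (n : ℕ) : Finset (Sym2 (Fin n)) :=
  Finset.univ.filter fun e => ¬ e.IsDiag

/-- The weight `w(F)` of a set of edges. -/
def setWeight {n : ℕ} (w : Sym2 (Fin n) → ℕ) (F : Finset (Sym2 (Fin n))) : ℕ :=
  ∑ e ∈ F, w e

/-- The problem instance `(G, r, h)`: hop bound, root and weight matrix. -/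
def WGraph.encode {n : ℕ} (G : WGraph n) (r : Fin n) (h : ℕ) : Data :=
  .cons (.ofNat h) (.cons (.ofNat r)
    (.ofMatrix fun i j => .ofNat (if i = j then 0 else G.weight s(i, j))))

/-- A weighted rooted tree with vertex set `Fin m` and positive integer edge weights. -/
structure WTree (m : ℕ) where
  graph : SimpleGraph (Fin m)
  isTree : graph.IsTree
  root : Fin m
  weight : Sym2 (Fin m) → ℕ
  weight_pos : ∀ e ∈ graph.edgeSet, 1 ≤ weight e

open Classical in
noncomputable def WTree.edges {m : ℕ} (T : WTree m) : Finset (Sym2 (Fin m)) :=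
  Finset.univ.filter fun e => e ∈ T.graph.edgeSet

open Classical in
/-- A rooted tree is written as its root and its weight matrix, with `0` for non-edges. -/
noncomputable def WTree.encode {m : ℕ} (T : WTree m) : Data :=
  .cons (.ofNat T.root)
    (.ofMatrix fun i j => .ofNat (if T.graph.Adj i j then T.weight s(i, j) else 0))

/-- `x` is the parent of `y`. -/
def WTree.IsParent {m : ℕ} (T : WTree m) (x y : Fin m) : Prop :=
  T.graph.Adj x y ∧ T.graph.dist T.root y = T.graph.dist T.root x + 1

/-- The weights on every path from the root downwards are (strictly) decreasing powers of two. -/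
def WTree.WellSeparated {m : ℕ} (T : WTree m) : Prop :=
  (∀ e ∈ T.edges, ∃ j : ℕ, T.weight e = 2 ^ j) ∧
  ∀ x y z, T.IsParent x y → T.IsParent y z → T.weight s(y, z) < T.weight s(x, y)

/-- `hop_F(u, v) ≤ b`: some path from `u` to `v` that uses only edges of `F` has at most `b`
edges. -/
def HopLE {n : ℕ} (F : Finset (Sym2 (Fin n))) (u v : Fin n) (b : ℝ) : Prop :=
  ∃ p : (SimpleGraph.fromEdgeSet (F : Set (Sym2 (Fin n)))).Walk u v, (p.length : ℝ) ≤ b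

/-- `u` and `v` are connected by the edges of `F`. -/
def ConnectedBy {n : ℕ} (F : Finset (Sym2 (Fin n))) (u v : Fin n) : Prop :=
  (SimpleGraph.fromEdgeSet (F : Set (Sym2 (Fin n)))).Reachable u v

/-! ### Repetition tree embeddings -/

/-- `φ` is injective with non-empty values, and its values partition the vertices of the tree. -/
structure IsVertexMapping {n m : ℕ} (φ : Fin n → Finset (Fin m)) : Prop where
  injective : Function.Injective φ
  nonempty : ∀ v, (φ v).Nonempty
  disjoint : ∀ u v, u ≠ v → Disjoint (φ u) (φ v)
  cover : ∀ v', ∃ v, v' ∈ φ v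

/-- `π` maps subsets of `E` to subsets of `E'` and is monotone. -/
structure IsMonotoneEdgeMapping {n m : ℕ} (E : Finset (Sym2 (Fin n)))
    (E' : Finset (Sym2 (Fin m))) (π : Finset (Sym2 (Fin n)) → Finset (Sym2 (Fin m))) : Prop where
  maps : ∀ F ⊆ E, π F ⊆ E'
  mono : ∀ A B, A ⊆ B → B ⊆ E → π A ⊆ π B

/-- `(T, φ, πGT, πTG)` is an `h`-hop repetition tree embedding of `G` with root `r`, cost stretch
`α` and hop stretch `β`. -/
structure IsRepTreeEmbedding {n m : ℕ} (G : WGraph n) (r : Fin n) (h : ℕ) (α β : ℝ)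
    (T : WTree m) (φ : Fin n → Finset (Fin m))
    (πGT : Finset (Sym2 (Fin n)) → Finset (Sym2 (Fin m)))
    (πTG : Finset (Sym2 (Fin m)) → Finset (Sym2 (Fin n))) : Prop where
  vertexMapping : IsVertexMapping φ
  edgeMapping_GT : IsMonotoneEdgeMapping (completeEdges n) T.edges πGT
  edgeMapping_TG : IsMonotoneEdgeMapping T.edges (completeEdges n) πTG
  cost_GT : ∀ F ⊆ completeEdges n,
    (setWeight T.weight (πGT F) : ℝ) ≤ α * setWeight G.weight F
  cost_TG : ∀ F' ⊆ T.edges, setWeight G.weight (πTG F') ≤ setWeight T.weight F'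
  hop_GT : ∀ F ⊆ completeEdges n, ∀ u v, HopLE F u v h →
    ∃ u' ∈ φ u, ∃ v' ∈ φ v, ConnectedBy (πGT F) u' v'
  hop_TG : ∀ F' ⊆ T.edges, ∀ u' v', ConnectedBy F' u' v' →
    ∀ u v, u' ∈ φ u → v' ∈ φ v → HopLE (πTG F') u v (β * h)
  root_mapping : (φ r).card = 1

/-- The three mappings of an embedding that is described by `y` are computed from `y` and their
argument by the given deterministic programs in polynomial time. -/
structure IsEfficient {n m : ℕ} (evalφ evalGT evalTG : Prog) (time : Polynomial ℕ) (y : Data)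
    (T : WTree m) (φ : Fin n → Finset (Fin m))
    (πGT : Finset (Sym2 (Fin n)) → Finset (Sym2 (Fin m)))
    (πTG : Finset (Sym2 (Fin m)) → Finset (Sym2 (Fin n))) : Prop where
  vertex : ∀ v : Fin n, ComputesIn evalφ time (.cons y (.ofNat v)) (.ofVertexSet (φ v))
  edge_GT : ∀ F ⊆ completeEdges n,
    ComputesIn evalGT time (.cons y (.ofEdgeSet F)) (.ofEdgeSet (πGT F))
  edge_TG : ∀ F' ⊆ T.edges,
    ComputesIn evalTG time (.cons y (.ofEdgeSet F')) (.ofEdgeSet (πTG F'))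

/-! ### Randomized algorithms

A randomized algorithm is a program that receives, besides its input `x`, a string of
uniformly random bits whose length is a polynomial in the size of `x`. -/

/-- The input of a randomized algorithm: the proper input together with the random bits. -/
def withBits (x : Data) {N : ℕ} (ρ : Fin N → Bool) : Data :=
  .cons x (.ofVec fun i => .ofBool (ρ i))

/-- The probability of an event over `N` independent fair coin flips. -/
noncomputable def coinProb (N : ℕ) (P : (Fin N → Bool) → Prop) : ℝ :=
  (Nat.card {ρ : Fin N → Bool // P ρ} : ℝ) / 2 ^ N

end HopRepTree

namespace HopRepTree

/-! ### Polynomial-time computable functions on encoded types -/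

/-! The construction is deterministic: it reads no random bits and succeeds with probability one. It
computes O(log n) hierarchical partial partitions of the vertices, turns each into a tree on the
vertex set, and glues these trees at the root. The copies of a vertex are its occurrences in the
different trees.

Each hierarchy arises top down by region growing. The s-th ball of level j has weight radius 2^j (1
+ s/rings)/4 and a hop budget that grows by 2·hop with every ring. A ball becomes a cluster and the
ring around it is deleted. The deleted ring is a buffer: survivors in different clusters of level j
are not joined by a walk with at most 2·hop steps and weight at most 2^j/(4·rings)
(`clusters_eq_of_conn`). Inside a cluster any two vertices are joined by a walk of weight at most
2^j with O(log² n)·hop steps (`clusters_conn`). The cost of a ring is charged to the logarithmic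
growth of the measure of the balls. Since the last ball of level j is the first ball of level j+1,
the charges telescope over all levels, and the deleted measure is at most mass·log(mass)/rings
however many levels there are (`ring_le`, `loss_le`).

The measures follow a multiplicative weights scheme. The weight of a vertex doubles whenever it is
deleted, and the root weighs as much as all other vertices together. At most a quarter of the total
penalty of the others is deleted in a round, so the root always survives (`root_alive`) and the
total penalty grows by a factor of at most 5/4 (`totalPenalty_cons_le`). Hence every vertex is
deleted in fewer than half of the rounds (`lost_lt`), and any two vertices survive together in some
round (`exists_alive`).

In the tree of a hierarchy a surviving vertex is joined to the representative of its first cluster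
that it does not represent itself, with weight 2^level; deleted vertices hang from the root. Levels
increase strictly towards the root, which gives separation and depth O(log n). A tree edge is mapped
to a lightest hop-bounded walk between its ends, so tree paths become walks with O(log³ n)·h edges
(`hop_treeToGraph`). Conversely, F selects the tree edge above x when it contains a path of at most
hop edges leaving the cluster that x represents. Such a path spends weight of order 2^j/rings near
that cluster, and neighbourhoods of distinct clusters are disjoint (`lt_sum_edges`, `same_of_near`).
So each level of each tree costs O(rings)·w(F), and there are O(log² n) pairs of a tree and a level
(`cost_graphToTree`).

For the running time, the machine model is wrapped into a calculus of polynomial-time functions on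
encoded types (`PTF`), in which folding over a list is the only loop. As weights are at most n^k,
internal numbers may be kept in unary. -/

theorem Data.one_le_size (x : Data) : 1 ≤ x.size := by
  cases x <;> simp [Data.size]

theorem Run.size_le {p : Prog} {x y : Data} {t : ℕ} (h : Run p x y t) :
    x.size ≤ t ∧ y.size ≤ t := by
  induction h with
  | nil x => exact ⟨le_rfl, x.one_le_size⟩
  | _ => (try simp only [Data.size] at *); omega

theorem eval_mono (P : Polynomial ℕ) {a b : ℕ} (h : a ≤ b) : P.eval a ≤ P.eval b := by
  simp only [Polynomial.eval_eq_sum, Polynomial.sum]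
  gcongr

/-- `p` maps `x` to `y` in at most `B` steps. -/
def RunsIn (p : Prog) (x y : Data) (B : ℕ) : Prop := ∃ t, Run p x y t ∧ t ≤ B

namespace RunsIn

variable {p q c : Prog} {x y z a b : Data} {s t u : ℕ}

theorem mono (h : RunsIn p x y s) (hst : s ≤ t) : RunsIn p x y t :=
  let ⟨u, hu, hus⟩ := h; ⟨u, hu, hus.trans hst⟩

theorem id (x : Data) : RunsIn .id x x x.size := ⟨_, .id x, le_rfl⟩

theorem nil (x : Data) : RunsIn .nil x .nil x.size := ⟨_, .nil x, le_rfl⟩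

theorem head (a b : Data) : RunsIn .head (.cons a b) a (Data.cons a b).size :=
  ⟨_, .head_cons a b, le_rfl⟩

theorem tail (a b : Data) : RunsIn .tail (.cons a b) b (Data.cons a b).size :=
  ⟨_, .tail_cons a b, le_rfl⟩

theorem cons (h : RunsIn p x a s) (h' : RunsIn q x b t) :
    RunsIn (.cons p q) x (.cons a b) (s + t + 1) :=
  let ⟨_, hu, _⟩ := h; let ⟨_, hv, _⟩ := h'; ⟨_, .cons hu hv, by omega⟩

theorem seq (h : RunsIn p x y s) (h' : RunsIn q y z t) : RunsIn (.seq p q) x z (s + t + 1) :=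
  let ⟨_, hu, _⟩ := h; let ⟨_, hv, _⟩ := h'; ⟨_, .seq hu hv, by omega⟩

theorem cond_true (h : RunsIn c x (.cons a b) s) (h' : RunsIn p x y t) :
    RunsIn (.cond c p q) x y (s + t + 1) :=
  let ⟨_, hu, _⟩ := h; let ⟨_, hv, _⟩ := h'; ⟨_, .cond_true hu hv, by omega⟩

theorem cond_false (h : RunsIn c x .nil s) (h' : RunsIn q x y t) :
    RunsIn (.cond c p q) x y (s + t + 1) :=
  let ⟨_, hu, _⟩ := h; let ⟨_, hv, _⟩ := h'; ⟨_, .cond_false hu hv, by omega⟩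

theorem loop_nil (h : RunsIn c x .nil s) : RunsIn (.loop c p) x x (s + 1) :=
  let ⟨_, hu, _⟩ := h; ⟨_, Run.loop_stop hu, by omega⟩

theorem loop_step (h : RunsIn c x (.cons a b) s) (h' : RunsIn p x y t)
    (h'' : RunsIn (.loop c p) y z u) : RunsIn (.loop c p) x z (s + t + u + 1) :=
  let ⟨_, hu, _⟩ := h; let ⟨_, hv, _⟩ := h'; let ⟨_, hw, _⟩ := h''
  ⟨_, .loop_step hu hv hw, by omega⟩

theorem size_le (h : RunsIn p x y s) : y.size ≤ s :=
  let ⟨_, hu, h⟩ := h; hu.size_le.2.trans h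

end RunsIn

/-- A type whose elements are represented by binary trees. -/
class Enc (α : Type) where
  enc : α → Data


open Enc

instance : Enc Unit := ⟨fun _ => .nil⟩
instance : Enc Bool := ⟨.ofBool⟩
instance {α β : Type} [Enc α] [Enc β] : Enc (α × β) := ⟨fun p => .cons (enc p.1) (enc p.2)⟩
instance {α : Type} [Enc α] : Enc (List α) := ⟨fun l => .ofList (l.map enc)⟩
/-- Natural numbers are written in unary. -/
instance : Enc ℕ := ⟨fun n => enc (List.replicate n ())⟩

/-- The size of the encoding. -/
def esize {α : Type} [Enc α] (a : α) : ℕ := (enc a).size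

/-- `f` is computable in polynomial time. -/
@[fun_prop]
def PTF {α β : Type} [Enc α] [Enc β] (f : α → β) : Prop :=
  ∃ (p : Prog) (P : Polynomial ℕ), ∀ a, RunsIn p (enc a) (enc (f a)) (P.eval (esize a))

/-- `f` is bounded by a polynomial in the size of its argument. -/
@[fun_prop]
def PBd {α : Type} [Enc α] (f : α → ℕ) : Prop :=
  ∃ P : Polynomial ℕ, ∀ a, f a ≤ P.eval (esize a)

section

variable {α β γ δ σ : Type} [Enc α] [Enc β] [Enc γ] [Enc δ] [Enc σ]

theorem enc_pair (a : α) (b : β) : enc (a, b) = .cons (enc a) (enc b) := rfl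

theorem enc_list_nil : enc ([] : List α) = .nil := rfl

theorem enc_list_cons (a : α) (l : List α) : enc (a :: l) = .cons (enc a) (enc l) := rfl

@[simp] theorem esize_pair (a : α) (b : β) : esize (a, b) = esize a + esize b + 1 := rfl

@[simp] theorem esize_nil : esize ([] : List α) = 1 := rfl

@[simp] theorem esize_cons (a : α) (l : List α) : esize (a :: l) = esize a + esize l + 1 := rfl

theorem one_le_esize (a : α) : 1 ≤ esize a := Data.one_le_size _

@[simp] theorem esize_nat (n : ℕ) : esize n = 2 * n + 1 := by
  induction n with
  | zero => rfl
  | succ n ih =>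
    have : esize (n + 1) = esize n + 2 := by
      change (enc (List.replicate (n + 1) ())).size = (enc (List.replicate n ())).size + 2
      rw [List.replicate_succ, enc_list_cons]
      simp only [Data.size, enc]; omega
    omega

namespace PBd

theorem of_le {f g : α → ℕ} (hg : PBd g) (h : ∀ a, f a ≤ g a) : PBd f :=
  let ⟨P, hP⟩ := hg; ⟨P, fun a => (h a).trans (hP a)⟩

@[fun_prop] theorem const (c : ℕ) : PBd (fun _ : α => c) :=
  ⟨Polynomial.C c, fun _ => by simp⟩

theorem esize_self : PBd (fun a : α => esize a) := ⟨Polynomial.X, fun _ => by simp⟩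

@[fun_prop] theorem add {f g : α → ℕ} (hf : PBd f) (hg : PBd g) : PBd (fun a => f a + g a) :=
  let ⟨P, hP⟩ := hf; let ⟨Q, hQ⟩ := hg
  ⟨P + Q, fun _ => by simpa using add_le_add (hP _) (hQ _)⟩

@[fun_prop] theorem mul {f g : α → ℕ} (hf : PBd f) (hg : PBd g) : PBd (fun a => f a * g a) :=
  let ⟨P, hP⟩ := hf; let ⟨Q, hQ⟩ := hg
  ⟨P * Q, fun _ => by simpa using Nat.mul_le_mul (hP _) (hQ _)⟩

theorem comp_poly {f : α → ℕ} (hf : PBd f) (Q : Polynomial ℕ) : PBd (fun a => Q.eval (f a)) :=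
  let ⟨P, hP⟩ := hf
  ⟨Q.comp P, fun _ => by simpa using eval_mono Q (hP _)⟩

end PBd

namespace PTF

@[fun_prop] theorem esize_bd {f : α → β} (hf : PTF f) : PBd (fun a => esize (f a)) :=
  let ⟨_, P, h⟩ := hf; ⟨P, fun a => (h a).size_le⟩

@[fun_prop] theorem natBd {f : α → ℕ} (hf : PTF f) : PBd f :=
  hf.esize_bd.of_le fun _ => by simp; omega

/-- The running time may be estimated by any polynomially bounded function. -/
theorem of_bd {f : α → β} (p : Prog) (B : α → ℕ) (hB : PBd B)
    (h : ∀ a, RunsIn p (enc a) (enc (f a)) (B a)) : PTF f :=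
  let ⟨P, hP⟩ := hB; ⟨p, P, fun a => (h a).mono (hP a)⟩

theorem exists_bd {f : α → β} (hf : PTF f) :
    ∃ p B, PBd B ∧ ∀ a, RunsIn p (enc a) (enc (f a)) (B a) :=
  let ⟨p, P, h⟩ := hf; ⟨p, _, ⟨P, fun _ => le_rfl⟩, h⟩

/-- Programs see only encodings, so values of different types with the same tree are
interchangeable. This identifies numbers with lists of units and structures with tuples, and lets a
function be replaced by an equal one that is easier to program. -/
theorem of_enc_eq {f : α → β} {g : α → γ} (hf : PTF f) (h : ∀ a, enc (f a) = enc (g a)) :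
    PTF g :=
  let ⟨p, P, hP⟩ := hf; ⟨p, P, fun a => by rw [← h]; exact hP a⟩

@[fun_prop] theorem id : PTF (fun a : α => a) :=
  of_bd .id _ PBd.esize_self fun _ => .id _

@[fun_prop] theorem comp {f : β → γ} {g : α → β} (hf : PTF f) (hg : PTF g) :
    PTF (fun a => f (g a)) := by
  obtain ⟨p, P, hp⟩ := hf
  obtain ⟨q, B, hB, hq⟩ := hg.exists_bd
  exact of_bd (.seq q p) (fun a => B a + P.eval (esize (g a)) + 1)
    ((hB.add (hg.esize_bd.comp_poly P)).add (.const 1)) fun a => (hq a).seq (hp _)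

@[fun_prop] theorem pair {f : α → β} {g : α → γ} (hf : PTF f) (hg : PTF g) :
    PTF (fun a => (f a, g a)) := by
  obtain ⟨p, B, hB, hp⟩ := hf.exists_bd
  obtain ⟨q, D, hD, hq⟩ := hg.exists_bd
  exact of_bd (.cons p q) (fun a => B a + D a + 1) (by fun_prop) fun a => (hp a).cons (hq a)

@[fun_prop] theorem fst {f : α → β × γ} (hf : PTF f) : PTF (fun a => (f a).1) :=
  comp (f := Prod.fst) (of_bd .head _ PBd.esize_self fun _ => .head _ _) hf

@[fun_prop] theorem snd {f : α → β × γ} (hf : PTF f) : PTF (fun a => (f a).2) :=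
  comp (f := Prod.snd) (of_bd .tail _ PBd.esize_self fun _ => .tail _ _) hf

theorem exists_const (d : Data) : ∃ (p : Prog) (P : Polynomial ℕ), ∀ x : Data,
    RunsIn p x d (P.eval x.size) := by
  induction d with
  | nil => exact ⟨.nil, .X, fun x => by simpa using RunsIn.nil x⟩
  | cons a b iha ihb =>
    obtain ⟨p, P, hp⟩ := iha
    obtain ⟨q, Q, hq⟩ := ihb
    exact ⟨.cons p q, P + Q + 1, fun x => by simpa using (hp x).cons (hq x)⟩

@[fun_prop] theorem const (b : β) : PTF (fun _ : α => b) :=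
  let ⟨p, P, hp⟩ := exists_const (enc b); ⟨p, P, fun _ => hp _⟩

@[fun_prop] theorem cond {c : α → Bool} {f g : α → β} (hc : PTF c) (hf : PTF f) (hg : PTF g) :
    PTF (fun a => cond (c a) (f a) (g a)) := by
  obtain ⟨r, A, hA, hr⟩ := hc.exists_bd
  obtain ⟨p, B, hB, hp⟩ := hf.exists_bd
  obtain ⟨q, D, hD, hq⟩ := hg.exists_bd
  refine of_bd (.cond r p q) (fun a => A a + (B a + D a) + 1) (by fun_prop) fun a => ?_
  have h := hr a
  cases hca : c a
  · rw [hca] at h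
    exact (RunsIn.cond_false h (hq a)).mono (by omega)
  · rw [hca] at h
    exact (RunsIn.cond_true (a := .nil) (b := .nil) h (hp a)).mono (by omega)

@[fun_prop] theorem cons {f : α → β} {g : α → List β} (hf : PTF f) (hg : PTF g) :
    PTF (fun a => f a :: g a) :=
  (pair hf hg).of_enc_eq fun _ => rfl

/-- A non-empty list is encoded as the pair of its head and tail. So the program for `l` serves both
as the test and, paired with the input, as the argument of the second branch. -/
theorem listCase {l : α → List β} {f : α → γ} {g : α → β → List β → γ} (hl : PTF l) (hf : PTF f)
    (hg : PTF fun p : α × β × List β => g p.1 p.2.1 p.2.2) :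
    PTF (fun a => match l a with | [] => f a | b :: m => g a b m) := by
  obtain ⟨r, A, hA, hr⟩ := hl.exists_bd
  obtain ⟨p, B, hB, hp⟩ := hf.exists_bd
  obtain ⟨q, Q, hq⟩ := hg
  refine of_bd (.cond r (.seq (.cons .id r) q) p)
    (fun a => A a + (B a + ((esize a + A a + 1) +
      Q.eval (esize a + esize (l a) + 1) + 1)) + 1)
    ?_ fun a => ?_
  · have h1 := ((PBd.esize_self (α := α)).add hl.esize_bd).add (.const 1)
    have := h1.comp_poly Q
    have h2 := PBd.esize_self (α := α)
    exact (hA.add (hB.add ((((h2.add hA).add (.const 1)).add this).add (.const 1)))).add (.const 1)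
  · have h := hr a
    have h1 := hq
    cases hla : l a with
    | nil =>
      rw [hla] at h
      exact (RunsIn.cond_false h (hp a)).mono (by omega)
    | cons b m =>
      rw [hla] at h
      exact (RunsIn.cond_true h (((RunsIn.id _).cons h).seq (hq (a, b, m)))).mono (by
        have : Q.eval (esize a + esize (b :: m) + 1) = Q.eval (esize (a, b, m)) := rfl
        have : (enc a).size = esize a := rfl
        omega)

end PTF

theorem RunsIn.loop_iterate {c p : Prog} {T : ℕ} (k : ℕ) (st : ℕ → Data)
    (hstep : ∀ i < k, (∃ a b s, RunsIn c (st i) (.cons a b) s ∧ s ≤ T) ∧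
      RunsIn p (st i) (st (i + 1)) T)
    (hend : RunsIn c (st k) .nil T) : RunsIn (.loop c p) (st 0) (st k) ((k + 1) * (2 * T + 1)) := by
  induction k generalizing st with
  | zero => exact hend.loop_nil.mono (by omega)
  | succ k ih =>
    obtain ⟨⟨a, b, s, h1, hs⟩, h2⟩ := hstep 0 (by omega)
    have h3 := ih (fun i => st (i + 1)) (fun i hi => hstep (i + 1) (by omega)) hend
    exact (h1.loop_step h2 h3).mono (by
      have : (k + 1 + 1) * (2 * T + 1) = (k + 1) * (2 * T + 1) + (2 * T + 1) := by ring
      omega)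

theorem esize_drop_le (l : List α) (i : ℕ) : esize (l.drop i) ≤ esize l := by
  induction l generalizing i with
  | nil => simp
  | cons a l ih =>
    cases i with
    | zero => simp
    | succ i => have := ih i; simp; omega

theorem length_le_esize (l : List α) : l.length ≤ esize l := by
  induction l with
  | nil => simp
  | cons a l ih => simp; omega

theorem esize_le_of_mem {l : List α} {a : α} (h : a ∈ l) : esize a ≤ esize l := by
  induction l with
  | nil => simp at h
  | cons b l ih =>
    rcases List.mem_cons.1 h with rfl | h
    · simp; omega
    · have := ih h; simp; omega

/-- Iterating a polynomial-time step may let the state grow exponentially. The polynomial bound `S`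
on all intermediate states excludes this; then the number of iterations and the cost of each are
polynomial. -/
theorem PTF.foldl {l : α → List β} {s : α → σ} {f : α → σ → β → σ} (hl : PTF l) (hs : PTF s)
    (hf : PTF fun p : α × σ × β => f p.1 p.2.1 p.2.2) (S : α → ℕ) (hS : PBd S)
    (hb : ∀ a (i : ℕ), esize (((l a).take i).foldl (f a) (s a)) ≤ S a) :
    PTF (fun a => (l a).foldl (f a) (s a)) := by
  obtain ⟨q, Q, hq⟩ := hf
  obtain ⟨r, A, hA, hr⟩ := hl.exists_bd
  obtain ⟨u, B, hB, hu⟩ := hs.exists_bd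
  -- The loop variable is (remaining list, (argument, accumulator)). Its head is the remaining list,
  -- which is `nil` exactly when the loop has to stop, so `.head` is the loop test.
  let body : Prog := .cons (.seq .head .tail) (.cons (.seq .tail .head)
    (.seq (.cons (.seq .tail .head) (.cons (.seq .tail .tail) (.seq .head .head))) q))
  -- bound on the size of the loop variable
  let Z : α → ℕ := fun a => esize (l a) + (esize a + S a + 1) + 1
  have hZ : PBd Z := (hl.esize_bd.add ((PBd.esize_self.add hS).add (.const 1))).add (.const 1)
  let T : α → ℕ := fun a => 20 * Z a + 20 + Q.eval (Z a)
  have hT : PBd T := by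
    have := hZ.comp_poly Q
    exact (((PBd.const 20).mul hZ).add (.const 20)).add this
  refine PTF.of_bd (.seq (.seq (.cons r (.cons .id u)) (.loop .head body)) (.seq .tail .tail))
    (fun a => ((A a + (esize a + B a + 1) + 1) + (esize (l a) + 1) * (2 * T a + 1) + 1) +
      (2 * Z a + 1) + 1) ?_ fun a => ?_
  · have := (PBd.esize_self (α := α))
    have := hl.esize_bd
    fun_prop
  · let st : ℕ → Data := fun i =>
      .cons (enc ((l a).drop i)) (.cons (enc a) (enc (((l a).take i).foldl (f a) (s a))))
    have hst : ∀ i, (st i).size ≤ Z a := fun i => by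
      have h1 := esize_drop_le (l a) i
      have h2 := hb a i
      change esize ((l a).drop i) + (esize a + esize (((l a).take i).foldl (f a) (s a)) + 1) + 1 ≤
        esize (l a) + (esize a + S a + 1) + 1
      omega
    have h0 : RunsIn (.cons r (.cons .id u)) (enc a) (st 0) (A a + (esize a + B a + 1) + 1) :=
      (hr a).cons ((RunsIn.id _).cons (hu a))
    have hloop : RunsIn (.loop .head body) (st 0) (st (l a).length)
        (((l a).length + 1) * (2 * T a + 1)) := by
      refine RunsIn.loop_iterate _ st (fun i hi => ?_) ?_
      · have hd : (l a).drop i = (l a)[i] :: (l a).drop (i + 1) := List.drop_eq_getElem_cons hi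
        have hsz := hst i
        have ht : ((l a).take (i + 1)).foldl (f a) (s a) =
            f a (((l a).take i).foldl (f a) (s a)) (l a)[i] := by
          rw [List.take_succ_eq_append_getElem hi, List.foldl_append]; rfl
        have hst' : st i = .cons (.cons (enc (l a)[i]) (enc ((l a).drop (i + 1))))
            (.cons (enc a) (enc (((l a).take i).foldl (f a) (s a)))) := by
          simp only [st, hd, enc_list_cons]
        have hst'' : st (i + 1) = .cons (enc ((l a).drop (i + 1)))
            (.cons (enc a) (enc (f a (((l a).take i).foldl (f a) (s a)) (l a)[i]))) := by
          simp only [st, ht]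
        rw [hst'] at hsz ⊢
        rw [hst'']
        simp only [Data.size] at hsz
        refine ⟨⟨_, _, _, RunsIn.head _ _, ?_⟩, ?_⟩
        · simp only [Data.size, T]; omega
        · have hq' := hq (a, ((l a).take i).foldl (f a) (s a), (l a)[i])
          refine (RunsIn.cons ((RunsIn.head _ _).seq (RunsIn.tail _ _))
            (RunsIn.cons ((RunsIn.tail _ _).seq (RunsIn.head _ _))
            (RunsIn.seq (RunsIn.cons ((RunsIn.tail _ _).seq (RunsIn.head _ _))
              (RunsIn.cons ((RunsIn.tail _ _).seq (RunsIn.tail _ _))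
                ((RunsIn.head _ _).seq (RunsIn.head _ _)))) hq'))).mono ?_
          have hQ : Q.eval (esize (a, ((l a).take i).foldl (f a) (s a), (l a)[i])) ≤
              Q.eval (Z a) := eval_mono Q (by
            change (enc a).size + ((enc (((l a).take i).foldl (f a) (s a))).size +
              (enc (l a)[i]).size + 1) + 1 ≤ _
            omega)
          simp only [Data.size, T]; omega
      · have hsz := hst (l a).length
        have : st (l a).length = .cons .nil
            (.cons (enc a) (enc (((l a).take (l a).length).foldl (f a) (s a)))) := by
          simp only [st, List.drop_length, enc_list_nil]
        rw [this] at hsz ⊢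
        exact (RunsIn.head _ _).mono (by simp only [T]; omega)
    have hfin : RunsIn (.seq .tail .tail) (st (l a).length) (enc ((l a).foldl (f a) (s a)))
        (2 * Z a + 1) := by
      have hsz := hst (l a).length
      have := (RunsIn.tail (enc ((l a).drop (l a).length)) (.cons (enc a)
        (enc (((l a).take (l a).length).foldl (f a) (s a))))).seq (RunsIn.tail _ _)
      have h2 : (l a).foldl (f a) (s a) = ((l a).take (l a).length).foldl (f a) (s a) := by
        rw [List.take_length]
      rw [h2]
      refine this.mono ?_
      simp only [st, Data.size] at hsz ⊢
      omega
    refine ((h0.seq hloop).seq hfin).mono ?_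
    have : ((l a).length + 1) * (2 * T a + 1) ≤ (esize (l a) + 1) * (2 * T a + 1) :=
      Nat.mul_le_mul_right _ (by have := length_le_esize (l a); omega)
    omega

end

end HopRepTree

/-! ### Polynomial-time operations on lists and unary numbers -/

namespace HopRepTree

open Enc

section

variable {α β γ δ σ : Type} [Enc α] [Enc β] [Enc γ] [Enc δ] [Enc σ]

theorem esize_append (l m : List α) : esize (l ++ m) + 1 = esize l + esize m := by
  induction l with
  | nil => simp; omega
  | cons a l ih => simp; omega

theorem esize_reverse (l : List α) : esize l.reverse = esize l := by
  induction l with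
  | nil => simp
  | cons a l ih => have := esize_append l.reverse [a]; simp at *; omega

theorem esize_take_le (l : List α) (i : ℕ) : esize (l.take i) ≤ esize l := by
  have := esize_append (l.take i) (l.drop i)
  have := one_le_esize (l.drop i)
  rw [List.take_append_drop] at *; omega

theorem esize_list_le {l : List α} {m k : ℕ} (hl : l.length ≤ m) (h : ∀ a ∈ l, esize a ≤ k) :
    esize l ≤ m * (k + 1) + 1 := by
  induction l generalizing m with
  | nil => simp
  | cons a l ih =>
    obtain ⟨m, rfl⟩ : ∃ m', m = m' + 1 := ⟨m - 1, by simp at hl; omega⟩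
    have h1 := ih (m := m) (by simpa using hl) fun b hb => h b (by simp [hb])
    have h2 := h a (by simp)
    simp only [esize_cons]
    have : (m + 1) * (k + 1) = m * (k + 1) + (k + 1) := by ring
    omega

namespace PTF

@[fun_prop] theorem not {f : α → Bool} (hf : PTF f) : PTF (fun a => !f a) :=
  (cond hf (const false) (const true)).of_enc_eq fun a => by cases f a <;> rfl

@[fun_prop] theorem and {f g : α → Bool} (hf : PTF f) (hg : PTF g) : PTF (fun a => f a && g a) :=
  (cond hf hg (const false)).of_enc_eq fun a => by cases f a <;> rfl

@[fun_prop] theorem or {f g : α → Bool} (hf : PTF f) (hg : PTF g) : PTF (fun a => f a || g a) :=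
  (cond hf (const true) hg).of_enc_eq fun a => by cases f a <;> rfl

@[fun_prop] theorem reverse {l : α → List β} (hl : PTF l) : PTF (fun a => (l a).reverse) := by
  refine (foldl (σ := List β) (s := fun _ => []) (f := fun _ s b => b :: s) hl (const _)
    (by fun_prop) (fun a => esize (l a)) (by fun_prop) fun a i => ?_).of_enc_eq fun a => ?_
  · simpa [List.foldl_flip_cons_eq_append, esize_reverse] using esize_take_le _ _
  · simp

@[fun_prop] theorem append {l m : α → List β} (hl : PTF l) (hm : PTF m) :
    PTF (fun a => l a ++ m a) := by
  refine (foldl (σ := List β) (s := m) (f := fun _ s b => b :: s) hl.reverse hm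
    (by fun_prop) (fun a => esize (l a) + esize (m a)) (by fun_prop) fun a i => ?_).of_enc_eq
    fun a => ?_
  · have h1 := esize_append ((l a).reverse.take i).reverse (m a)
    have h2 := esize_take_le (l a).reverse i
    rw [esize_reverse] at *
    simp only [List.foldl_flip_cons_eq_append, List.map_id']; omega
  · simp

theorem flatMap {l : α → List β} {g : α → β → List γ} (hl : PTF l)
    (hg : PTF fun p : α × β => g p.1 p.2) : PTF (fun a => (l a).flatMap (g a)) := by
  obtain ⟨P, hP⟩ := hg.esize_bd
  have key : ∀ a (l : List β) (s : List γ),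
      l.foldl (fun s b => s ++ g a b) s = s ++ l.flatMap (g a) := fun a l => by
    induction l with
    | nil => simp
    | cons b l ih => simp [ih]
  -- A list has at most `esize` many members, and each contributes a block whose size is bounded
  -- uniformly by `P`.
  have hB := (hl.esize_bd.mul
    (((PBd.esize_self.add hl.esize_bd).add (.const 1)).comp_poly P)).add (.const 1)
  refine (foldl (σ := List γ) (s := fun _ => []) (f := fun a s b => s ++ g a b) hl (const _)
    ?_ _ hB fun a i => ?_).of_enc_eq fun a => ?_
  · exact append (by fun_prop) (hg.comp (g := fun p : α × List γ × β => (p.1, p.2.2)) (by fun_prop))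
  · rw [key, List.nil_append]
    have hm : ∀ b ∈ l a, esize (g a b) ≤ P.eval (esize a + esize (l a) + 1) := fun b hb =>
      (hP (a, b)).trans (eval_mono P (by have := esize_le_of_mem hb; simp; omega))
    have : ∀ L : List β, (∀ b ∈ L, b ∈ l a) → esize (L.flatMap (g a)) ≤
        L.length * P.eval (esize a + esize (l a) + 1) + 1 := fun L => by
      induction L with
      | nil => simp
      | cons b L ih =>
        intro h
        have h1 := ih fun c hc => h c (by simp [hc])
        have h2 := hm b (h b (by simp))
        have h3 := esize_append (g a b) (L.flatMap (g a))
        simp only [List.flatMap_cons, List.length_cons, add_mul]; omega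
    refine (this _ fun b hb => List.mem_of_mem_take hb).trans ?_
    gcongr
    exact ((List.length_take_le' _ _).trans (length_le_esize _))
  · rw [key, List.nil_append]

theorem map {l : α → List β} {g : α → β → γ} (hl : PTF l)
    (hg : PTF fun p : α × β => g p.1 p.2) : PTF (fun a => (l a).map (g a)) :=
  (flatMap (g := fun a b => [g a b]) hl (by fun_prop)).of_enc_eq fun a => by
    rw [List.map_eq_flatMap]

theorem filter {l : α → List β} {p : α → β → Bool} (hl : PTF l)
    (hp : PTF fun q : α × β => p q.1 q.2) : PTF (fun a => (l a).filter (p a)) :=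
  (flatMap (g := fun a b => bif p a b then [b] else []) hl (by fun_prop)).of_enc_eq fun a => by
    congr 1
    induction l a with
    | nil => rfl
    | cons b l ih => rw [List.flatMap_cons, ih, List.filter_cons]; cases p a b <;> rfl

@[fun_prop] theorem isEmpty {l : α → List β} (hl : PTF l) : PTF (fun a => (l a).isEmpty) :=
  (listCase (g := fun _ _ _ => false) hl (const true) (const _)).of_enc_eq fun a => by
    cases l a <;> rfl

@[fun_prop] theorem headD {l : α → List β} {d : α → β} (hl : PTF l) (hd : PTF d) :
    PTF (fun a => (l a).headD (d a)) :=
  (listCase (g := fun _ b _ => b) hl hd (by fun_prop)).of_enc_eq fun a => by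
    cases l a <;> rfl

@[fun_prop] theorem tail {l : α → List β} (hl : PTF l) : PTF (fun a => (l a).tail) :=
  (listCase (g := fun _ _ b => b) hl (const []) (by fun_prop)).of_enc_eq fun a => by
    cases l a <;> rfl

theorem any {l : α → List β} {p : α → β → Bool} (hl : PTF l)
    (hp : PTF fun q : α × β => p q.1 q.2) : PTF (fun a => (l a).any (p a)) :=
  (filter hl hp).isEmpty.not.of_enc_eq fun a => by
    congr 1
    induction l a with
    | nil => rfl
    | cons b l ih => rw [List.filter_cons, List.any_cons, ← ih]; cases p a b <;> simp

theorem all {l : α → List β} {p : α → β → Bool} (hl : PTF l)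
    (hp : PTF fun q : α × β => p q.1 q.2) : PTF (fun a => (l a).all (p a)) :=
  (any (p := fun a b => !p a b) hl (by fun_prop)).not.of_enc_eq fun a => by
    rw [List.all_eq_not_any_not]

theorem find {l : α → List β} {p : α → β → Bool} {d : α → β} (hl : PTF l)
    (hp : PTF fun q : α × β => p q.1 q.2) (hd : PTF d) :
    PTF (fun a => ((l a).find? (p a)).getD (d a)) :=
  (headD (filter hl hp) hd).of_enc_eq fun a => by
    rw [← List.head?_filter, List.headD_eq_head?_getD]

/-! Arithmetic -/

theorem ofUnits {l : α → List Unit} (hl : PTF l) : PTF (fun a => (l a).length) :=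
  hl.of_enc_eq fun a => by
    change _ = enc (List.replicate _ ())
    rw [← List.eq_replicate_length.2 (fun _ _ => rfl)]

theorem toUnits {f : α → ℕ} (hf : PTF f) : PTF (fun a => List.replicate (f a) ()) :=
  hf.of_enc_eq fun _ => rfl

/-- A unary number is a list of units, so iteration is a fold over it. -/
theorem iterate {k : α → ℕ} {s : α → σ} {f : α → σ → σ} (hk : PTF k) (hs : PTF s)
    (hf : PTF fun p : α × σ => f p.1 p.2) (S : α → ℕ) (hS : PBd S)
    (hb : ∀ a (i : ℕ), i ≤ k a → esize ((f a)^[i] (s a)) ≤ S a) :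
    PTF (fun a => (f a)^[k a] (s a)) := by
  have key : ∀ a (i : ℕ) (s : σ), (List.replicate i ()).foldl (fun s _ => f a s) s = (f a)^[i] s :=
    fun a i => by
      induction i with
      | zero => simp
      | succ i ih => intro s; simp [List.replicate_succ, ih]
  refine (foldl (f := fun a s (_ : Unit) => f a s) hk.toUnits hs ?_ S hS fun a i => ?_).of_enc_eq
    fun a => ?_
  · exact hf.comp (g := fun p : α × σ × Unit => (p.1, p.2.1)) (by fun_prop)
  · rw [List.take_replicate, key]; exact hb a _ (by omega)
  · rw [key]

@[fun_prop] theorem length {l : α → List β} (hl : PTF l) : PTF (fun a => (l a).length) :=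
  (ofUnits (map (g := fun _ _ => ()) hl (const _))).of_enc_eq fun a => by simp

@[fun_prop] theorem add {f g : α → ℕ} (hf : PTF f) (hg : PTF g) : PTF (fun a => f a + g a) :=
  (ofUnits (append hf.toUnits hg.toUnits)).of_enc_eq fun a => by simp

@[fun_prop] theorem mul {f g : α → ℕ} (hf : PTF f) (hg : PTF g) : PTF (fun a => f a * g a) :=
  (ofUnits (flatMap (g := fun a _ => List.replicate (g a) ()) hf.toUnits
    (hg.toUnits.comp (g := fun p : α × Unit => p.1) (by fun_prop)))).of_enc_eq fun a => by simp

@[fun_prop] theorem drop {l : α → List β} {k : α → ℕ} (hl : PTF l) (hk : PTF k) :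
    PTF (fun a => (l a).drop (k a)) := by
  have key : ∀ (i : ℕ) (l : List β), List.tail^[i] l = l.drop i := fun i => by
    induction i with
    | zero => simp
    | succ i ih => intro l; rw [Function.iterate_succ_apply, ih, List.drop_tail]
  refine (iterate (f := fun _ l => l.tail) hk hl (by fun_prop) (fun a => esize (l a)) (by fun_prop)
    fun a i _ => ?_).of_enc_eq fun a => ?_
  · exact (congrArg esize (key i (l a))).trans_le (esize_drop_le _ _)
  · exact congrArg enc (key _ _)

@[fun_prop] theorem sub {f g : α → ℕ} (hf : PTF f) (hg : PTF g) : PTF (fun a => f a - g a) :=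
  (ofUnits (drop hf.toUnits hg)).of_enc_eq fun a => by simp

@[fun_prop] theorem ble {f g : α → ℕ} (hf : PTF f) (hg : PTF g) :
    PTF (fun a => Nat.ble (f a) (g a)) :=
  (isEmpty (sub hf hg).toUnits).of_enc_eq fun a => by
    congr 1
    rw [Bool.eq_iff_iff]; simp; omega

@[fun_prop] theorem beq {f g : α → ℕ} (hf : PTF f) (hg : PTF g) :
    PTF (fun a => Nat.beq (f a) (g a)) :=
  (and (ble hf hg) (ble hg hf)).of_enc_eq fun a => by
    congr 1
    rw [Bool.eq_iff_iff]; simp; omega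

@[fun_prop] theorem min {f g : α → ℕ} (hf : PTF f) (hg : PTF g) :
    PTF (fun a => Min.min (f a) (g a)) :=
  (cond (ble hf hg) hf hg).of_enc_eq fun a => by
    rw [Bool.cond_eq_ite]; simp [min_def]

@[fun_prop] theorem getD {l : α → List β} {k : α → ℕ} {d : α → β} (hl : PTF l) (hk : PTF k)
    (hd : PTF d) : PTF (fun a => (l a).getD (k a) (d a)) :=
  (headD (drop hl hk) hd).of_enc_eq fun a => by
    rw [List.headD_eq_head?_getD, List.head?_drop, List.getD_eq_getElem?_getD]

@[fun_prop] theorem range {k : α → ℕ} (hk : PTF k) : PTF (fun a => List.range (k a)) := by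
  have key : ∀ i : ℕ, (fun l : List ℕ => l ++ [l.length])^[i] [] = List.range i := fun i => by
    induction i with
    | zero => simp
    | succ i ih => rw [Function.iterate_succ_apply', ih, List.range_succ]; simp
  refine (iterate (s := fun _ => []) (f := fun _ (l : List ℕ) => l ++ [l.length]) hk (const _)
    (by fun_prop) (fun a => k a * (2 * k a + 1 + 1) + 1) (by fun_prop)
    fun a i hi => ?_).of_enc_eq fun a => ?_
  · rw [key]
    exact esize_list_le (by simpa) fun b hb => by simp at hb ⊢; omega
  · rw [key]

@[fun_prop] theorem sum {l : α → List ℕ} (hl : PTF l) : PTF (fun a => (l a).sum) :=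
  (ofUnits (flatMap (g := fun _ b => List.replicate b ()) hl (toUnits (by fun_prop)))).of_enc_eq
    fun a => by simp [List.length_flatMap]

@[fun_prop] theorem replicate {k : α → ℕ} {b : α → β} (hk : PTF k) (hb : PTF b) :
    PTF (fun a => List.replicate (k a) (b a)) :=
  (map (g := fun a _ => b a) hk.range
    (hb.comp (g := fun p : α × ℕ => p.1) (by fun_prop))).of_enc_eq fun a => by simp

@[fun_prop] theorem pow {f : α → ℕ} (hf : PTF f) (k : ℕ) : PTF (fun a => f a ^ k) := by
  induction k with
  | zero => simpa using const 1
  | succ k ih => simp only [pow_succ]; fun_prop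

end PTF

end

end HopRepTree

namespace HopRepTree

open Enc

/-! ### The algorithm -/

/-- The entry of a matrix, `0` outside of its range. -/
def entry (M : List (List ℕ)) (u v : ℕ) : ℕ := (M.getD u []).getD v 0

/-- The entry of a Boolean matrix, `false` outside of its range. -/
def bentry (M : List (List Bool)) (u v : ℕ) : Bool := (M.getD u []).getD v false

/-- The consecutive pairs of a list. -/
def steps (l : List ℕ) : List (ℕ × ℕ) :=
  (List.range (l.length - 1)).map fun i => (l.getD i 0, l.getD (i + 1) 0)

/-- The weight of a walk, which is given by the list of its vertices. -/
def walkWt (M : List (List ℕ)) (l : List ℕ) : ℕ := ((steps l).map fun p => entry M p.1 p.2).sum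

/-- An element of `l` that is `r`-related to all of them. -/
def pick {α : Type} (r : α → α → Bool) (l : List α) (d : α) : α :=
  (l.find? fun x => l.all (r x)).getD d

/-- The lightest walk to `v` that extends one of the walks in `T` by a last step. -/
def extendWalk (M : List (List ℕ)) (n : ℕ) (T : List (List ℕ)) (v : ℕ) : List ℕ :=
  pick (fun p q => Nat.ble (walkWt M p) (walkWt M q))
    ((List.range n).map fun u => v :: T.getD u []) []

/-- Lightest walks from `c` to all vertices among those with `i + 1` steps (where a step may stay
at the same vertex), as reversed lists of vertices. -/
def walkTable (M : List (List ℕ)) (n c i : ℕ) : List (List ℕ) :=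
  (fun T => (List.range n).map (extendWalk M n T))^[i] ((List.range n).map fun v => [v, c])

def lightWalk (M : List (List ℕ)) (n c i v : ℕ) : List ℕ := (walkTable M n c i).getD v []

/-- The least weight of a walk of at most `i + 1` steps. -/
def hopDist (M : List (List ℕ)) (n c i v : ℕ) : ℕ := walkWt M (lightWalk M n c i v)

/-- `2 ^ x`, truncated at `cap`. -/
def pow2 (cap x : ℕ) : ℕ := (fun y => min (2 * y) cap)^[x] 1

/-- A problem instance, together with parameters of the algorithm. -/
structure Inst where
  n : ℕ
  root : ℕ
  hop : ℕ
  ell : ℕ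
  levels : ℕ
  cap : ℕ
  mat : List (List ℕ)

instance : Enc Inst :=
  ⟨fun I => enc (I.n, I.root, I.hop, I.ell, I.levels, I.cap, I.mat)⟩

namespace Inst

def others (I : Inst) : List ℕ := (List.range I.n).filter fun v => !Nat.beq v I.root

/-- The root comes first because representatives are found by searching this list; thus the root
represents every cluster that contains it. -/
def verts (I : Inst) : List ℕ := I.root :: I.others

/-- The number of concentric balls that are inspected at every level. -/
def rings (I : Inst) : ℕ := 64 * I.ell

/-- The number of trees. -/
def rounds (I : Inst) : ℕ := 6 * I.ell

/-- `v` lies in the `s`-th ball of level `j` around `c`. -/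
def inBall (I : Inst) (j c s v : ℕ) : Bool :=
  Nat.ble (4 * I.rings * hopDist I.mat I.n c ((j * I.rings + s) * (2 * I.hop)) v)
    (pow2 I.cap j * (I.rings + s))

/-- The measure of the part of a ball inside `R`. -/
def ballMass (I : Inst) (μ : List ℕ) (j : ℕ) (R : List ℕ) (c s : ℕ) : ℕ :=
  ((R.filter (I.inBall j c s)).map fun v => μ.getD v 0).sum

/-- With a heaviest innermost ball as the starting point, the measure of that ball bounds all
innermost balls inside the new cluster. The recursion over levels needs this. -/
def center (I : Inst) (μ : List ℕ) (j : ℕ) (R : List ℕ) : ℕ :=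
  pick (fun c c' => Nat.ble (I.ballMass μ j R c' 0) (I.ballMass μ j R c 0)) R 0

/-- The growth ratio of consecutive balls is minimized; the comparison of two ratios is multiplied
out. -/
def radius (I : Inst) (μ : List ℕ) (j : ℕ) (R : List ℕ) (c : ℕ) : ℕ :=
  pick (fun s s' => Nat.ble (I.ballMass μ j R c (s + 1) * I.ballMass μ j R c s')
    (I.ballMass μ j R c (s' + 1) * I.ballMass μ j R c s)) (List.range I.rings) 0

/-- Move the `s`-th ball around `c` to the list of clusters and delete the ring around it. -/
def carveAt (I : Inst) (j c s : ℕ) (st : List ℕ × List (List ℕ)) : List ℕ × List (List ℕ) :=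
  (st.1.filter fun v => !I.inBall j c s v && !I.inBall j c (s + 1) v,
    st.1.filter (I.inBall j c s) :: st.2)

def carveStep (I : Inst) (μ : List ℕ) (j : ℕ) (st : List ℕ × List (List ℕ)) :
    List ℕ × List (List ℕ) :=
  bif st.1.isEmpty then st else
    I.carveAt j (I.center μ j st.1) (I.radius μ j st.1 (I.center μ j st.1)) st

/-- The clusters of level `j` into which `R` is decomposed. -/
def carve (I : Inst) (μ : List ℕ) (j : ℕ) (R : List ℕ) : List (List ℕ) :=
  ((I.carveStep μ j)^[R.length] (R, [])).2.filter fun P => !P.isEmpty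

/-- New levels are put in front. With one list present the next level is `levels - 1`, and after
`levels` steps the list at position j is level j. -/
def refineStep (I : Inst) (μ : List ℕ) (H : List (List (List ℕ))) : List (List (List ℕ)) :=
  ((H.headD []).flatMap (I.carve μ (I.levels - H.length))) :: H

/-- The partial partitions of all levels. -/
def hierarchy (I : Inst) (μ : List ℕ) : List (List (List ℕ)) :=
  (I.refineStep μ)^[I.levels] [[I.verts]]

end Inst

/-- `u` and `v` lie in the same cluster of level `j`. -/
def same (H : List (List (List ℕ))) (j u v : ℕ) : Bool :=
  (H.getD j []).any fun P => P.any (Nat.beq u) && P.any (Nat.beq v)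

/-- `v` has not been deleted. -/
def alive (H : List (List (List ℕ))) (v : ℕ) : Bool := same H 0 v v

namespace Inst

/-- The multiplicative weight: it doubles with each deletion. The truncation keeps the unary value
small on every input and is never reached on good instances. -/
def penalty (I : Inst) (Hs : List (List (List (List ℕ)))) (v : ℕ) : ℕ :=
  pow2 I.cap (Hs.filter fun H => !alive H v).length

/-- The measure used for the next hierarchy. -/
def measure (I : Inst) (Hs : List (List (List (List ℕ)))) : List ℕ :=
  (List.range I.n).map fun v =>
    bif Nat.beq v I.root then (I.others.map (I.penalty Hs)).sum else I.penalty Hs v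

def hierarchies (I : Inst) : List (List (List (List ℕ))) :=
  (fun Hs => I.hierarchy (I.measure Hs) :: Hs)^[I.rounds] []

/-- The representative of the cluster of `v` at level `j`. -/
def rep (I : Inst) (H : List (List (List ℕ))) (j v : ℕ) : ℕ :=
  (I.verts.find? fun u => alive H u && same H j v u).getD I.root

/-- The first level at which `v` no longer represents its own cluster. Deleted vertices are attached
to the root with the largest weight, so that the tree spans all vertices. -/
def lev (I : Inst) (H : List (List (List ℕ))) (v : ℕ) : ℕ :=
  bif alive H v then
    ((List.range (I.levels + 1)).find? fun j => !Nat.beq (I.rep H j v) v).getD I.levels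
  else I.levels

def par (I : Inst) (H : List (List (List ℕ))) (v : ℕ) : ℕ :=
  bif alive H v then I.rep H (I.lev H v) v else I.root

/-- The nodes of the tree: the root, and the copy of `v` in the `i`-th tree. -/
def nodes (I : Inst) : List (ℕ × ℕ) :=
  (0, I.root) :: (List.range I.rounds).flatMap fun i => I.others.map fun v => (i, v)

/-- All trees share the single node (0, root); this is where they are glued. -/
def nPar (I : Inst) (Hs : List (List (List (List ℕ)))) (x : ℕ × ℕ) : ℕ × ℕ :=
  bif Nat.beq (I.par (Hs.getD x.1 []) x.2) I.root then (0, I.root)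
  else (x.1, I.par (Hs.getD x.1 []) x.2)

def nLev (I : Inst) (Hs : List (List (List (List ℕ)))) (x : ℕ × ℕ) : ℕ :=
  bif Nat.beq x.2 I.root then I.levels + 1 else I.lev (Hs.getD x.1 []) x.2

/-- `y` is the parent of `x`. -/
def isChild (I : Inst) (Hs : List (List (List (List ℕ)))) (x y : ℕ × ℕ) : Bool :=
  !Nat.beq x.2 I.root && (Nat.beq (I.nPar Hs x).1 y.1 && Nat.beq (I.nPar Hs x).2 y.2)

/-- The weight of the tree edge between `x` and `y`, in binary. -/
def treeEntry (I : Inst) (Hs : List (List (List (List ℕ)))) (x y : ℕ × ℕ) : List Bool :=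
  bif I.isChild Hs x y || I.isChild Hs y x then
    List.replicate (min (I.nLev Hs x) (I.nLev Hs y)) false ++ [true]
  else []

/-- `u` and `v` are separated by the edge above `x`. -/
def separates (I : Inst) (Hs : List (List (List (List ℕ)))) (x : ℕ × ℕ) (u v : ℕ) : Bool :=
  (alive (Hs.getD x.1 []) x.2 && (alive (Hs.getD x.1 []) u && alive (Hs.getD x.1 []) v)) &&
    (same (Hs.getD x.1 []) (I.nLev Hs x - 1) x.2 u && !same (Hs.getD x.1 []) (I.nLev Hs x - 1) x.2 v)

def sepMask (I : Inst) (Hs : List (List (List (List ℕ)))) (x y : ℕ × ℕ) : List (List Bool) :=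
  (List.range I.n).map fun u => (List.range I.n).map fun v =>
    (I.isChild Hs x y && I.separates Hs x u v) || (I.isChild Hs y x && I.separates Hs y u v)

/-- The walk between `x` and its parent. -/
def edgeWalk (I : Inst) (Hs : List (List (List (List ℕ)))) (x : ℕ × ℕ) : List ℕ :=
  lightWalk I.mat I.n (I.nPar Hs x).2 (2 * (1 + I.levels * I.rings * (2 * I.hop))) x.2

def onWalk (I : Inst) (Hs : List (List (List (List ℕ)))) (x : ℕ × ℕ) (a b : ℕ) : Bool :=
  !Nat.beq a b && (steps (I.edgeWalk Hs x)).any fun q =>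
    (Nat.beq q.1 a && Nat.beq q.2 b) || (Nat.beq q.1 b && Nat.beq q.2 a)

def walkMask (I : Inst) (Hs : List (List (List (List ℕ)))) (a b : ℕ) : List (List Bool) :=
  I.nodes.map fun x => I.nodes.map fun y =>
    (I.isChild Hs x y && I.onWalk Hs x a b) || (I.isChild Hs y x && I.onWalk Hs y a b)

end Inst

/-- `M` and `A` have a common entry `true`. -/
def maskAny (M A : List (List Bool)) : Bool :=
  (List.range M.length).any fun a => (List.range (M.getD a []).length).any fun b =>
    bentry M a b && bentry A a b

/-- The matrix that tells which vertices are joined by at most `h` edges of `F`. -/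
def hopMat (h : ℕ) (F : List (List Bool)) : List (List Bool) :=
  (List.range F.length).map fun u => (List.range F.length).map fun v =>
    Nat.beq (hopDist ((List.range F.length).map fun a => (List.range F.length).map fun b =>
      bif Nat.beq a b || bentry F a b then 0 else 1) F.length u (h - 1) v) 0

/-- The value of a list of binary digits (least significant one first), truncated at `cap`. -/
def natOfBits (cap : ℕ) (l : List Bool) : ℕ :=
  l.reverse.foldl (fun x b => min cap (bif b then 2 * x + 1 else 2 * x)) 0

/-- The least power of two that is at least `n`, and its exponent. -/
def ceilPow (n : ℕ) : ℕ × ℕ :=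
  (fun st : ℕ × ℕ => bif Nat.ble n st.1 then st else (2 * st.1, st.2 + 1))^[n] (1, 0)

/-- Binary numbers appear as bit lists, since a plain number would be encoded in unary. The
components are hop bound, root, weight matrix and random bits. -/
abbrev InputData : Type := (List Bool × List Bool × List (List (List Bool))) × List Bool

/-- Reading binary numbers with truncation keeps their unary form polynomial. The hop bound may be
cut at n because paths are shorter than that. With `ell` the rounded-up binary logarithm of n, the
value of `cap` exceeds both 2^levels and the largest possible penalty 2^(6·ell). -/
def mkInst (k : ℕ) (x : InputData) : Inst where
  n := x.1.2.2.length
  root := natOfBits x.1.2.2.length x.1.2.1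
  hop := natOfBits x.1.2.2.length x.1.1
  ell := (ceilPow x.1.2.2.length).2
  levels := k * (ceilPow x.1.2.2.length).2 + 2
  cap := 4 * (ceilPow x.1.2.2.length).1 ^ (k + 6)
  mat := x.1.2.2.map fun row => row.map fun b => natOfBits (x.1.2.2.length ^ k) b

abbrev OutputData : Type :=
  (List Bool × List (List (List Bool))) × List (List Bool) × ℕ ×
    List (List (List (List Bool))) × List (List (List (List Bool)))

/-- Besides the tree, the output tabulates for each pair of nodes the vertex pairs whose nearness
selects that tree edge, and for each pair of vertices the tree edges whose walk uses it. The edge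
mappings then only intersect these fixed masks with the argument, or with its hop matrix. -/
def embedWith (I : Inst) (Hs : List (List (List (List ℕ)))) : OutputData :=
  (([], I.nodes.map fun x => I.nodes.map fun y => I.treeEntry Hs x y),
    (List.range I.n).map (fun v => I.nodes.map fun x => Nat.beq x.2 v),
    I.hop,
    I.nodes.map (fun x => I.nodes.map fun y => I.sepMask Hs x y),
    (List.range I.n).map (fun a => (List.range I.n).map fun b => I.walkMask Hs a b))

def embed (k : ℕ) (x : InputData) : OutputData :=
  embedWith (mkInst k x) (mkInst k x).hierarchies

def vertexEval (x : OutputData × List Bool) : List Bool :=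
  x.1.2.1.getD (natOfBits x.1.2.1.length x.2) []

def edgeEvalGT (x : OutputData × List (List Bool)) : List (List Bool) :=
  x.1.2.2.2.1.map fun row => row.map fun M => maskAny M (hopMat x.1.2.2.1 x.2)

def edgeEvalTG (x : OutputData × List (List Bool)) : List (List Bool) :=
  x.1.2.2.2.2.map fun row => row.map fun M => maskAny M x.2

end HopRepTree

/-! ### The ingredients of the algorithm run in polynomial time -/

namespace HopRepTree

open Enc

theorem pick_mem_or {α : Type} (r : α → α → Bool) (l : List α) (d : α) :
    pick r l d ∈ l ∨ pick r l d = d := by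
  unfold pick
  cases h : l.find? fun x => l.all (r x) with
  | none => simp
  | some a => exact .inl (List.mem_of_find?_eq_some h)

namespace PTF

variable {α β : Type} [Enc α] [Enc β]

@[fun_prop] theorem entry {M : α → List (List ℕ)} {u v : α → ℕ} (hM : PTF M) (hu : PTF u)
    (hv : PTF v) : PTF (fun a => entry (M a) (u a) (v a)) := by
  unfold HopRepTree.entry; fun_prop

@[fun_prop] theorem bentry {M : α → List (List Bool)} {u v : α → ℕ} (hM : PTF M) (hu : PTF u)
    (hv : PTF v) : PTF (fun a => bentry (M a) (u a) (v a)) := by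
  unfold HopRepTree.bentry; fun_prop

@[fun_prop] theorem steps {l : α → List ℕ} (hl : PTF l) : PTF (fun a => steps (l a)) :=
  map (by fun_prop) (by fun_prop)

@[fun_prop] theorem walkWt {M : α → List (List ℕ)} {l : α → List ℕ} (hM : PTF M) (hl : PTF l) :
    PTF (fun a => walkWt (M a) (l a)) :=
  sum (map (by fun_prop) (by fun_prop))

theorem pick {r : α → β → β → Bool} {l : α → List β} {d : α → β}
    (hr : PTF fun p : α × β × β => r p.1 p.2.1 p.2.2) (hl : PTF l) (hd : PTF d) :
    PTF (fun a => pick (r a) (l a) (d a)) :=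
  find hl (all (by fun_prop)
    (hr.comp (g := fun q : (α × β) × β => (q.1.1, q.1.2, q.2)) (by fun_prop))) hd

@[fun_prop] theorem extendWalk {M T : α → List (List ℕ)} {n v : α → ℕ} (hM : PTF M) (hn : PTF n)
    (hT : PTF T) (hv : PTF v) : PTF (fun a => extendWalk (M a) (n a) (T a) (v a)) :=
  pick (by fun_prop) (map (by fun_prop) (by fun_prop)) (by fun_prop)

@[fun_prop] theorem walkTable {M : α → List (List ℕ)} {n c i : α → ℕ} (hM : PTF M) (hn : PTF n)
    (hc : PTF c) (hi : PTF i) : PTF (fun a => walkTable (M a) (n a) (c a) (i a)) := by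
  refine iterate (f := fun a T => (List.range (n a)).map (HopRepTree.extendWalk (M a) (n a) T)) hi
    (map (by fun_prop) (by fun_prop)) (map (by fun_prop) (by fun_prop))
    (fun a => n a * (((i a + 2) * (2 * (n a + c a) + 1 + 1) + 1) + 1) + 1) (by fun_prop)
    fun a k hk => ?_
  -- The table keeps at most n walks; every round lengthens each by at most one vertex, and all
  -- names stay at most n + c. This also covers meaningless inputs, where `pick` or `getD` may
  -- return its default.
  have key : ∀ k, (((fun T => (List.range (n a)).map (HopRepTree.extendWalk (M a) (n a) T))^[k]
      ((List.range (n a)).map fun v => [v, c a])).length ≤ n a) ∧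
      ∀ l ∈ (fun T => (List.range (n a)).map (HopRepTree.extendWalk (M a) (n a) T))^[k]
      ((List.range (n a)).map fun v => [v, c a]), l.length ≤ k + 2 ∧ ∀ x ∈ l, x ≤ n a + c a := by
    intro k
    induction k with
    | zero =>
      refine ⟨by simp, fun l hl => ?_⟩
      simp only [Function.iterate_zero, id_eq, List.mem_map, List.mem_range] at hl
      obtain ⟨v, hv, rfl⟩ := hl
      simp; omega
    | succ k ih =>
      rw [Function.iterate_succ_apply']
      refine ⟨by simp, fun l hl => ?_⟩
      simp only [List.mem_map, List.mem_range] at hl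
      obtain ⟨v, hv, rfl⟩ := hl
      rcases pick_mem_or (fun p q => Nat.ble (HopRepTree.walkWt (M a) p) (HopRepTree.walkWt (M a) q))
        ((List.range (n a)).map fun u => v :: ((fun T => (List.range (n a)).map
          (HopRepTree.extendWalk (M a) (n a) T))^[k]
          ((List.range (n a)).map fun v => [v, c a])).getD u []) [] with h | h
      · simp only [List.mem_map, List.mem_range] at h
        obtain ⟨u, hu, h⟩ := h
        unfold HopRepTree.extendWalk at h ih ⊢
        rw [← h]
        by_cases hlt : u < ((fun T => (List.range (n a)).map fun v => HopRepTree.pick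
            (fun p q => Nat.ble (HopRepTree.walkWt (M a) p) (HopRepTree.walkWt (M a) q))
            ((List.range (n a)).map fun u => v :: T.getD u []) [])^[k]
            ((List.range (n a)).map fun v => [v, c a])).length
        · have := ih.2 _ (List.getElem_mem hlt)
          rw [List.getD_eq_getElem _ _ hlt]
          simp only [List.length_cons, List.mem_cons, forall_eq_or_imp]
          exact ⟨by omega, by omega, this.2⟩
        · rw [List.getD_eq_default _ _ (by omega)]
          simp; omega
      · unfold HopRepTree.extendWalk at h ⊢
        rw [h]; simp
  refine esize_list_le (key k).1 fun l hl => ?_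
  refine esize_list_le (((key k).2 l hl).1.trans (by omega)) fun x hx => ?_
  have := ((key k).2 l hl).2 x hx
  simp; omega

@[fun_prop] theorem lightWalk {M : α → List (List ℕ)} {n c i v : α → ℕ} (hM : PTF M) (hn : PTF n)
    (hc : PTF c) (hi : PTF i) (hv : PTF v) :
    PTF (fun a => lightWalk (M a) (n a) (c a) (i a) (v a)) := by
  unfold HopRepTree.lightWalk; fun_prop

@[fun_prop] theorem hopDist {M : α → List (List ℕ)} {n c i v : α → ℕ} (hM : PTF M) (hn : PTF n)
    (hc : PTF c) (hi : PTF i) (hv : PTF v) :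
    PTF (fun a => hopDist (M a) (n a) (c a) (i a) (v a)) := by
  unfold HopRepTree.hopDist; fun_prop

@[fun_prop] theorem pow2 {cap x : α → ℕ} (hcap : PTF cap) (hx : PTF x) :
    PTF (fun a => pow2 (cap a) (x a)) := by
  refine iterate (f := fun a y => Min.min (2 * y) (cap a)) hx (const 1) (by fun_prop)
    (fun a => 2 * (cap a + 1) + 1) (by fun_prop) fun a k _ => ?_
  cases k with
  | zero => simp
  | succ k => rw [Function.iterate_succ_apply']; simp

section Inst

variable {I : α → Inst}

theorem instTuple (hI : PTF I) : PTF (fun a =>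
    ((I a).n, (I a).root, (I a).hop, (I a).ell, (I a).levels, (I a).cap, (I a).mat)) :=
  hI.of_enc_eq fun _ => rfl

@[fun_prop] theorem inst_n (hI : PTF I) : PTF (fun a => (I a).n) := hI.instTuple.fst
@[fun_prop] theorem inst_root (hI : PTF I) : PTF (fun a => (I a).root) := hI.instTuple.snd.fst
@[fun_prop] theorem inst_hop (hI : PTF I) : PTF (fun a => (I a).hop) := hI.instTuple.snd.snd.fst
@[fun_prop] theorem inst_ell (hI : PTF I) : PTF (fun a => (I a).ell) :=
  hI.instTuple.snd.snd.snd.fst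
@[fun_prop] theorem inst_levels (hI : PTF I) : PTF (fun a => (I a).levels) :=
  hI.instTuple.snd.snd.snd.snd.fst
@[fun_prop] theorem inst_cap (hI : PTF I) : PTF (fun a => (I a).cap) :=
  hI.instTuple.snd.snd.snd.snd.snd.fst
@[fun_prop] theorem inst_mat (hI : PTF I) : PTF (fun a => (I a).mat) :=
  hI.instTuple.snd.snd.snd.snd.snd.snd

@[fun_prop] theorem others (hI : PTF I) : PTF (fun a => (I a).others) :=
  filter (by fun_prop) (by fun_prop)

@[fun_prop] theorem verts (hI : PTF I) : PTF (fun a => (I a).verts) := by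
  unfold Inst.verts; fun_prop

@[fun_prop] theorem rings (hI : PTF I) : PTF (fun a => (I a).rings) := by
  unfold Inst.rings; fun_prop

@[fun_prop] theorem rounds (hI : PTF I) : PTF (fun a => (I a).rounds) := by
  unfold Inst.rounds; fun_prop

@[fun_prop] theorem inBall {j c s v : α → ℕ} (hI : PTF I) (hj : PTF j) (hc : PTF c) (hs : PTF s)
    (hv : PTF v) : PTF (fun a => (I a).inBall (j a) (c a) (s a) (v a)) := by
  unfold Inst.inBall; fun_prop

@[fun_prop] theorem ballMass {μ R : α → List ℕ} {j c s : α → ℕ} (hI : PTF I) (hμ : PTF μ)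
    (hj : PTF j) (hR : PTF R) (hc : PTF c) (hs : PTF s) :
    PTF (fun a => (I a).ballMass (μ a) (j a) (R a) (c a) (s a)) :=
  sum (map (filter (by fun_prop) (by fun_prop)) (by fun_prop))

@[fun_prop] theorem center {μ R : α → List ℕ} {j : α → ℕ} (hI : PTF I) (hμ : PTF μ)
    (hj : PTF j) (hR : PTF R) : PTF (fun a => (I a).center (μ a) (j a) (R a)) :=
  pick (by fun_prop) hR (const 0)

@[fun_prop] theorem radius {μ R : α → List ℕ} {j c : α → ℕ} (hI : PTF I) (hμ : PTF μ)
    (hj : PTF j) (hR : PTF R) (hc : PTF c) :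
    PTF (fun a => (I a).radius (μ a) (j a) (R a) (c a)) :=
  pick (by fun_prop) (by fun_prop) (const 0)

@[fun_prop] theorem carveAt {j c s : α → ℕ} {st : α → List ℕ × List (List ℕ)} (hI : PTF I)
    (hj : PTF j) (hc : PTF c) (hs : PTF s) (hst : PTF st) :
    PTF (fun a => (I a).carveAt (j a) (c a) (s a) (st a)) :=
  pair (filter (by fun_prop) (by fun_prop))
    (cons (filter (by fun_prop) (by fun_prop)) (by fun_prop))

@[fun_prop] theorem carveStep {μ : α → List ℕ} {j : α → ℕ} {st : α → List ℕ × List (List ℕ)}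
    (hI : PTF I) (hμ : PTF μ) (hj : PTF j) (hst : PTF st) :
    PTF (fun a => (I a).carveStep (μ a) (j a) (st a)) := by
  unfold Inst.carveStep; fun_prop

end Inst

end PTF

end HopRepTree

/-! ### Size bounds for partitions, and polynomial time of the whole algorithm -/

namespace HopRepTree

open Enc

theorem esize_le_of_sublist {α : Type} [Enc α] {l m : List α} (h : l.Sublist m) :
    esize l ≤ esize m := by
  induction h with
  | slnil => exact le_rfl
  | cons a h ih => simp; omega
  | cons_cons a h ih => simp; omega

theorem length_filter_add_le {α : Type} (l : List α) (p q : α → Bool) :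
    (l.filter fun v => !p v && !q v).length + (l.filter p).length ≤ l.length := by
  induction l with
  | nil => simp
  | cons a l ih => simp only [List.filter_cons]; cases p a <;> cases q a <;> simp <;> omega

namespace Inst

variable (I : Inst) (μ : List ℕ) (j : ℕ)

/-- No assumption on the instance is made, so balls need not be nested. As `carveAt` removes the
union of both balls from the remainder, the total number of listed vertices still cannot increase.
-/
theorem carveStep_iterate (R : List ℕ) (i : ℕ) :
    (((I.carveStep μ j)^[i] (R, [])).1.Sublist R ∧
      ∀ P ∈ ((I.carveStep μ j)^[i] (R, [])).2, P.Sublist R) ∧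
    ((I.carveStep μ j)^[i] (R, [])).2.length ≤ i ∧
    ((I.carveStep μ j)^[i] (R, [])).1.length +
      (((I.carveStep μ j)^[i] (R, [])).2.map List.length).sum ≤ R.length := by
  induction i with
  | zero => simp
  | succ i ih =>
    rw [Function.iterate_succ_apply']
    generalize (I.carveStep μ j)^[i] (R, []) = st at ih
    unfold carveStep
    cases st.1.isEmpty with
    | true => exact ⟨ih.1, by simp; omega⟩
    | false =>
      simp only [cond_false, carveAt, List.mem_cons, List.map_cons, List.sum_cons,
        List.length_cons, forall_eq_or_imp]
      have h := length_filter_add_le st.1 (I.inBall j (I.center μ j st.1)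
        (I.radius μ j st.1 (I.center μ j st.1)))
        (I.inBall j (I.center μ j st.1) (I.radius μ j st.1 (I.center μ j st.1) + 1))
      exact ⟨⟨List.filter_sublist.trans ih.1.1, List.filter_sublist.trans ih.1.1, ih.1.2⟩,
        by omega, by omega⟩

theorem sum_length_filter_le (L : List (List ℕ)) (p : List ℕ → Bool) :
    ((L.filter p).map List.length).sum ≤ (L.map List.length).sum :=
  (List.Sublist.map _ List.filter_sublist).sum_le_sum fun _ _ => Nat.zero_le _

theorem carve_sublist {R P : List ℕ} (h : P ∈ I.carve μ j R) : P.Sublist R ∧ P ≠ [] := by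
  simp only [carve, List.mem_filter] at h
  exact ⟨(I.carveStep_iterate μ j R _).1.2 _ h.1, by rintro rfl; simp at h⟩

theorem sum_length_carve_le (R : List ℕ) :
    ((I.carve μ j R).map List.length).sum ≤ R.length :=
  (sum_length_filter_le _ _).trans (by have := (I.carveStep_iterate μ j R R.length).2.2; omega)

theorem length_le_sum_length (L : List (List ℕ)) (h : ∀ P ∈ L, P ≠ []) :
    L.length ≤ (L.map List.length).sum := by
  induction L with
  | nil => simp
  | cons P L ih =>
    have h1 := ih fun Q hQ => h Q (by simp [hQ])
    have h2 := List.length_pos_iff.2 (h P (by simp))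
    simp; omega

/-- Refining the clusters does not increase the total number of vertices. -/
theorem flatMap_carve (L : List (List ℕ)) (V : List ℕ) (h : ∀ P ∈ L, P.Sublist V) :
    (∀ P ∈ L.flatMap (I.carve μ j), P.Sublist V ∧ P ≠ []) ∧
    ((L.flatMap (I.carve μ j)).map List.length).sum ≤ (L.map List.length).sum := by
  refine ⟨fun P hP => ?_, ?_⟩
  · obtain ⟨Q, hQ, hP⟩ := List.mem_flatMap.1 hP
    exact ⟨(I.carve_sublist μ j hP).1.trans (h Q hQ), (I.carve_sublist μ j hP).2⟩
  · clear h
    induction L with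
    | nil => simp
    | cons P L ih =>
      have := I.sum_length_carve_le μ j P
      simp only [List.flatMap_cons, List.map_append, List.sum_append, List.map_cons, List.sum_cons]
      omega

/-- Clusters are non-empty and their lengths add up to at most the number of vertices. This bounds
the number of clusters on each level and with it the size of the hierarchy. -/
theorem refineStep_iterate (i : ℕ) : ((I.refineStep μ)^[i] [[I.verts]]).length = i + 1 ∧
    ∀ L ∈ (I.refineStep μ)^[i] [[I.verts]], (∀ P ∈ L, P.Sublist I.verts ∧ P ≠ []) ∧
      (L.map List.length).sum ≤ I.verts.length := by
  induction i with
  | zero => simp [verts]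
  | succ i ih =>
    rw [Function.iterate_succ_apply']
    generalize (I.refineStep μ)^[i] [[I.verts]] = H at ih
    obtain ⟨L, H, rfl⟩ := List.exists_cons_of_length_eq_add_one ih.1
    refine ⟨by simp [refineStep] at ih ⊢; omega, fun L' hL' => ?_⟩
    simp only [refineStep, List.headD_cons] at hL'
    rcases List.mem_cons.1 hL' with rfl | hL'
    · have h1 := ih.2 L (by simp)
      have h2 := I.flatMap_carve μ (I.levels - (L :: H).length) L I.verts fun P hP => (h1.1 P hP).1
      exact ⟨h2.1, h2.2.trans h1.2⟩
    · exact ih.2 _ hL'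

theorem esize_refineStep_iterate_le (i : ℕ) : esize ((I.refineStep μ)^[i] [[I.verts]]) ≤
    (i + 1) * ((I.verts.length * (esize I.verts + 1) + 1) + 1) + 1 := by
  have h := I.refineStep_iterate μ i
  refine esize_list_le h.1.le fun L hL => ?_
  refine esize_list_le ((length_le_sum_length L fun P hP => ((h.2 L hL).1 P hP).2).trans
    (h.2 L hL).2) fun P hP => esize_le_of_sublist ((h.2 L hL).1 P hP).1

end Inst

namespace PBd

variable {α β : Type} [Enc α] [Enc β]

@[fun_prop] theorem length {l : α → List β} (hl : PTF l) : PBd (fun a => (l a).length) :=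
  hl.length.natBd

@[fun_prop] theorem levels {I : α → Inst} (hI : PTF I) : PBd (fun a => (I a).levels) :=
  hI.inst_levels.natBd

@[fun_prop] theorem rounds {I : α → Inst} (hI : PTF I) : PBd (fun a => (I a).rounds) :=
  hI.rounds.natBd

end PBd

namespace PTF

variable {α : Type} [Enc α] {I : α → Inst}

@[fun_prop] theorem carve {μ R : α → List ℕ} {j : α → ℕ} (hI : PTF I) (hμ : PTF μ)
    (hj : PTF j) (hR : PTF R) : PTF (fun a => (I a).carve (μ a) (j a) (R a)) := by
  refine filter (snd (iterate (s := fun a => (R a, [])) (f := fun a => (I a).carveStep (μ a) (j a))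
    (by fun_prop) (by fun_prop) (by fun_prop)
    (fun a => esize (R a) + ((R a).length * (esize (R a) + 1) + 1) + 1) (by fun_prop)
    fun a i hi => ?_)) (by fun_prop)
  have h := (I a).carveStep_iterate (μ a) (j a) (R a) i
  have h1 := esize_le_of_sublist h.1.1
  have h2 := esize_list_le (h.2.1.trans hi) fun P hP => esize_le_of_sublist (h.1.2 P hP)
  change esize (((I a).carveStep (μ a) (j a))^[i] (R a, [])).1 +
    esize (((I a).carveStep (μ a) (j a))^[i] (R a, [])).2 + 1 ≤ _
  omega

@[fun_prop] theorem refineStep {μ : α → List ℕ} {H : α → List (List (List ℕ))} (hI : PTF I)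
    (hμ : PTF μ) (hH : PTF H) : PTF (fun a => (I a).refineStep (μ a) (H a)) :=
  cons (flatMap (by fun_prop) (by fun_prop)) hH

@[fun_prop] theorem hierarchy {μ : α → List ℕ} (hI : PTF I) (hμ : PTF μ) :
    PTF (fun a => (I a).hierarchy (μ a)) := by
  refine iterate (f := fun a => (I a).refineStep (μ a)) (by fun_prop) (by fun_prop) (by fun_prop)
    (fun a => ((I a).levels + 1) *
      (((I a).verts.length * (esize (I a).verts + 1) + 1) + 1) + 1) (by fun_prop)
    fun a i hi => ((I a).esize_refineStep_iterate_le _ _).trans ?_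
  gcongr

@[fun_prop] theorem same {H : α → List (List (List ℕ))} {j u v : α → ℕ} (hH : PTF H) (hj : PTF j)
    (hu : PTF u) (hv : PTF v) : PTF (fun a => same (H a) (j a) (u a) (v a)) :=
  any (by fun_prop) (and (any (by fun_prop) (by fun_prop)) (any (by fun_prop) (by fun_prop)))

@[fun_prop] theorem alive {H : α → List (List (List ℕ))} {v : α → ℕ} (hH : PTF H) (hv : PTF v) :
    PTF (fun a => alive (H a) (v a)) := by
  unfold HopRepTree.alive; fun_prop

variable {Hs : α → List (List (List (List ℕ)))} {x y : α → ℕ × ℕ}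

@[fun_prop] theorem penalty {v : α → ℕ} (hI : PTF I) (hHs : PTF Hs) (hv : PTF v) :
    PTF (fun a => (I a).penalty (Hs a) (v a)) :=
  pow2 (by fun_prop) (length (filter (by fun_prop) (by fun_prop)))

@[fun_prop] theorem measure (hI : PTF I) (hHs : PTF Hs) :
    PTF (fun a => (I a).measure (Hs a)) :=
  map (by fun_prop) (cond (by fun_prop) (sum (map (by fun_prop) (by fun_prop))) (by fun_prop))

@[fun_prop] theorem hierarchies (hI : PTF I) : PTF (fun a => (I a).hierarchies) := by
  refine iterate (f := fun a Hs => (I a).hierarchy ((I a).measure Hs) :: Hs) (by fun_prop)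
    (const []) (by fun_prop) (fun a => (I a).rounds * (((I a).levels + 1) *
      (((I a).verts.length * (esize (I a).verts + 1) + 1) + 1) + 1 + 1) + 1) (by fun_prop)
    fun a i hi => ?_
  have key : ∀ i, ((fun Hs => (I a).hierarchy ((I a).measure Hs) :: Hs)^[i] []).length = i ∧
      ∀ H ∈ (fun Hs => (I a).hierarchy ((I a).measure Hs) :: Hs)^[i] [], esize H ≤
        ((I a).levels + 1) * (((I a).verts.length * (esize (I a).verts + 1) + 1) + 1) + 1 := by
    intro i
    induction i with
    | zero => simp
    | succ i ih =>
      rw [Function.iterate_succ_apply']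
      refine ⟨by simp [ih.1], fun H hH => ?_⟩
      rcases List.mem_cons.1 hH with rfl | hH
      · exact (I a).esize_refineStep_iterate_le _ _
      · exact ih.2 H hH
  exact esize_list_le ((key i).1.trans_le hi) (key i).2

@[fun_prop] theorem rep {H : α → List (List (List ℕ))} {j v : α → ℕ} (hI : PTF I) (hH : PTF H)
    (hj : PTF j) (hv : PTF v) : PTF (fun a => (I a).rep (H a) (j a) (v a)) :=
  find (by fun_prop) (by fun_prop) (by fun_prop)

@[fun_prop] theorem lev {H : α → List (List (List ℕ))} {v : α → ℕ} (hI : PTF I) (hH : PTF H)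
    (hv : PTF v) : PTF (fun a => (I a).lev (H a) (v a)) :=
  cond (by fun_prop) (find (by fun_prop) (by fun_prop) (by fun_prop)) (by fun_prop)

@[fun_prop] theorem par {H : α → List (List (List ℕ))} {v : α → ℕ} (hI : PTF I) (hH : PTF H)
    (hv : PTF v) : PTF (fun a => (I a).par (H a) (v a)) := by
  unfold Inst.par; fun_prop

@[fun_prop] theorem nodes (hI : PTF I) : PTF (fun a => (I a).nodes) :=
  cons (by fun_prop) (flatMap (by fun_prop) (map (by fun_prop) (by fun_prop)))

@[fun_prop] theorem nPar (hI : PTF I) (hHs : PTF Hs) (hx : PTF x) :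
    PTF (fun a => (I a).nPar (Hs a) (x a)) := by
  unfold Inst.nPar; fun_prop

@[fun_prop] theorem nLev (hI : PTF I) (hHs : PTF Hs) (hx : PTF x) :
    PTF (fun a => (I a).nLev (Hs a) (x a)) := by
  unfold Inst.nLev; fun_prop

@[fun_prop] theorem isChild (hI : PTF I) (hHs : PTF Hs) (hx : PTF x) (hy : PTF y) :
    PTF (fun a => (I a).isChild (Hs a) (x a) (y a)) := by
  unfold Inst.isChild; fun_prop

@[fun_prop] theorem treeEntry (hI : PTF I) (hHs : PTF Hs) (hx : PTF x) (hy : PTF y) :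
    PTF (fun a => (I a).treeEntry (Hs a) (x a) (y a)) := by
  unfold Inst.treeEntry; fun_prop

@[fun_prop] theorem separates {u v : α → ℕ} (hI : PTF I) (hHs : PTF Hs) (hx : PTF x) (hu : PTF u)
    (hv : PTF v) : PTF (fun a => (I a).separates (Hs a) (x a) (u a) (v a)) := by
  unfold Inst.separates; fun_prop

@[fun_prop] theorem sepMask (hI : PTF I) (hHs : PTF Hs) (hx : PTF x) (hy : PTF y) :
    PTF (fun a => (I a).sepMask (Hs a) (x a) (y a)) :=
  map (by fun_prop) (map (by fun_prop) (by fun_prop))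

@[fun_prop] theorem edgeWalk (hI : PTF I) (hHs : PTF Hs) (hx : PTF x) :
    PTF (fun a => (I a).edgeWalk (Hs a) (x a)) := by
  unfold Inst.edgeWalk; fun_prop

@[fun_prop] theorem onWalk {u v : α → ℕ} (hI : PTF I) (hHs : PTF Hs) (hx : PTF x) (hu : PTF u)
    (hv : PTF v) : PTF (fun a => (I a).onWalk (Hs a) (x a) (u a) (v a)) :=
  and (by fun_prop) (any (by fun_prop) (by fun_prop))

@[fun_prop] theorem walkMask {u v : α → ℕ} (hI : PTF I) (hHs : PTF Hs) (hu : PTF u) (hv : PTF v) :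
    PTF (fun a => (I a).walkMask (Hs a) (u a) (v a)) :=
  map (by fun_prop) (map (by fun_prop) (by fun_prop))

@[fun_prop] theorem maskAny {M A : α → List (List Bool)} (hM : PTF M) (hA : PTF A) :
    PTF (fun a => maskAny (M a) (A a)) :=
  any (by fun_prop) (any (by fun_prop) (by fun_prop))

@[fun_prop] theorem hopMat {h : α → ℕ} {F : α → List (List Bool)} (hh : PTF h) (hF : PTF F) :
    PTF (fun a => hopMat (h a) (F a)) :=
  map (by fun_prop) (map (by fun_prop) (beq (hopDist (map (by fun_prop) (map (by fun_prop)
    (by fun_prop))) (by fun_prop) (by fun_prop) (by fun_prop) (by fun_prop)) (by fun_prop)))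

@[fun_prop] theorem natOfBits {cap : α → ℕ} {l : α → List Bool} (hcap : PTF cap) (hl : PTF l) :
    PTF (fun a => natOfBits (cap a) (l a)) := by
  refine foldl (f := fun a x b => Min.min (cap a) (bif b then 2 * x + 1 else 2 * x)) (by fun_prop)
    (const 0) (by fun_prop) (fun a => 2 * cap a + 1) (by fun_prop) fun a i => ?_
  generalize (l a).reverse.take i = m
  induction m using List.reverseRecOn with
  | nil => simp
  | append_singleton m b _ => rw [List.foldl_append]; simp

@[fun_prop] theorem ceilPow {n : α → ℕ} (hn : PTF n) : PTF (fun a => ceilPow (n a)) := by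
  refine iterate (f := fun a st => bif Nat.ble (n a) st.1 then st else (2 * st.1, st.2 + 1)) hn
    (const (1, 0)) (by fun_prop) (fun a => 2 * (2 * n a + 1) + 1 + (2 * n a + 1) + 1) (by fun_prop)
    fun a i hi => ?_
  -- The power is doubled only while it is below n, hence it never exceeds 2n + 1; the summand 1 is
  -- for n = 0.
  have key : ∀ i, ((fun st : ℕ × ℕ => bif Nat.ble (n a) st.1 then st
      else (2 * st.1, st.2 + 1))^[i] (1, 0)).1 ≤ 2 * n a + 1 ∧
      ((fun st : ℕ × ℕ => bif Nat.ble (n a) st.1 then st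
      else (2 * st.1, st.2 + 1))^[i] (1, 0)).2 ≤ i := by
    intro i
    induction i with
    | zero => simp
    | succ i ih =>
      rw [Function.iterate_succ_apply']
      generalize (fun st : ℕ × ℕ => bif Nat.ble (n a) st.1 then st
        else (2 * st.1, st.2 + 1))^[i] (1, 0) = st at ih ⊢
      cases h : Nat.ble (n a) st.1 with
      | true => simp; omega
      | false =>
        have : ¬ n a ≤ st.1 := fun h' => by simp [Nat.ble_eq_true_of_le h'] at h
        simp; omega
  have := key i
  generalize (fun st : ℕ × ℕ => bif Nat.ble (n a) st.1 then st
    else (2 * st.1, st.2 + 1))^[i] (1, 0) = st at this ⊢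
  obtain ⟨p, q⟩ := st
  simp at this ⊢; omega

@[fun_prop] theorem mkInst (k : ℕ) {x : α → InputData} (hx : PTF x) :
    PTF (fun a => mkInst k (x a)) := by
  have h1 : PTF fun a => (x a).1.2.2.length := by fun_prop
  have h2 : PTF fun a => (x a).1.2.2.map fun row => row.map fun b =>
      HopRepTree.natOfBits ((x a).1.2.2.length ^ k) b := by
    refine map (by fun_prop) (map (by fun_prop) (natOfBits (pow ?_ k) (by fun_prop)))
    exact h1.comp (g := fun p : (α × List (List Bool)) × List Bool => p.1.1) (by fun_prop)
  exact (pair h1 (pair (natOfBits h1 hx.fst.snd.fst) (pair (natOfBits h1 hx.fst.fst)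
    (pair h1.ceilPow.snd (pair (add (mul (const k) h1.ceilPow.snd) (const 2))
      (pair (mul (const 4) (pow h1.ceilPow.fst (k + 6))) h2)))))).of_enc_eq fun _ => rfl

theorem embedWith {I : α → Inst} (hI : PTF I) (hHs : PTF Hs) :
    PTF (fun a => embedWith (I a) (Hs a)) :=
  pair (pair (const []) (map (by fun_prop) (map (by fun_prop) (by fun_prop))))
    (pair (map (by fun_prop) (map (by fun_prop) (by fun_prop))) (pair (by fun_prop)
      (pair (map (by fun_prop) (map (by fun_prop) (by fun_prop)))
        (map (by fun_prop) (map (by fun_prop) (by fun_prop))))))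

theorem embed (k : ℕ) : PTF (embed k) :=
  embedWith (by fun_prop) (by fun_prop)

theorem vertexEval : PTF vertexEval := by
  unfold HopRepTree.vertexEval; fun_prop

theorem edgeEvalGT : PTF edgeEvalGT :=
  map (by fun_prop) (map (by fun_prop) (by fun_prop))

theorem edgeEvalTG : PTF edgeEvalTG :=
  map (by fun_prop) (map (by fun_prop) (by fun_prop))

end PTF

end HopRepTree

namespace HopRepTree

/-! ### Hop-bounded distances -/

/-- `M` restricted to `Fin n` is symmetric with zero diagonal. -/
structure IsWeightMatrix (M : List (List ℕ)) (n : ℕ) : Prop where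
  symm : ∀ u < n, ∀ v < n, entry M u v = entry M v u
  diag : ∀ u < n, entry M u u = 0

/-- There is a walk from `u` to `v` with `k` steps and weight `W`. -/
inductive Conn (M : List (List ℕ)) (n : ℕ) (u : ℕ) : ℕ → ℕ → ℕ → Prop
  | refl : u < n → Conn M n u u 0 0
  | step {v x k W : ℕ} : Conn M n u v k W → x < n → Conn M n u x (k + 1) (W + entry M v x)

namespace Conn

variable {M : List (List ℕ)} {n u v x k l W W' : ℕ}

theorem left_lt (h : Conn M n u v k W) : u < n := by
  induction h with
  | refl h => exact h
  | step _ _ ih => exact ih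

theorem right_lt (h : Conn M n u v k W) : v < n := by
  cases h with
  | refl h => exact h
  | step _ h => exact h

theorem trans (h : Conn M n u v k W) (h' : Conn M n v x l W') :
    Conn M n u x (k + l) (W + W') := by
  induction h' with
  | refl _ => exact h
  | step _ hx ih => simpa only [add_assoc] using ih.step hx

theorem single (hu : u < n) (hv : v < n) : Conn M n u v 1 (entry M u v) := by
  simpa using (Conn.refl (M := M) hu).step hv

theorem symm (hM : IsWeightMatrix M n) (h : Conn M n u v k W) : Conn M n v u k W := by
  induction h with
  | refl h => exact .refl h
  | step h hx ih =>
    have := (single (M := M) hx h.right_lt).trans ih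
    rwa [hM.symm _ hx _ h.right_lt, add_comm 1, add_comm (entry M _ _)] at this

/-- The zero diagonal makes idle steps free, so exact and bounded numbers of steps are
interchangeable. -/
theorem mono (hM : IsWeightMatrix M n) (h : Conn M n u v k W) (hkl : k ≤ l) :
    Conn M n u v l W := by
  induction l, hkl using Nat.le_induction with
  | base => exact h
  | succ l _ ih => simpa [hM.diag v h.right_lt] using ih.step h.right_lt

end Conn

theorem steps_cons_cons (a b : ℕ) (l : List ℕ) :
    steps (a :: b :: l) = (a, b) :: steps (b :: l) := by
  simp [steps, List.range_succ_eq_map, Function.comp_def]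

theorem steps_singleton (a : ℕ) : steps [a] = [] := rfl

theorem walkWt_cons_cons (M : List (List ℕ)) (a b : ℕ) (l : List ℕ) :
    walkWt M (a :: b :: l) = entry M a b + walkWt M (b :: l) := by
  simp [walkWt, steps_cons_cons]

theorem pick_spec {α : Type} {r : α → α → Bool} {l : List α} {d : α}
    (h : ∃ x ∈ l, ∀ y ∈ l, r x y = true) :
    pick r l d ∈ l ∧ ∀ y ∈ l, r (pick r l d) y = true := by
  unfold pick
  cases h' : l.find? fun x => l.all (r x) with
  | none =>
    obtain ⟨x, hx, hr⟩ := h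
    rw [List.find?_eq_none] at h'
    exact absurd (List.all_eq_true.2 hr) (h' x hx)
  | some a =>
    refine ⟨List.mem_of_find?_eq_some h', fun y hy => ?_⟩
    have := List.find?_some h'
    exact List.all_eq_true.1 this y hy

theorem exists_min_of_ne_nil {α β : Type} [LinearOrder β] (f : α → β) {l : List α} (h : l ≠ []) :
    ∃ x ∈ l, ∀ y ∈ l, f x ≤ f y := by
  classical
  obtain ⟨x, hx, hmin⟩ := l.toFinset.exists_min_image f (by
    obtain ⟨a, ha⟩ := List.exists_mem_of_ne_nil l h
    exact ⟨a, by simpa⟩)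
  exact ⟨x, by simpa using hx, fun y hy => hmin y (by simpa)⟩

variable {M : List (List ℕ)} {n c : ℕ}

theorem lightWalk_zero {v : ℕ} (hv : v < n) : lightWalk M n c 0 v = [v, c] := by
  simp [lightWalk, walkTable, hv]

theorem lightWalk_succ {i v : ℕ} (hv : v < n) :
    (∃ u < n, lightWalk M n c (i + 1) v = v :: lightWalk M n c i u) ∧
    ∀ u < n, walkWt M (lightWalk M n c (i + 1) v) ≤ walkWt M (v :: lightWalk M n c i u) := by
  have h : lightWalk M n c (i + 1) v = extendWalk M n (walkTable M n c i) v := by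
    rw [lightWalk, walkTable, Function.iterate_succ_apply']
    simp [hv, walkTable]
  rw [h]
  obtain ⟨h1, h2⟩ := pick_spec (r := fun p q => Nat.ble (walkWt M p) (walkWt M q)) (d := [])
    (l := (List.range n).map fun u => v :: (walkTable M n c i).getD u []) (by
      simpa only [Nat.ble_eq] using exists_min_of_ne_nil (walkWt M) (by
        simp; omega))
  simp only [List.mem_map, List.mem_range, Nat.ble_eq] at h1 h2
  exact ⟨let ⟨u, hu, h⟩ := h1; ⟨u, hu, h.symm⟩, fun u hu => h2 _ ⟨u, hu, rfl⟩⟩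

theorem lightWalk_eq_cons (hc : c < n) (i : ℕ) {v : ℕ} (hv : v < n) :
    ∃ l, lightWalk M n c i v = v :: l ∧ l.length = i + 1 ∧ (v :: l).getLast? = some c ∧
      ∀ x ∈ v :: l, x < n := by
  induction i generalizing v with
  | zero => exact ⟨[c], lightWalk_zero hv, rfl, rfl, by simp [hv, hc]⟩
  | succ i ih =>
    obtain ⟨u, hu, h⟩ := (lightWalk_succ (M := M) (c := c) (i := i) hv).1
    obtain ⟨l, h1, h2, h3, h4⟩ := ih hu
    exact ⟨u :: l, by rw [h, h1], by simp [h2], by simpa using h3, by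
      simp only [List.mem_cons, forall_eq_or_imp] at h4 ⊢; exact ⟨hv, h4⟩⟩

theorem hopDist_zero {v : ℕ} (hv : v < n) : hopDist M n c 0 v = entry M v c := by
  simp [hopDist, lightWalk_zero hv, walkWt, steps_cons_cons, steps_singleton]

theorem walkWt_cons_lightWalk (hc : c < n) {i u v : ℕ} (hu : u < n) :
    walkWt M (v :: lightWalk M n c i u) = hopDist M n c i u + entry M v u := by
  obtain ⟨l, h1, -⟩ := lightWalk_eq_cons (M := M) hc i hu
  rw [hopDist, h1, walkWt_cons_cons, add_comm]

theorem hopDist_succ_le (hc : c < n) {i u v : ℕ} (hu : u < n) (hv : v < n) :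
    hopDist M n c (i + 1) v ≤ hopDist M n c i u + entry M v u := by
  rw [← walkWt_cons_lightWalk hc hu]
  exact (lightWalk_succ hv).2 u hu

theorem exists_hopDist_succ (hc : c < n) {i v : ℕ} (hv : v < n) :
    ∃ u < n, hopDist M n c (i + 1) v = hopDist M n c i u + entry M v u := by
  obtain ⟨u, hu, h⟩ := (lightWalk_succ (M := M) (c := c) (i := i) hv).1
  exact ⟨u, hu, by rw [← walkWt_cons_lightWalk hc hu, ← h, hopDist]⟩

theorem conn_hopDist (hM : IsWeightMatrix M n) (hc : c < n) (i : ℕ) {v : ℕ} (hv : v < n) :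
    Conn M n c v (i + 1) (hopDist M n c i v) := by
  induction i generalizing v with
  | zero => rw [hopDist_zero hv, hM.symm v hv c hc]; exact .single hc hv
  | succ i ih =>
    obtain ⟨u, hu, h⟩ := exists_hopDist_succ (M := M) hc (i := i) hv
    rw [h, hM.symm v hv u hu]
    exact (ih hu).step hv

/-- The triangle inequality for hop-bounded distances: hop budgets have to be added as well. This is
why the budget of a ball grows together with its radius. -/
theorem hopDist_add_le (hM : IsWeightMatrix M n) (hc : c < n) {i u v k W : ℕ}
    (h : Conn M n u v k W) : hopDist M n c (i + k) v ≤ hopDist M n c i u + W := by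
  induction h with
  | refl _ => exact le_rfl
  | @step _ _ l _ h hx ih =>
    have := hopDist_succ_le (M := M) hc (i := i + l) h.right_lt hx
    rw [hM.symm _ hx _ h.right_lt] at this
    exact this.trans (by omega)

theorem hopDist_self (hM : IsWeightMatrix M n) (hc : c < n) (i : ℕ) : hopDist M n c i c = 0 := by
  have h := hopDist_add_le (i := 0) hM hc ((Conn.refl (M := M) hc).mono hM (Nat.zero_le i))
  rw [hopDist_zero hc, hM.diag c hc] at h
  simpa using h

theorem hopDist_le (hM : IsWeightMatrix M n) {i k v W : ℕ} (h : Conn M n c v k W)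
    (hk : k ≤ i + 1) : hopDist M n c i v ≤ W := by
  have hc := h.left_lt
  have h1 := h.mono hM hk
  generalize hk' : i + 1 = k' at h1
  cases h1 with
  | refl => omega
  | step h' hx =>
    obtain rfl : _ = i := (Nat.succ.inj hk').symm
    clear h hk' hk
    -- The index i of `hopDist` allows i + 1 steps, so the last step is split off.
    have key : ∀ {i u W}, Conn M n c u i W → ∀ x < n, hopDist M n c i x ≤ W + entry M u x := by
      intro i u W h
      induction h with
      | refl _ => intro x hx; rw [hopDist_zero hx, hM.symm x hx c hc]; omega
      | @step _ _ l _ h hx ih =>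
        intro y hy
        have h1 := ih _ hx
        have h2 := hopDist_succ_le (M := M) hc (i := l) hx hy
        rw [hM.symm y hy _ hx] at h2
        exact h2.trans (by gcongr)
    exact key h' _ hx

end HopRepTree

/-! ### Ball carving: separation, diameter and deleted measure -/

namespace HopRepTree

theorem pow2_eq {cap x : ℕ} (h : 2 ^ x ≤ cap) : pow2 cap x = 2 ^ x := by
  induction x with
  | zero => rfl
  | succ x ih =>
    have h1 := ih ((Nat.pow_le_pow_right (by norm_num) (Nat.le_succ x)).trans h)
    unfold pow2 at h1 ⊢
    rw [Function.iterate_succ_apply', h1, min_eq_left (by rwa [pow_succ, mul_comm] at h), pow_succ,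
      mul_comm]

/-- The total measure of a list of vertices. -/
def mass (μ l : List ℕ) : ℕ := (l.map fun v => μ.getD v 0).sum

/-- The conditions on the parameters under which the algorithm is analysed. -/
structure Inst.Good (I : Inst) : Prop where
  isWeightMatrix : IsWeightMatrix I.mat I.n
  pos : ∀ u < I.n, ∀ v < I.n, u ≠ v → 1 ≤ entry I.mat u v
  root_lt : I.root < I.n
  two_le : 2 ≤ I.n
  ell_pos : 1 ≤ I.ell
  le_pow_ell : I.n ≤ 2 ^ I.ell
  pow_levels_le : 2 ^ I.levels ≤ I.cap
  pow_ell_le : 2 ^ (6 * I.ell) ≤ I.cap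
  weight_le : ∀ u < I.n, ∀ v < I.n, entry I.mat u v ≤ 2 ^ I.levels
  levels_pos : 1 ≤ I.levels

namespace Inst

variable {I : Inst} {μ : List ℕ} {j c s u v k W : ℕ}

theorem Good.rings_pos (hI : I.Good) : 0 < I.rings := by
  have := hI.ell_pos; unfold rings; omega

theorem inBall_iff (hI : I.Good) (hj : j ≤ I.levels) : I.inBall j c s v = true ↔
    4 * I.rings * hopDist I.mat I.n c ((j * I.rings + s) * (2 * I.hop)) v ≤
      2 ^ j * (I.rings + s) := by
  rw [inBall, Nat.ble_eq, pow2_eq]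
  exact (Nat.pow_le_pow_right (by norm_num) hj).trans hI.pow_levels_le

theorem inBall_self (hI : I.Good) (hj : j ≤ I.levels) (hc : c < I.n) :
    I.inBall j c s c = true := by
  rw [inBall_iff hI hj, hopDist_self hI.isWeightMatrix hc]; simp

/-- Passing to the next ball raises the radius by 2^j/(4·rings) and the hop budget by 2·hop, which
is exactly what such a walk consumes. -/
theorem inBall_step (hI : I.Good) (hj : j ≤ I.levels) (hc : c < I.n)
    (h : I.inBall j c s u = true) (huv : Conn I.mat I.n u v k W) (hk : k ≤ 2 * I.hop)
    (hW : 4 * I.rings * W ≤ 2 ^ j) : I.inBall j c (s + 1) v = true := by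
  rw [inBall_iff hI hj] at h ⊢
  have h1 := hopDist_add_le (i := (j * I.rings + s) * (2 * I.hop)) hI.isWeightMatrix hc
    (huv.mono hI.isWeightMatrix hk)
  have h2 : (j * I.rings + (s + 1)) * (2 * I.hop) =
    (j * I.rings + s) * (2 * I.hop) + 2 * I.hop := by ring
  rw [h2]
  calc _ ≤ 4 * I.rings * (_ + W) := Nat.mul_le_mul_left _ h1
    _ ≤ _ := by rw [mul_add]; linarith

theorem inBall_succ (hI : I.Good) (hj : j ≤ I.levels) (hc : c < I.n) (hv : v < I.n)
    (h : I.inBall j c s v = true) : I.inBall j c (s + 1) v = true :=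
  inBall_step hI hj hc h (.refl hv) (Nat.zero_le _) (by simp)

theorem filter_filter_inBall (hI : I.Good) (hj : j ≤ I.levels) (hc : c < I.n) {R : List ℕ}
    (hR : ∀ v ∈ R, v < I.n) :
    (R.filter (I.inBall j c (s + 1))).filter (I.inBall j c s) = R.filter (I.inBall j c s) := by
  rw [List.filter_filter]
  refine List.filter_congr fun v hv => ?_
  cases h : I.inBall j c s v
  · simp
  · simp [inBall_succ hI hj hc (hR v hv) h]

/-- Both the radius and the hop budget fit together at the change of levels. This is the hinge of
the telescoping over levels. -/
theorem inBall_rings (hI : I.Good) (hj : j + 1 ≤ I.levels) :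
    I.inBall j c I.rings v = I.inBall (j + 1) c 0 v := by
  rw [Bool.eq_iff_iff, inBall_iff hI (by omega), inBall_iff hI hj]
  have h1 : (j * I.rings + I.rings) * (2 * I.hop) = ((j + 1) * I.rings + 0) * (2 * I.hop) := by ring
  have h2 : 2 ^ j * (I.rings + I.rings) = 2 ^ (j + 1) * (I.rings + 0) := by ring
  rw [h1, h2]

theorem conn_of_inBall (hI : I.Good) (hj : j ≤ I.levels) (hc : c < I.n) (hv : v < I.n)
    (hs : s ≤ I.rings) (h : I.inBall j c s v = true) :
    ∃ W, Conn I.mat I.n c v (1 + (j + 1) * I.rings * (2 * I.hop)) W ∧ 2 * W ≤ 2 ^ j := by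
  rw [inBall_iff hI hj] at h
  refine ⟨_, (conn_hopDist hI.isWeightMatrix hc ((j * I.rings + s) * (2 * I.hop)) hv).mono
    hI.isWeightMatrix ?_, ?_⟩
  · have : (j * I.rings + s) * (2 * I.hop) ≤ (j + 1) * I.rings * (2 * I.hop) := by
      gcongr; linarith
    omega
  · have h1 : 2 ^ j * (I.rings + s) ≤ 2 ^ j * (2 * I.rings) := by gcongr; omega
    have h2 := hI.rings_pos
    refine le_of_mul_le_mul_left (a := 2 * I.rings) ?_ (by omega)
    calc _ = _ := by rw [← mul_assoc, mul_comm (2 * I.rings) 2, ← mul_assoc]; norm_num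
      _ ≤ _ := h
      _ ≤ _ := h1.trans (by rw [mul_comm])

/-- `out` is obtained from `R` by repeatedly carving out balls. -/
inductive Carves (I : Inst) (μ : List ℕ) (j : ℕ) : List ℕ → List (List ℕ) → Prop
  | nil : Carves I μ j [] []
  | step {R : List ℕ} {out : List (List ℕ)} {c s : ℕ} : c ∈ R →
      (∀ c' ∈ R, I.ballMass μ j R c' 0 ≤ I.ballMass μ j R c 0) → s < I.rings →
      (∀ s' < I.rings, I.ballMass μ j R c (s + 1) * I.ballMass μ j R c s' ≤
        I.ballMass μ j R c (s' + 1) * I.ballMass μ j R c s) →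
      Carves I μ j (R.filter fun v => !I.inBall j c (s + 1) v) out →
      Carves I μ j R (R.filter (I.inBall j c s) :: out)

theorem ballMass_eq (R : List ℕ) : I.ballMass μ j R c s = mass μ (R.filter (I.inBall j c s)) := rfl

theorem mass_pos_of_mem {l : List ℕ} (hv : v ∈ l) (h : 1 ≤ μ.getD v 0) : 1 ≤ mass μ l :=
  h.trans (List.le_sum_of_mem (List.mem_map.2 ⟨v, hv, rfl⟩))

theorem mass_le_of_sublist {l m : List ℕ} (h : l.Sublist m) : mass μ l ≤ mass μ m :=
  (h.map _).sum_le_sum fun _ _ => Nat.zero_le _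

theorem exists_ratio_min {f : ℕ → ℕ} {t : ℕ} (ht : 0 < t) (hf : ∀ s, 1 ≤ f s) :
    ∃ s ∈ List.range t, ∀ s' ∈ List.range t, f (s + 1) * f s' ≤ f (s' + 1) * f s := by
  obtain ⟨s, hs, h⟩ := exists_min_of_ne_nil (fun s => (f (s + 1) : ℚ) / f s)
    (l := List.range t) (by simp; omega)
  refine ⟨s, hs, fun s' hs' => ?_⟩
  have h1 := h s' hs'
  have h2 : (0 : ℚ) < f s := by exact_mod_cast hf s
  have h3 : (0 : ℚ) < f s' := by exact_mod_cast hf s'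
  rw [div_le_div_iff₀ h2 h3] at h1
  exact_mod_cast h1

/-- All vertices have positive measure. -/
def PosMeasure (I : Inst) (μ : List ℕ) : Prop := ∀ v < I.n, 1 ≤ μ.getD v 0

/-- Every step removes at least the centre, so as many steps as there are vertices exhaust the
remainder. The algorithm collects the clusters in reverse order. -/
theorem exists_carves (hI : I.Good) (hμ : I.PosMeasure μ) (hj : j ≤ I.levels) (k : ℕ)
    (R : List ℕ) (acc : List (List ℕ)) (hR : ∀ v ∈ R, v < I.n) (hk : R.length ≤ k) :
    ∃ out, Carves I μ j R out ∧ ((I.carveStep μ j)^[k] (R, acc)).2 = out.reverse ++ acc := by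
  induction k generalizing R acc with
  | zero =>
    obtain rfl : R = [] := List.length_eq_zero_iff.1 (by omega)
    exact ⟨[], .nil, rfl⟩
  | succ k ih =>
    rw [Function.iterate_succ_apply]
    rcases eq_or_ne R [] with rfl | hne
    · have := ih [] acc (by simp) (by simp)
      simpa [carveStep] using this
    · have hc := pick_spec (d := 0) (l := R)
        (r := fun c c' => Nat.ble (I.ballMass μ j R c' 0) (I.ballMass μ j R c 0)) (by
          simp only [Nat.ble_eq]
          exact exists_min_of_ne_nil (fun c => OrderDual.toDual (I.ballMass μ j R c 0)) hne)
      simp only [Nat.ble_eq] at hc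
      change I.center μ j R ∈ R ∧ ∀ y ∈ R, I.ballMass μ j R y 0 ≤
        I.ballMass μ j R (I.center μ j R) 0 at hc
      generalize hcdef : I.center μ j R = c at hc
      have hcn := hR c hc.1
      have hf : ∀ s, 1 ≤ I.ballMass μ j R c s := fun s => by
        rw [ballMass_eq]
        refine mass_pos_of_mem (List.mem_filter.2 ⟨hc.1, ?_⟩) (hμ c hcn)
        have := inBall_self hI hj hcn (s := s)
        exact this
      have hs := pick_spec (d := 0) (l := List.range I.rings)
        (r := fun s s' => Nat.ble (I.ballMass μ j R c (s + 1) * I.ballMass μ j R c s')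
          (I.ballMass μ j R c (s' + 1) * I.ballMass μ j R c s)) (by
          simp only [Nat.ble_eq]
          exact exists_ratio_min (f := fun s => I.ballMass μ j R c s) hI.rings_pos hf)
      simp only [Nat.ble_eq, List.mem_range] at hs
      change I.radius μ j R c < _ ∧ ∀ y < I.rings,
        I.ballMass μ j R c (I.radius μ j R c + 1) * I.ballMass μ j R c y ≤
        I.ballMass μ j R c (y + 1) * I.ballMass μ j R c (I.radius μ j R c) at hs
      generalize hsdef : I.radius μ j R c = s at hs
      have hstep : I.carveStep μ j (R, acc) = (R.filter fun v => !I.inBall j c (s + 1) v,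
          R.filter (I.inBall j c s) :: acc) := by
        have : R.isEmpty = false := by simpa using hne
        simp only [carveStep, this, cond_false, hcdef, hsdef, carveAt, Prod.mk.injEq, and_true]
        refine List.filter_congr fun v hv => ?_
        cases h : I.inBall j c s v
        · simp
        · simp [inBall_succ hI hj hcn (hR v hv) h]
      rw [hstep]
      obtain ⟨out, h1, h2⟩ := ih (R.filter fun v => !I.inBall j c (s + 1) v)
        (R.filter (I.inBall j c s) :: acc) (fun v hv => hR v (List.mem_filter.1 hv).1) (by
          have : (R.filter fun v => !I.inBall j c (s + 1) v).length < R.length :=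
            List.length_filter_lt_length_iff_exists.2 ⟨c, hc.1, by simp [inBall_self hI hj hcn]⟩
          omega)
      exact ⟨_, .step hc.1 hc.2 hs.1 hs.2 h1, by rw [h2]; simp⟩

theorem Carves.ne_nil {R : List ℕ} {out : List (List ℕ)} (h : Carves I μ j R out) (hI : I.Good)
    (hj : j ≤ I.levels) (hR : ∀ v ∈ R, v < I.n) : ∀ P ∈ out, P ≠ [] := by
  induction h with
  | nil => simp
  | step hc _ _ _ _ ih =>
    rintro P (_ | ⟨_, hP⟩)
    · exact List.ne_nil_of_mem (List.mem_filter.2 ⟨hc, inBall_self hI hj (hR _ hc)⟩)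
    · exact ih (fun v hv => hR v (List.mem_filter.1 hv).1) P hP

theorem exists_carves_carve (hI : I.Good) (hμ : I.PosMeasure μ) (hj : j ≤ I.levels) (R : List ℕ)
    (hR : ∀ v ∈ R, v < I.n) : ∃ out, Carves I μ j R out ∧ I.carve μ j R = out.reverse := by
  obtain ⟨out, h1, h2⟩ := exists_carves hI hμ hj R.length R [] hR le_rfl
  refine ⟨out, h1, ?_⟩
  rw [carve, h2, List.append_nil, List.filter_eq_self]
  intro P hP
  simpa using h1.ne_nil hI hj hR P (by simpa using hP)

/-- Nearby vertices lie in the same cluster. -/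
theorem Carves.eq_of_conn {R : List ℕ} {out : List (List ℕ)} (h : Carves I μ j R out)
    (hI : I.Good) (hj : j ≤ I.levels) (hR : ∀ v ∈ R, v < I.n) {P Q : List ℕ} (hP : P ∈ out)
    (hQ : Q ∈ out) (hu : u ∈ P) (hv : v ∈ Q) (huv : Conn I.mat I.n u v k W) (hk : k ≤ 2 * I.hop)
    (hW : 4 * I.rings * W ≤ 2 ^ j) : P = Q := by
  have hsub : ∀ {R out}, Carves I μ j R out → ∀ P ∈ out, ∀ x ∈ P, x ∈ R := by
    intro R out h
    induction h with
    | nil => simp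
    | step _ _ _ _ _ ih =>
      rintro P (_ | ⟨_, hP⟩) x hx
      · exact (List.mem_filter.1 hx).1
      · exact (List.mem_filter.1 (ih P hP x hx)).1
  induction h with
  | nil => simp at hP
  | step hc _ _ _ h' ih =>
    rcases List.mem_cons.1 hP with rfl | hP <;> rcases List.mem_cons.1 hQ with rfl | hQ
    · rfl
    · have h1 := inBall_step hI hj (hR _ hc) (List.mem_filter.1 hu).2 huv hk hW
      have h2 := (List.mem_filter.1 (hsub h' _ hQ _ hv)).2
      simp [h1] at h2
    · have h1 := inBall_step hI hj (hR _ hc) (List.mem_filter.1 hv).2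
        (huv.symm hI.isWeightMatrix) hk hW
      have h2 := (List.mem_filter.1 (hsub h' _ hP _ hu)).2
      simp [h1] at h2
    · exact ih (fun v hv => hR v (List.mem_filter.1 hv).1) hP hQ

theorem Carves.conn {R : List ℕ} {out : List (List ℕ)} (h : Carves I μ j R out)
    (hI : I.Good) (hj : j ≤ I.levels) (hR : ∀ v ∈ R, v < I.n) {P : List ℕ} (hP : P ∈ out)
    (hu : u ∈ P) (hv : v ∈ P) : ∃ W,
      Conn I.mat I.n u v (2 * (1 + (j + 1) * I.rings * (2 * I.hop))) W ∧ W ≤ 2 ^ j := by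
  induction h with
  | nil => simp at hP
  | step hc _ hs _ h' ih =>
    rcases List.mem_cons.1 hP with rfl | hP
    · rw [List.mem_filter] at hu hv
      obtain ⟨W, h1, h2⟩ := conn_of_inBall hI hj (hR _ hc) (hR _ hu.1) hs.le hu.2
      obtain ⟨W', h3, h4⟩ := conn_of_inBall hI hj (hR _ hc) (hR _ hv.1) hs.le hv.2
      refine ⟨W + W', ?_, by omega⟩
      rw [two_mul]
      exact (h1.symm hI.isWeightMatrix).trans h3
    · exact ih (fun v hv => hR v (List.mem_filter.1 hv).1) hP

/-! The measure of the deleted vertices -/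

/-- The smallest of t growth ratios is at most their geometric mean, so its logarithm times t is at
most the telescoping sum log f(t) - log f(0). The inequality 1 - 1/x ≤ log x turns the ratio into
the measure of the ring. -/
theorem ring_le {f : ℕ → ℕ} {s t : ℕ} (hf : ∀ s, 1 ≤ f s)
    (h : ∀ s' < t, f (s + 1) * f s' ≤ f (s' + 1) * f s) :
    (t : ℝ) * (f (s + 1) - f s) ≤ f (s + 1) * (Real.log (f t) - Real.log (f 0)) := by
  have hpos : ∀ s, (0 : ℝ) < f s := fun s => by exact_mod_cast hf s
  have h1 : (t : ℝ) * (Real.log (f (s + 1)) - Real.log (f s)) ≤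
      Real.log (f t) - Real.log (f 0) := by
    rw [← Finset.sum_range_sub (fun i => Real.log (f i)) t, ← nsmul_eq_mul]
    conv_lhs => rw [← Finset.card_range t]
    refine Finset.card_nsmul_le_sum _ _ _ fun i hi => ?_
    rw [← Real.log_div (hpos _).ne' (hpos _).ne', ← Real.log_div (hpos _).ne' (hpos _).ne']
    refine Real.log_le_log (div_pos (hpos _) (hpos _)) ?_
    rw [div_le_div_iff₀ (hpos _) (hpos _)]
    exact_mod_cast h i (Finset.mem_range.1 hi)
  have h2 : (f (s + 1) - f s : ℝ) ≤
      f (s + 1) * (Real.log (f (s + 1)) - Real.log (f s)) := by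
    rw [← Real.log_div (hpos _).ne' (hpos _).ne']
    have := Real.one_sub_inv_le_log_of_pos (div_pos (hpos (s + 1)) (hpos s))
    calc (f (s + 1) - f s : ℝ) = f (s + 1) * (1 - ((f (s + 1) : ℝ) / f s)⁻¹) := by
          have := (hpos (s + 1)).ne'; field_simp
      _ ≤ _ := mul_le_mul_of_nonneg_left this (hpos _).le
  calc (t : ℝ) * (f (s + 1) - f s)
      ≤ t * (f (s + 1) * (Real.log (f (s + 1)) - Real.log (f s))) :=
        mul_le_mul_of_nonneg_left h2 (Nat.cast_nonneg t)
    _ = f (s + 1) * (t * (Real.log (f (s + 1)) - Real.log (f s))) := by ring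
    _ ≤ _ := mul_le_mul_of_nonneg_left h1 (hpos _).le

/-- The clusters of level `0` that arise from a list of clusters of level `j`. -/
def refineAll (I : Inst) (μ : List ℕ) : ℕ → List (List ℕ) → List (List ℕ)
  | 0, L => L
  | j + 1, L => refineAll I μ j (L.flatMap (I.carve μ j))

theorem refineAll_append (j : ℕ) (L L' : List (List ℕ)) :
    I.refineAll μ j (L ++ L') = I.refineAll μ j L ++ I.refineAll μ j L' := by
  induction j generalizing L L' with
  | zero => rfl
  | succ j ih => simp [refineAll, ih]

theorem refineAll_nil (j : ℕ) : I.refineAll μ j [] = [] := by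
  induction j with
  | zero => rfl
  | succ j ih => simpa [refineAll] using ih

/-- The measure of the vertices that survive the refinement of `L`. -/
def survMass (I : Inst) (μ : List ℕ) (j : ℕ) (L : List (List ℕ)) : ℕ :=
  ((I.refineAll μ j L).map (mass μ)).sum

theorem survMass_cons (j : ℕ) (P : List ℕ) (L : List (List ℕ)) :
    I.survMass μ j (P :: L) = I.survMass μ j [P] + I.survMass μ j L := by
  simp only [survMass]
  rw [show P :: L = [P] ++ L from rfl, refineAll_append]; simp

theorem survMass_reverse (j : ℕ) (L : List (List ℕ)) :
    I.survMass μ j L.reverse = I.survMass μ j L := by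
  induction L with
  | nil => rfl
  | cons P L ih =>
    rw [survMass_cons, ← ih, List.reverse_cons, survMass, refineAll_append]
    simp [survMass, add_comm]

theorem mass_filter_add (l : List ℕ) (p : ℕ → Bool) :
    mass μ (l.filter p) + mass μ (l.filter fun v => !p v) = mass μ l := by
  induction l with
  | nil => rfl
  | cons a l ih =>
    simp only [mass, List.filter_cons] at ih ⊢
    cases p a <;> simp at ih ⊢ <;> omega

/-- Let f be the measures of the balls that are grown, and s the chosen radius. The ring costs at
most f(s+1)·(log f(rings) - log f(0)), where f(rings) ≤ A. Inductively, the later losses inside the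
ball cost at most f(s)·log f(0). Together this is at most f(s+1)·log A, and the parts cut off in
succession add up to the mass of P. -/
theorem loss_le (hI : I.Good) (hμ : I.PosMeasure μ) (hj : j ≤ I.levels) (P : List ℕ)
    (hP : ∀ v ∈ P, v < I.n) (A : ℕ) (hA : 1 ≤ A) (h : ∀ c ∈ P, I.ballMass μ j P c 0 ≤ A) :
    (I.rings : ℝ) * (mass μ P - I.survMass μ j [P]) ≤ mass μ P * Real.log A := by
  induction j generalizing P A with
  | zero =>
    have h1 : (0 : ℝ) ≤ Real.log A := Real.log_nonneg (by exact_mod_cast hA)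
    have h2 : I.survMass μ 0 [P] = mass μ P := by simp [survMass, refineAll]
    rw [h2, sub_self, mul_zero]
    positivity
  | succ j ih =>
    obtain ⟨out, hc, hout⟩ := exists_carves_carve hI hμ (j := j) (by omega) P hP
    have hsurv : I.survMass μ (j + 1) [P] = I.survMass μ j out := by
      rw [← survMass_reverse j out, ← hout]; simp [survMass, refineAll]
    rw [hsurv]
    clear hsurv hout
    have hlogA : (0 : ℝ) ≤ Real.log A := Real.log_nonneg (by exact_mod_cast hA)
    induction hc with
    | nil => simp [mass, survMass, refineAll_nil]
    | @step R out c s hcR hmax hs hrad hc ih' =>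
      have hcn := hP c hcR
      have hf : ∀ s, 1 ≤ I.ballMass μ j R c s := fun s =>
        mass_pos_of_mem (List.mem_filter.2 ⟨hcR, inBall_self hI (by omega) hcn⟩) (hμ c hcn)
      -- In the remainder balls only get lighter, so the same A serves.
      have h1 := ih' (fun v hv => hP v (List.mem_filter.1 hv).1) fun c' hc' =>
        (mass_le_of_sublist (List.filter_sublist.filter _)).trans (h c' (List.mem_filter.1 hc').1)
      have h2 := ring_le hf hrad
      -- By the choice of the centre, the new bound one level down is the measure of its innermost
      -- ball.
      have h3 := ih (by omega) (R.filter (I.inBall j c s)) (fun v hv => hP v (List.mem_filter.1 hv).1)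
        (I.ballMass μ j R c 0) (hf 0) fun c' hc' =>
        (mass_le_of_sublist (List.filter_sublist.filter _)).trans (hmax c' (List.mem_filter.1 hc').1)
      rw [← ballMass_eq] at h3
      have h4 : mass μ (R.filter fun v => !I.inBall j c (s + 1) v) =
          (mass μ R : ℝ) - I.ballMass μ j R c (s + 1) := by
        rw [← mass_filter_add R (I.inBall j c (s + 1)), ballMass_eq]; push_cast; ring
      have h5 : I.ballMass μ j R c I.rings ≤ A := by
        refine le_of_eq_of_le ?_ (h c hcR)
        rw [ballMass_eq, ballMass_eq]
        congr 1
        exact List.filter_congr fun v _ => inBall_rings hI hj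
      have h6 : Real.log (I.ballMass μ j R c I.rings) ≤ Real.log A :=
        Real.log_le_log (by exact_mod_cast hf _) (by exact_mod_cast h5)
      have h7 : (0 : ℝ) ≤ Real.log (I.ballMass μ j R c 0) :=
        Real.log_nonneg (by exact_mod_cast hf 0)
      have h8 : (I.ballMass μ j R c s : ℝ) ≤ I.ballMass μ j R c (s + 1) := by
        have := mass_filter_add (μ := μ) (R.filter (I.inBall j c (s + 1))) (I.inBall j c s)
        rw [filter_filter_inBall hI (by omega) hcn hP] at this
        rw [ballMass_eq, ballMass_eq]
        exact_mod_cast (by omega : _ ≤ _)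
      rw [h4] at h1
      rw [survMass_cons]
      push_cast
      -- The term with log f(0) gained inside the cluster is absorbed by the one subtracted in the
      -- bound for the ring.
      have h9 := mul_le_mul_of_nonneg_right h8 h7
      have h10 := mul_le_mul_of_nonneg_left h6 (Nat.cast_nonneg (α := ℝ) (I.ballMass μ j R c (s + 1)))
      linarith

end Inst

end HopRepTree

/-! ### Properties of the hierarchical partition -/

namespace HopRepTree

namespace Inst

variable {I : Inst} {μ : List ℕ} {j c s u v k W : ℕ}

theorem Conn.eq_of_weight_zero (hI : I.Good) (h : Conn I.mat I.n u v k 0) : u = v := by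
  generalize hW : 0 = W at h
  induction h with
  | refl _ => rfl
  | @step x y k W h hx ih =>
    have h1 := ih (by omega)
    by_contra hne
    have := hI.pos x h.right_lt y hx (by rintro rfl; exact hne h1)
    omega

/-- Twice the distance from the centre is at most 1, hence it is 0; since distinct vertices have
positive distance, a cluster of level 0 consists of its centre alone. -/
theorem Carves.eq_of_mem_zero {R : List ℕ} {out : List (List ℕ)} (h : Carves I μ 0 R out)
    (hI : I.Good) (hR : ∀ v ∈ R, v < I.n) {P : List ℕ} (hP : P ∈ out) (hu : u ∈ P) (hv : v ∈ P) :
    u = v := by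
  induction h with
  | nil => simp at hP
  | step hc _ hs _ h' ih =>
    rcases List.mem_cons.1 hP with rfl | hP
    · rw [List.mem_filter] at hu hv
      obtain ⟨W, h1, h2⟩ := conn_of_inBall hI (Nat.zero_le _) (hR _ hc) (hR _ hu.1) hs.le hu.2
      obtain ⟨W', h3, h4⟩ := conn_of_inBall hI (Nat.zero_le _) (hR _ hc) (hR _ hv.1) hs.le hv.2
      obtain rfl : W = 0 := by omega
      obtain rfl : W' = 0 := by omega
      exact (Conn.eq_of_weight_zero hI h1).symm.trans (Conn.eq_of_weight_zero hI h3)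
    · exact ih (fun v hv => hR v (List.mem_filter.1 hv).1) hP

theorem Carves.flatten_subperm {R : List ℕ} {out : List (List ℕ)} (h : Carves I μ j R out)
    (hI : I.Good) (hj : j ≤ I.levels) (hR : ∀ v ∈ R, v < I.n) : out.flatten.Subperm R := by
  induction h with
  | nil => exact List.nil_subperm
  | @step R out c s hc _ _ _ h' ih =>
    have h1 := ih fun v hv => hR v (List.mem_filter.1 hv).1
    have h2 : (R.filter (I.inBall j c s)).Subperm (R.filter (I.inBall j c (s + 1))) := by
      rw [← filter_filter_inBall hI hj (hR c hc) hR]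
      exact List.filter_sublist.subperm
    exact (h2.append h1).trans (List.filter_append_perm _ _).subperm

theorem mem_verts (hI : I.Good) : v ∈ I.verts ↔ v < I.n := by
  have := hI.root_lt
  have hb : ∀ v w, Nat.beq v w = false ↔ v ≠ w := fun v w => by
    rw [← Bool.not_eq_true, Nat.beq_eq]
  simp only [verts, others, List.mem_cons, List.mem_filter, List.mem_range, Bool.not_eq_true', hb]
  constructor
  · rintro (rfl | h)
    · exact this
    · exact h.1
  · intro h
    by_cases hv : v = I.root
    · exact .inl hv
    · exact .inr ⟨h, hv⟩

theorem nodup_verts : I.verts.Nodup := by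
  simp only [verts, others, List.nodup_cons]
  exact ⟨by simp, List.nodup_range.filter _⟩

/-- The clusters of level `j`. -/
def clusters (I : Inst) (μ : List ℕ) (j : ℕ) : List (List ℕ) :=
  ((I.refineStep μ)^[I.levels - j] [[I.verts]]).headD []

theorem getD_hierarchy (hj : j ≤ I.levels) : (I.hierarchy μ).getD j [] = I.clusters μ j := by
  have key : ∀ m i, ((I.refineStep μ)^[i + m] [[I.verts]]).drop m =
      (I.refineStep μ)^[i] [[I.verts]] := by
    intro m i
    induction m with
    | zero => rfl
    | succ m ih => rw [← add_assoc, Function.iterate_succ_apply', refineStep, List.drop_succ_cons, ih]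
  rw [hierarchy, clusters, List.getD_eq_getElem?_getD, ← List.head?_drop,
    List.headD_eq_head?_getD, ← key j (I.levels - j), Nat.sub_add_cancel hj]

theorem clusters_levels : I.clusters μ I.levels = [I.verts] := by simp [clusters]

theorem clusters_of_lt (hj : j < I.levels) :
    I.clusters μ j = (I.clusters μ (j + 1)).flatMap (I.carve μ j) := by
  have h : I.levels - j = I.levels - (j + 1) + 1 := by omega
  rw [clusters, h, Function.iterate_succ_apply', refineStep, List.headD_cons,
    (I.refineStep_iterate μ _).1, ← clusters]
  congr 2
  omega

theorem lt_of_mem_clusters (hI : I.Good) {P : List ℕ} (hP : P ∈ I.clusters μ j) (hv : v ∈ P) :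
    v < I.n := by
  have h := I.refineStep_iterate μ (I.levels - j)
  obtain ⟨L, H, hL⟩ := List.exists_cons_of_length_eq_add_one h.1
  rw [clusters, hL, List.headD_cons] at hP
  rw [hL] at h
  exact (mem_verts hI).1 (((h.2 L (by simp)).1 P hP).1.mem hv)

theorem refineAll_clusters (hj : j ≤ I.levels) :
    I.refineAll μ j (I.clusters μ j) = I.clusters μ 0 := by
  induction j with
  | zero => rfl
  | succ j ih => rw [refineAll, ← clusters_of_lt (by omega), ih (by omega)]

theorem mem_clusters_of_lt (hI : I.Good) (hμ : I.PosMeasure μ) (hj : j < I.levels) {P : List ℕ}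
    (hP : P ∈ I.clusters μ j) : ∃ Q ∈ I.clusters μ (j + 1), ∃ out, Carves I μ j Q out ∧
      I.carve μ j Q = out.reverse ∧ P ∈ out ∧ ∀ v ∈ P, v ∈ Q := by
  rw [clusters_of_lt hj] at hP
  obtain ⟨Q, hQ, hP⟩ := List.mem_flatMap.1 hP
  obtain ⟨out, h1, h2⟩ := exists_carves_carve hI hμ hj.le Q fun v hv => lt_of_mem_clusters hI hQ hv
  exact ⟨Q, hQ, out, h1, h2, by simpa [h2] using hP, fun v hv => (I.carve_sublist μ j hP).1.mem hv⟩

/-- Downward induction on the level: a walk that is light for level j is light for level j+1, so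
both clusters come from the same carving, where the deleted rings separate them. The trivial walk
shows in particular that clusters of one level are disjoint or equal. -/
theorem clusters_eq_of_conn (hI : I.Good) (hμ : I.PosMeasure μ) (hj : j ≤ I.levels)
    {P Q : List ℕ} (hP : P ∈ I.clusters μ j) (hQ : Q ∈ I.clusters μ j) (hu : u ∈ P) (hv : v ∈ Q)
    (huv : Conn I.mat I.n u v k W) (hk : k ≤ 2 * I.hop) (hW : 4 * I.rings * W ≤ 2 ^ j) : P = Q := by
  induction hj using Nat.decreasingInduction generalizing P Q with
  | self =>
    rw [clusters_levels, List.mem_singleton] at hP hQ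
    rw [hP, hQ]
  | of_succ j hj ih =>
    obtain ⟨P', hP', out, h1, h1r, h2, h3⟩ := mem_clusters_of_lt hI hμ hj hP
    obtain ⟨Q', hQ', out', h1', h1r', h2', h3'⟩ := mem_clusters_of_lt hI hμ hj hQ
    obtain rfl := ih hP' hQ' (h3 u hu) (h3' v hv)
      (hW.trans (Nat.pow_le_pow_right (by norm_num) (Nat.le_succ j)))
    obtain rfl : out = out' := List.reverse_injective (h1r.symm.trans h1r')
    exact h1.eq_of_conn hI hj.le (fun v hv => lt_of_mem_clusters hI hP' hv) h2 h2' hu hv huv hk hW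

/-- The number of steps that suffice to connect the vertices of a cluster. -/
def hopRadius (I : Inst) : ℕ := 2 * (1 + I.levels * I.rings * (2 * I.hop))

/-- Below the top both vertices are joined through the centre of their ball; at the top a single
edge suffices, as all weights are at most 2^levels. -/
theorem clusters_conn (hI : I.Good) (hμ : I.PosMeasure μ) (hj : j ≤ I.levels) {P : List ℕ}
    (hP : P ∈ I.clusters μ j) (hu : u ∈ P) (hv : v ∈ P) :
    ∃ W, Conn I.mat I.n u v I.hopRadius W ∧ W ≤ 2 ^ j := by
  rcases hj.eq_or_lt with rfl | hj
  · have hu := lt_of_mem_clusters hI hP hu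
    have hv := lt_of_mem_clusters hI hP hv
    exact ⟨_, (Conn.single hu hv).mono hI.isWeightMatrix (by unfold hopRadius; omega),
      hI.weight_le u hu v hv⟩
  · obtain ⟨Q, hQ, out, h1, -, h2, -⟩ := mem_clusters_of_lt hI hμ hj hP
    obtain ⟨W, h3, h4⟩ :=
      h1.conn hI hj.le (fun v hv => lt_of_mem_clusters hI hQ hv) h2 hu hv
    refine ⟨W, h3.mono hI.isWeightMatrix ?_, h4⟩
    unfold hopRadius
    gcongr
    omega

theorem flatten_clusters_subperm (hI : I.Good) (hμ : I.PosMeasure μ) (hj : j ≤ I.levels) :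
    (I.clusters μ j).flatten.Subperm I.verts := by
  induction hj using Nat.decreasingInduction with
  | self => simp [clusters_levels, List.Subperm.refl]
  | of_succ j hj ih =>
    refine List.Subperm.trans ?_ ih
    rw [clusters_of_lt hj]
    have h := fun P (hP : P ∈ I.clusters μ (j + 1)) v (hv : v ∈ P) => lt_of_mem_clusters hI hP hv
    generalize I.clusters μ (j + 1) = L at h
    induction L with
    | nil => exact List.nil_subperm
    | cons P L ih =>
      simp only [List.flatMap_cons, List.flatten_append, List.flatten_cons]
      refine List.Subperm.append ?_ (ih fun Q hQ => h Q (by simp [hQ]))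
      have hP := h P (by simp)
      obtain ⟨out, h1, h2⟩ := exists_carves_carve hI hμ hj.le P hP
      rw [h2]
      exact ((List.reverse_perm out).flatten.subperm).trans (h1.flatten_subperm hI hj.le hP)

end Inst

theorem same_iff {H : List (List (List ℕ))} {j u v : ℕ} :
    same H j u v = true ↔ ∃ P ∈ H.getD j [], u ∈ P ∧ v ∈ P := by
  simp [same, List.any_eq_true]

namespace Inst

/-- The properties of a hierarchical partition that are used below. -/
structure IsHierarchy (I : Inst) (H : List (List (List ℕ))) : Prop where
  lt : ∀ {v}, alive H v = true → v < I.n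
  trans : ∀ {j u v x}, j ≤ I.levels → same H j u v = true → same H j v x = true →
    same H j u x = true
  mono : ∀ {j u v}, j < I.levels → same H j u v = true → same H (j + 1) u v = true
  top : ∀ {u v}, u < I.n → v < I.n → same H I.levels u v = true
  zero : ∀ {u v}, same H 0 u v = true → u = v
  conn : ∀ {j u v}, j ≤ I.levels → same H j u v = true →
    ∃ W, Conn I.mat I.n u v I.hopRadius W ∧ W ≤ 2 ^ j
  sep : ∀ {j u v k W}, j ≤ I.levels → alive H u = true → alive H v = true →
    Conn I.mat I.n u v k W → k ≤ 2 * I.hop → 4 * I.rings * W ≤ 2 ^ j → same H j u v = true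
  root_alive : alive H I.root = true

variable {I : Inst} {μ : List ℕ} {j c s u v k W : ℕ}

theorem IsHierarchy.mono_le {H : List (List (List ℕ))} (hH : I.IsHierarchy H) {i : ℕ}
    (hij : i ≤ j) (hj : j ≤ I.levels) (h : same H i u v = true) : same H j u v = true := by
  induction j, hij using Nat.le_induction with
  | base => exact h
  | succ j _ ih => exact hH.mono (by omega) (ih (by omega))

theorem same_hierarchy_iff (hj : j ≤ I.levels) : same (I.hierarchy μ) j u v = true ↔
    ∃ P ∈ I.clusters μ j, u ∈ P ∧ v ∈ P := by
  rw [same_iff, getD_hierarchy hj]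

theorem isHierarchy (hI : I.Good) (hμ : I.PosMeasure μ)
    (hr : alive (I.hierarchy μ) I.root = true) : I.IsHierarchy (I.hierarchy μ) := by
  have hmono : ∀ {j u v}, j < I.levels → same (I.hierarchy μ) j u v = true →
      same (I.hierarchy μ) (j + 1) u v = true := by
    intro j u v hj h
    rw [same_hierarchy_iff hj.le] at h
    rw [same_hierarchy_iff (by omega)]
    obtain ⟨P, hP, hu, hv⟩ := h
    obtain ⟨Q, hQ, -, -, -, -, h⟩ := mem_clusters_of_lt hI hμ hj hP
    exact ⟨Q, hQ, h u hu, h v hv⟩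
  have hmono' : ∀ {j v}, j ≤ I.levels → alive (I.hierarchy μ) v = true →
      same (I.hierarchy μ) j v v = true := by
    intro j v hj h
    induction j with
    | zero => exact h
    | succ j ih => exact hmono (by omega) (ih (by omega))
  refine ⟨?_, ?_, hmono, ?_, ?_, ?_, ?_, hr⟩
  · intro v h
    rw [alive, same_hierarchy_iff (Nat.zero_le _)] at h
    obtain ⟨P, hP, hv, -⟩ := h
    exact lt_of_mem_clusters hI hP hv
  · intro j u v x hj h1 h2
    rw [same_hierarchy_iff hj] at h1 h2 ⊢
    obtain ⟨P, hP, hu, hv⟩ := h1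
    obtain ⟨Q, hQ, hv', hx⟩ := h2
    obtain rfl := clusters_eq_of_conn hI hμ hj hP hQ hv hv' (.refl (lt_of_mem_clusters hI hP hv))
      (Nat.zero_le _) (by simp)
    exact ⟨P, hP, hu, hx⟩
  · intro u v hu hv
    rw [same_hierarchy_iff le_rfl, clusters_levels]
    exact ⟨_, List.mem_singleton_self _, (mem_verts hI).2 hu, (mem_verts hI).2 hv⟩
  · intro u v h
    rw [same_hierarchy_iff (Nat.zero_le _)] at h
    obtain ⟨P, hP, hu, hv⟩ := h
    obtain ⟨Q, hQ, out, h1, -, h2, -⟩ := mem_clusters_of_lt hI hμ hI.levels_pos hP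
    exact h1.eq_of_mem_zero hI (fun v hv => lt_of_mem_clusters hI hQ hv) h2 hu hv
  · intro j u v hj h
    rw [same_hierarchy_iff hj] at h
    obtain ⟨P, hP, hu, hv⟩ := h
    exact clusters_conn hI hμ hj hP hu hv
  · intro j u v k W hj hu hv h hk hW
    have hu := hmono' hj hu
    have hv := hmono' hj hv
    rw [same_hierarchy_iff hj] at hu hv ⊢
    obtain ⟨P, hP, hu, -⟩ := hu
    obtain ⟨Q, hQ, hv, -⟩ := hv
    obtain rfl := clusters_eq_of_conn hI hμ hj hP hQ hu hv h hk hW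
    exact ⟨P, hP, hu, hv⟩

theorem mass_flatten (L : List (List ℕ)) : mass μ L.flatten = (L.map (mass μ)).sum := by
  induction L with
  | nil => rfl
  | cons P L ih => simp [mass] at ih ⊢; exact ih

theorem mass_le_of_subperm {l m : List ℕ} (h : l.Subperm m) : mass μ l ≤ mass μ m := by
  obtain ⟨l', h1, h2⟩ := h
  rw [mass, ← (h1.map _).sum_eq]
  exact mass_le_of_sublist h2

/-- This is `loss_le` at the top level, where the total mass bounds every ball. -/
theorem mass_dead_le (hI : I.Good) (hμ : I.PosMeasure μ) :
    (I.rings : ℝ) * mass μ (I.verts.filter fun v => !alive (I.hierarchy μ) v) ≤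
      mass μ I.verts * Real.log (mass μ I.verts) := by
  have hv : ∀ v ∈ I.verts, v < I.n := fun v => (mem_verts hI).1
  have h1 : 1 ≤ mass μ I.verts :=
    mass_pos_of_mem (v := I.root) (by simp [verts]) (hμ _ hI.root_lt)
  refine le_trans ?_ (loss_le hI hμ le_rfl I.verts hv _ h1 fun c _ =>
    mass_le_of_sublist List.filter_sublist)
  have h2 : I.survMass μ I.levels [I.verts] ≤
      mass μ (I.verts.filter (alive (I.hierarchy μ))) := by
    rw [survMass, ← clusters_levels (μ := μ), refineAll_clusters le_rfl, ← mass_flatten]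
    have h3 := flatten_clusters_subperm hI hμ (Nat.zero_le I.levels)
    refine mass_le_of_subperm (List.subperm_of_subset ?_ fun v hv => ?_)
    · obtain ⟨l, hl, hl'⟩ := h3
      exact hl.nodup_iff.1 (nodup_verts.sublist hl')
    · refine List.mem_filter.2 ⟨h3.subset hv, ?_⟩
      rw [alive, same_hierarchy_iff (Nat.zero_le _)]
      obtain ⟨P, hP, hv⟩ := List.mem_flatten.1 hv
      exact ⟨P, hP, hv, hv⟩
  have h3 := mass_filter_add (μ := μ) I.verts (alive (I.hierarchy μ))
  gcongr
  rw [← h3]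
  push_cast
  have : (I.survMass μ I.levels [I.verts] : ℝ) ≤
    mass μ (I.verts.filter (alive (I.hierarchy μ))) := by exact_mod_cast h2
  linarith

end Inst

end HopRepTree

/-! ### Multiplicative weights: every pair of vertices survives in some round -/

namespace HopRepTree

namespace Inst

variable {I : Inst}

/-- The number of hierarchies in which `v` has been deleted. -/
def lost (Hs : List (List (List (List ℕ)))) (v : ℕ) : ℕ :=
  (Hs.filter fun H => !alive H v).length

/-- The total penalty of the vertices other than the root. -/
def totalPenalty (I : Inst) (Hs : List (List (List (List ℕ)))) : ℕ :=
  (I.others.map (I.penalty Hs)).sum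

variable {Hs : List (List (List (List ℕ)))}

theorem penalty_eq (hI : I.Good) (h : Hs.length ≤ I.rounds) (v : ℕ) :
    I.penalty Hs v = 2 ^ lost Hs v := by
  refine pow2_eq (le_trans ?_ hI.pow_ell_le)
  exact Nat.pow_le_pow_right (by norm_num) ((List.length_filter_le _ _).trans h)

theorem mem_others {v : ℕ} : v ∈ I.others ↔ v < I.n ∧ v ≠ I.root := by
  have hb : ∀ v w, Nat.beq v w = false ↔ v ≠ w := fun v w => by
    rw [← Bool.not_eq_true, Nat.beq_eq]
  simp [others, hb]

theorem length_others (hI : I.Good) : I.others.length + 1 = I.n := by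
  have h : I.verts.Perm (List.range I.n) :=
    (List.perm_ext_iff_of_nodup nodup_verts List.nodup_range).2 fun v => by
      rw [mem_verts hI, List.mem_range]
  simpa [verts] using h.length_eq

theorem getD_measure {v : ℕ} (hv : v < I.n) : (I.measure Hs).getD v 0 =
    if v = I.root then I.totalPenalty Hs else I.penalty Hs v := by
  have : ∀ b : Bool, ∀ x y : ℕ, cond b x y = if b = true then x else y := fun b x y => by
    cases b <;> rfl
  simp [measure, hv, this, totalPenalty]

theorem map_getD_measure : (I.others.map fun v => (I.measure Hs).getD v 0) =
    I.others.map (I.penalty Hs) :=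
  List.map_congr_left fun v hv => by
    rw [mem_others] at hv
    rw [getD_measure hv.1, if_neg hv.2]

theorem mass_measure (hI : I.Good) : mass (I.measure Hs) I.verts = 2 * I.totalPenalty Hs := by
  rw [mass, verts, List.map_cons, List.sum_cons, map_getD_measure, getD_measure hI.root_lt,
    if_pos rfl, totalPenalty]
  ring

theorem penalty_pos (hI : I.Good) (h : Hs.length ≤ I.rounds) (v : ℕ) : 1 ≤ I.penalty Hs v := by
  rw [penalty_eq hI h]; exact Nat.one_le_two_pow

theorem totalPenalty_pos (hI : I.Good) (h : Hs.length ≤ I.rounds) : 1 ≤ I.totalPenalty Hs := by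
  have h1 := length_others hI
  have h2 := hI.two_le
  obtain ⟨v, hv⟩ := List.exists_mem_of_length_pos (l := I.others) (by omega)
  exact (penalty_pos hI h v).trans (List.le_sum_of_mem (List.mem_map.2 ⟨v, hv, rfl⟩))

/-- The exponent 8·ell collects 6·ell for the penalty of a vertex, ell for the number of vertices
and ell for the factor 2. -/
theorem totalPenalty_le (hI : I.Good) (h : Hs.length ≤ I.rounds) :
    2 * I.totalPenalty Hs ≤ 2 ^ (8 * I.ell) := by
  have h1 := List.sum_le_card_nsmul (I.others.map (I.penalty Hs)) (2 ^ (6 * I.ell)) (by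
    simp only [List.mem_map]
    rintro _ ⟨v, -, rfl⟩
    rw [penalty_eq hI h]
    exact Nat.pow_le_pow_right (by norm_num) ((List.length_filter_le _ _).trans h))
  have h2 := length_others hI
  have h3 := hI.le_pow_ell
  rw [List.length_map, smul_eq_mul] at h1
  calc 2 * I.totalPenalty Hs ≤ 2 ^ I.ell * (2 ^ I.ell * 2 ^ (6 * I.ell)) := by
        refine Nat.mul_le_mul ?_ (h1.trans (Nat.mul_le_mul_right _ (by omega)))
        exact Nat.le_self_pow (by have := hI.ell_pos; omega) 2
    _ = 2 ^ (8 * I.ell) := by rw [← pow_add, ← pow_add]; congr 1; ring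

theorem posMeasure (hI : I.Good) (h : Hs.length ≤ I.rounds) : I.PosMeasure (I.measure Hs) := by
  intro v hv
  rw [getD_measure hv]
  split_ifs
  · exact totalPenalty_pos hI h
  · exact penalty_pos hI h v

/-- With Φ the total penalty, the mass is 2Φ and its logarithm is at most 8·ell. Division by the
64·ell rings leaves at most Φ/4. -/
theorem mass_dead_measure_le (hI : I.Good) (h : Hs.length ≤ I.rounds) :
    4 * mass (I.measure Hs)
      (I.verts.filter fun v => !alive (I.hierarchy (I.measure Hs)) v) ≤ I.totalPenalty Hs := by
  have h1 := mass_dead_le hI (posMeasure hI h)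
  rw [mass_measure hI] at h1
  set D := mass (I.measure Hs) (I.verts.filter fun v => !alive (I.hierarchy (I.measure Hs)) v)
  have h2 : Real.log ((2 * I.totalPenalty Hs : ℕ) : ℝ) ≤ 8 * I.ell := by
    have h3 := totalPenalty_pos hI h
    calc _ ≤ Real.log ((2 : ℝ) ^ (8 * I.ell)) :=
          Real.log_le_log (by exact_mod_cast (by omega : 0 < _)) (by
            exact_mod_cast totalPenalty_le hI h)
      _ = (8 * I.ell) * Real.log 2 := by rw [Real.log_pow]; push_cast; ring
      _ ≤ (8 * I.ell) * 1 := by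
          gcongr
          exact (Real.log_two_lt_d9.trans (by norm_num)).le
      _ = _ := mul_one _
  have h4 := h1.trans (mul_le_mul_of_nonneg_left h2 (Nat.cast_nonneg _))
  have h5 : I.rings * D ≤ 2 * I.totalPenalty Hs * (8 * I.ell) := by exact_mod_cast h4
  refine Nat.le_of_mul_le_mul_left (c := 16 * I.ell) ?_ (by have := hI.ell_pos; omega)
  rw [rings] at h5
  calc _ = 64 * I.ell * D := by ring
    _ ≤ _ := h5
    _ = _ := by ring

/-- The measure of the root alone is the total penalty, four times as much as can be deleted. -/
theorem root_alive (hI : I.Good) (h : Hs.length ≤ I.rounds) :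
    alive (I.hierarchy (I.measure Hs)) I.root = true := by
  by_contra hr
  have h1 := mass_dead_measure_le hI h
  have h2 : I.totalPenalty Hs ≤ mass (I.measure Hs)
      (I.verts.filter fun v => !alive (I.hierarchy (I.measure Hs)) v) := by
    refine List.le_sum_of_mem (List.mem_map.2 ⟨I.root, List.mem_filter.2 ⟨by simp [verts], ?_⟩, ?_⟩)
    · simpa using hr
    · rw [getD_measure hI.root_lt, if_pos rfl]
  have := totalPenalty_pos hI h
  omega

/-- Deleted vertices double their penalty, so the total grows by the deleted measure outside the
root. -/
theorem totalPenalty_cons_le (hI : I.Good) (h : Hs.length + 1 ≤ I.rounds) :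
    4 * I.totalPenalty (I.hierarchy (I.measure Hs) :: Hs) ≤ 5 * I.totalPenalty Hs := by
  have h1 := mass_dead_measure_le hI (Hs := Hs) (by omega)
  have h2 : I.totalPenalty (I.hierarchy (I.measure Hs) :: Hs) = I.totalPenalty Hs +
      ((I.others.filter fun v => !alive (I.hierarchy (I.measure Hs)) v).map (I.penalty Hs)).sum := by
    rw [totalPenalty, totalPenalty]
    induction I.others with
    | nil => rfl
    | cons v l ih =>
      have : I.penalty (I.hierarchy (I.measure Hs) :: Hs) v = I.penalty Hs v +
          if alive (I.hierarchy (I.measure Hs)) v = true then 0 else I.penalty Hs v := by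
        rw [penalty_eq hI (by simpa), penalty_eq hI (by omega), lost, lost, List.filter_cons]
        cases alive (I.hierarchy (I.measure Hs)) v
        · simp [pow_succ]; omega
        · simp
      simp only [List.map_cons, List.sum_cons, ih, this, List.filter_cons]
      cases alive (I.hierarchy (I.measure Hs)) v <;> simp <;> omega
  have h3 : ((I.others.filter fun v => !alive (I.hierarchy (I.measure Hs)) v).map
      (I.penalty Hs)).sum ≤ mass (I.measure Hs)
      (I.verts.filter fun v => !alive (I.hierarchy (I.measure Hs)) v) := by
    have : ((I.others.filter fun v => !alive (I.hierarchy (I.measure Hs)) v).map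
      (I.penalty Hs)) = (I.others.filter fun v => !alive (I.hierarchy (I.measure Hs)) v).map
      fun v => (I.measure Hs).getD v 0 :=
      List.map_congr_left fun v hv => by
        have := mem_others.1 (List.mem_filter.1 hv).1
        rw [getD_measure this.1, if_neg this.2]
    rw [this]
    exact mass_le_of_sublist ((List.sublist_cons_self _ _).filter _)
  omega

theorem iterate_spec (hI : I.Good) {i : ℕ} (hi : i ≤ I.rounds) :
    ((fun Hs => I.hierarchy (I.measure Hs) :: Hs)^[i] []).length = i ∧
    (∀ H ∈ (fun Hs => I.hierarchy (I.measure Hs) :: Hs)^[i] [], I.IsHierarchy H) ∧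
    4 ^ i * I.totalPenalty ((fun Hs => I.hierarchy (I.measure Hs) :: Hs)^[i] []) ≤ 5 ^ i * I.n := by
  induction i with
  | zero =>
    have h1 := length_others hI
    have h2 : I.penalty [] = fun _ => 1 := rfl
    simp [totalPenalty, h2]
    omega
  | succ i ih =>
    obtain ⟨h1, h2, h3⟩ := ih (by omega)
    rw [Function.iterate_succ_apply']
    generalize (fun Hs => I.hierarchy (I.measure Hs) :: Hs)^[i] [] = Hs at h1 h2 h3
    refine ⟨by simp [h1], fun H hH => ?_, ?_⟩
    · rcases List.mem_cons.1 hH with rfl | hH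
      · exact isHierarchy hI (posMeasure hI (by omega)) (root_alive hI (by omega))
      · exact h2 H hH
    · have := totalPenalty_cons_le hI (Hs := Hs) (by omega)
      calc _ = 4 ^ i * (4 * I.totalPenalty (I.hierarchy (I.measure Hs) :: Hs)) := by ring
        _ ≤ 4 ^ i * (5 * I.totalPenalty Hs) := Nat.mul_le_mul_left _ this
        _ = 5 * (4 ^ i * I.totalPenalty Hs) := by ring
        _ ≤ 5 * (5 ^ i * I.n) := Nat.mul_le_mul_left _ h3
        _ = _ := by ring

theorem length_hierarchies (hI : I.Good) : I.hierarchies.length = I.rounds :=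
  (iterate_spec hI le_rfl).1

theorem isHierarchy_of_mem (hI : I.Good) {H : List (List (List ℕ))} (hH : H ∈ I.hierarchies) :
    I.IsHierarchy H :=
  (iterate_spec hI le_rfl).2.1 H hH

/-- After 6·ell rounds the total penalty is at most n·(5/4)^(6·ell), while 3·ell deletions would
give a single vertex the penalty 2^(3·ell). -/
theorem lost_lt (hI : I.Good) {v : ℕ} (hv : v < I.n) : lost I.hierarchies v < 3 * I.ell := by
  by_cases hr : v = I.root
  · have : lost I.hierarchies v = 0 := by
      rw [lost, List.length_eq_zero_iff, List.filter_eq_nil_iff]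
      intro H hH
      simp [hr, (isHierarchy_of_mem hI hH).root_alive]
    have := hI.ell_pos
    omega
  · by_contra! hge
    have h1 : 2 ^ (3 * I.ell) ≤ I.totalPenalty I.hierarchies := by
      refine le_trans ?_ (List.le_sum_of_mem (List.mem_map.2 ⟨v, mem_others.2 ⟨hv, hr⟩, rfl⟩))
      rw [penalty_eq hI (length_hierarchies hI).le]
      exact Nat.pow_le_pow_right (by norm_num) hge
    have h2 : 4 ^ I.rounds * I.totalPenalty I.hierarchies ≤ 5 ^ I.rounds * I.n :=
      (iterate_spec hI le_rfl).2.2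
    have h3 : 4 ^ I.rounds * 2 ^ (3 * I.ell) ≤ 5 ^ I.rounds * 2 ^ I.ell :=
      (Nat.mul_le_mul_left _ h1).trans (h2.trans (Nat.mul_le_mul_left _ hI.le_pow_ell))
    -- The contradiction is the ell-th power of 5^6·2 = 31250 < 32768 = 4^6·2^3.
    rw [rounds, pow_mul, pow_mul, pow_mul, ← mul_pow, ← mul_pow] at h3
    exact absurd h3 (not_le.2 (Nat.pow_lt_pow_left (by norm_num) (by have := hI.ell_pos; omega)))

/-- Every pair of vertices survives in one of the hierarchies. -/
theorem exists_alive (hI : I.Good) {u v : ℕ} (hu : u < I.n) (hv : v < I.n) :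
    ∃ i < I.rounds, alive (I.hierarchies.getD i []) u = true ∧
      alive (I.hierarchies.getD i []) v = true := by
  have h1 := lost_lt hI hu
  have h2 := lost_lt hI hv
  have h3 := length_hierarchies hI
  by_contra! hne
  -- If no round kept both vertices, each of the 6·ell rounds would be lost for one of them,
  -- although each loses fewer than 3·ell.
  have key : ∀ Hs : List (List (List (List ℕ))),
      (∀ H ∈ Hs, alive H u = true → ¬ alive H v = true) → Hs.length ≤ lost Hs u + lost Hs v := by
    intro Hs h
    induction Hs with
    | nil => simp
    | cons H Hs ih =>
      have h4 := ih fun H' hH' => h H' (by simp [hH'])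
      have h5 := h H (by simp)
      simp only [lost, List.filter_cons, List.length_cons] at h4 ⊢
      cases hu : alive H u <;> cases hv : alive H v <;> simp_all <;> omega
  have h4 := key I.hierarchies fun H hH hHu => by
    obtain ⟨i, hi, rfl⟩ := List.getElem_of_mem hH
    have := hne i (by omega)
    rw [List.getD_eq_getElem _ _ hi] at this
    simpa using this hHu
  rw [h3, rounds] at h4
  omega

end Inst

end HopRepTree

namespace HopRepTree

/-! ### Trees given by a parent function -/

/-- A parent function along which a rank increases. -/
structure RankedTree (m : ℕ) where
  root : Fin m
  parent : Fin m → Fin m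
  lev : Fin m → ℕ
  lt : ∀ x, x ≠ root → lev x < lev (parent x)

namespace RankedTree

variable {m : ℕ} (R : RankedTree m) {x y z : Fin m}

def graph : SimpleGraph (Fin m) where
  Adj x y := (x ≠ R.root ∧ R.parent x = y) ∨ (y ≠ R.root ∧ R.parent y = x)
  symm := ⟨fun _ _ h => h.symm⟩
  loopless := ⟨fun x h => by
    have h' : x ≠ R.root ∧ R.parent x = x := h.elim id id
    have := R.lt x h'.1
    rw [h'.2] at this
    exact lt_irrefl _ this⟩

theorem adj_iff : R.graph.Adj x y ↔
    (x ≠ R.root ∧ R.parent x = y) ∨ (y ≠ R.root ∧ R.parent y = x) := Iff.rfl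

theorem adj_parent (hx : x ≠ R.root) : R.graph.Adj x (R.parent x) := .inl ⟨hx, rfl⟩

theorem exists_iterate (x : Fin m) : ∃ k, R.parent^[k] x = R.root := by
  have hfin : ∃ B, ∀ x, R.lev x ≤ B :=
    ⟨Finset.univ.sup R.lev, fun x => Finset.le_sup (Finset.mem_univ x)⟩
  obtain ⟨B, hB⟩ := hfin
  induction hk : B - R.lev x using Nat.strong_induction_on generalizing x with
  | _ k ih =>
    by_cases hx : x = R.root
    · exact ⟨0, hx⟩
    · have h1 := R.lt x hx
      have h2 := hB (R.parent x)
      obtain ⟨l, hl⟩ := ih (B - R.lev (R.parent x)) (by omega) (R.parent x) rfl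
      exact ⟨l + 1, hl⟩

/-- The distance of a node from the root. -/
def depth (x : Fin m) : ℕ := Nat.find (R.exists_iterate x)

theorem depth_root : R.depth R.root = 0 := (Nat.find_eq_zero _).2 rfl

theorem depth_eq (hx : x ≠ R.root) : R.depth x = R.depth (R.parent x) + 1 :=
  Nat.find_comp_succ (R.exists_iterate x) (R.exists_iterate (R.parent x)) hx

/-- Induction along the parent function. -/
theorem induction {p : Fin m → Prop} (root : p R.root)
    (step : ∀ x, x ≠ R.root → p (R.parent x) → p x) (x : Fin m) : p x := by
  induction hk : R.depth x generalizing x with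
  | zero =>
    by_cases hx : x = R.root
    · rwa [hx]
    · have := R.depth_eq hx; omega
  | succ k ih =>
    by_cases hx : x = R.root
    · rwa [hx]
    · exact step x hx (ih _ (by have := R.depth_eq hx; omega))

theorem depth_add_lev_le (x : Fin m) : R.depth x + R.lev x ≤ R.lev R.root := by
  induction x using R.induction with
  | root => rw [depth_root, zero_add]
  | step x hx ih => have := R.lt x hx; have := R.depth_eq hx; omega

theorem exists_walk (x : Fin m) : ∃ p : R.graph.Walk x R.root, p.length = R.depth x := by
  induction x using R.induction with
  | root => exact ⟨.nil, R.depth_root.symm⟩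
  | step x hx ih =>
    obtain ⟨p, hp⟩ := ih
    exact ⟨.cons (R.adj_parent hx) p, by rw [R.depth_eq hx, ← hp]; rfl⟩

theorem depth_le_length (p : R.graph.Walk x y) : R.depth x ≤ R.depth y + p.length := by
  induction p with
  | nil => simp
  | cons h p ih =>
    rw [SimpleGraph.Walk.length_cons]
    rcases h with ⟨h1, h2⟩ | ⟨h1, h2⟩
    · have := R.depth_eq h1; rw [h2] at this; omega
    · have := R.depth_eq h1; rw [h2] at this; omega

theorem connected : R.graph.Connected := by
  have : Nonempty (Fin m) := ⟨R.root⟩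
  refine ⟨fun x y => ?_⟩
  obtain ⟨p, -⟩ := R.exists_walk x
  obtain ⟨q, -⟩ := R.exists_walk y
  exact ⟨p.append q.reverse⟩

theorem dist_root (x : Fin m) : R.graph.dist R.root x = R.depth x := by
  apply le_antisymm
  · obtain ⟨p, hp⟩ := R.exists_walk x
    rw [← hp, SimpleGraph.dist_comm]
    exact SimpleGraph.dist_le p
  · obtain ⟨p, hp⟩ := R.connected.exists_walk_length_eq_dist x R.root
    have := R.depth_le_length p
    rw [R.depth_root, hp, SimpleGraph.dist_comm] at this
    omega

theorem edge_injective {x y : Fin m} (hx : x ≠ R.root) (hy : y ≠ R.root)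
    (h : s(x, R.parent x) = s(y, R.parent y)) : x = y := by
  rcases Sym2.eq_iff.1 h with h | h
  · exact h.1
  · have h1 := R.depth_eq hx
    have h2 := R.depth_eq hy
    rw [h.2] at h1
    rw [← h.1] at h2
    omega

theorem mem_edgeSet {e : Sym2 (Fin m)} :
    e ∈ R.graph.edgeSet ↔ ∃ x, x ≠ R.root ∧ e = s(x, R.parent x) := by
  induction e with
  | _ x y =>
    rw [SimpleGraph.mem_edgeSet]
    constructor
    · rintro (⟨h, rfl⟩ | ⟨h, rfl⟩)
      · exact ⟨x, h, rfl⟩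
      · exact ⟨y, h, Sym2.eq_swap⟩
    · rintro ⟨z, h, hz⟩
      rcases Sym2.eq_iff.1 hz with ⟨rfl, rfl⟩ | ⟨rfl, rfl⟩
      · exact R.adj_parent h
      · exact (R.adj_parent h).symm

/-- The graph is connected through the root, and sending each other node to the edge above it shows
that there are m - 1 edges. -/
theorem isTree : R.graph.IsTree := by
  rw [SimpleGraph.isTree_iff_connected_and_card]
  refine ⟨R.connected, ?_⟩
  let f : {x // x ≠ R.root} → R.graph.edgeSet := fun x =>
    ⟨s(x.1, R.parent x.1), R.mem_edgeSet.2 ⟨x.1, x.2, rfl⟩⟩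
  have hf : Function.Bijective f := by
    refine ⟨fun x y h => Subtype.ext (R.edge_injective x.2 y.2 (congrArg Subtype.val h)), ?_⟩
    rintro ⟨e, he⟩
    obtain ⟨x, hx, rfl⟩ := R.mem_edgeSet.1 he
    exact ⟨⟨x, hx⟩, rfl⟩
  rw [← Nat.card_congr (Equiv.ofBijective f hf), Nat.card_eq_fintype_card,
    Fintype.card_subtype_compl, Fintype.card_subtype_eq, Nat.card_eq_fintype_card]
  have : 0 < Fintype.card (Fin m) := Fintype.card_pos_iff.2 ⟨R.root⟩
  omega

/-- The tree with weight `2 ^ lev x` on the edge between `x` and its parent. -/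
def toWTree : WTree m where
  graph := R.graph
  isTree := R.isTree
  root := R.root
  weight := Sym2.lift ⟨fun x y => 2 ^ min (R.lev x) (R.lev y), fun x y => by
    simp only [min_comm]⟩
  weight_pos e _ := by
    induction e with
    | _ x y => exact Nat.one_le_two_pow

theorem weight_parent (hx : x ≠ R.root) : R.toWTree.weight s(x, R.parent x) = 2 ^ R.lev x := by
  simp [toWTree, (R.lt x hx).le]

theorem mem_edges {e : Sym2 (Fin m)} :
    e ∈ R.toWTree.edges ↔ ∃ x, x ≠ R.root ∧ e = s(x, R.parent x) := by
  simp only [WTree.edges, Finset.mem_filter, Finset.mem_univ, true_and]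
  exact R.mem_edgeSet

theorem parent_of_isParent (h : R.toWTree.IsParent x y) : y ≠ R.root ∧ R.parent y = x := by
  obtain ⟨h1 | h1, h2⟩ := h
  · exfalso
    change R.graph.dist R.root y = R.graph.dist R.root x + 1 at h2
    rw [dist_root, dist_root] at h2
    have := R.depth_eq h1.1
    rw [h1.2] at this
    omega
  · exact h1

theorem wellSeparated : R.toWTree.WellSeparated := by
  refine ⟨fun e he => ?_, fun x y z hxy hyz => ?_⟩
  · obtain ⟨x, hx, rfl⟩ := R.mem_edges.1 he
    exact ⟨_, R.weight_parent hx⟩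
  · obtain ⟨hy, rfl⟩ := R.parent_of_isParent hxy
    obtain ⟨hz, rfl⟩ := R.parent_of_isParent hyz
    rw [Sym2.eq_swap, R.weight_parent hz, Sym2.eq_swap, R.weight_parent hy]
    exact Nat.pow_lt_pow_right (by norm_num) (R.lt z hz)

/-- Paths in the tree are short. -/
theorem length_le {F : Finset (Sym2 (Fin m))} (hF : F ⊆ R.toWTree.edges) {B : ℕ}
    (hB : ∀ x, R.depth x ≤ B)
    {p : (SimpleGraph.fromEdgeSet (F : Set (Sym2 (Fin m)))).Walk x y} (hp : p.IsPath) :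
    p.length ≤ 2 * B := by
  have hle : SimpleGraph.fromEdgeSet (F : Set (Sym2 (Fin m))) ≤ R.graph := fun a b hab => by
    have := R.mem_edges.1 (hF (SimpleGraph.fromEdgeSet_adj _ |>.1 hab).1)
    rwa [← R.mem_edgeSet] at this
  obtain ⟨q, hq⟩ := R.exists_walk x
  obtain ⟨q', hq'⟩ := R.exists_walk y
  have h1 := (q.append q'.reverse).length_bypass_le_length
  -- Paths in a tree are unique, so this one is a shortcut of the detour through the root.
  have h2 : p.mapLe hle = (q.append q'.reverse).bypass :=
    congrArg Subtype.val ((R.isTree.isAcyclic.subsingleton_path x y).elim ⟨p.mapLe hle, hp.mapLe hle⟩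
      ⟨_, (q.append q'.reverse).bypass_isPath⟩)
  have h3 : (p.mapLe hle).length = p.length := by simp
  rw [h2] at h3
  rw [SimpleGraph.Walk.length_append, SimpleGraph.Walk.length_reverse] at h1
  have := hB x
  have := hB y
  omega

end RankedTree

end HopRepTree

/-! ### Representatives, parents and nodes -/

namespace HopRepTree

theorem beq_iff {a b : ℕ} : Nat.beq a b = true ↔ a = b := by rw [Nat.beq_eq]

theorem same_comm {H : List (List (List ℕ))} {j u v : ℕ} :
    same H j u v = true ↔ same H j v u = true := by
  simp only [same_iff, and_comm]

/-- The first member of a set stays first in every subset that contains it. For nested clusters this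
makes representatives consistent across levels. -/
theorem find?_eq_of_imp {α : Type} {p q : α → Bool} {l : List α} {a : α}
    (h : ∀ x ∈ l, q x = true → p x = true) (ha : l.find? p = some a) (hq : q a = true) :
    l.find? q = some a := by
  induction l with
  | nil => simp at ha
  | cons b l ih =>
    rw [List.find?_cons] at ha ⊢
    cases hb : p b with
    | true =>
      simp only [hb, Option.some.injEq] at ha
      rw [ha, hq]
    | false =>
      simp only [hb] at ha
      have : q b = false := by
        by_contra hqb
        simp [h b (by simp) (by simpa using hqb)] at hb
      rw [this]
      exact ih (fun x hx => h x (by simp [hx])) ha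

namespace Inst

namespace IsHierarchy

variable {I : Inst} {H : List (List (List ℕ))} {j u v x : ℕ}

theorem same_refl (hH : I.IsHierarchy H) (hj : j ≤ I.levels) (hv : alive H v = true) :
    same H j v v = true := hH.mono_le (Nat.zero_le j) hj hv

theorem find?_rep (hI : I.Good) (hH : I.IsHierarchy H) (hj : j ≤ I.levels)
    (hv : alive H v = true) :
    (I.verts.find? fun u => alive H u && same H j v u) = some (I.rep H j v) := by
  unfold rep
  cases h : I.verts.find? fun u => alive H u && same H j v u with
  | none =>
    rw [List.find?_eq_none] at h
    exact absurd (by simp [hv, hH.same_refl hj hv]) (h v ((mem_verts hI).2 (hH.lt hv)))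
  | some a => rfl

theorem rep_spec (hI : I.Good) (hH : I.IsHierarchy H) (hj : j ≤ I.levels)
    (hv : alive H v = true) :
    alive H (I.rep H j v) = true ∧ same H j v (I.rep H j v) = true := by
  simpa using List.find?_some (hH.find?_rep hI hj hv)

theorem rep_congr (hH : I.IsHierarchy H) (hj : j ≤ I.levels)
    (huv : same H j u v = true) : I.rep H j u = I.rep H j v := by
  unfold rep
  congr 2
  funext x
  congr 1
  rw [Bool.eq_iff_iff]
  exact ⟨hH.trans hj (same_comm.1 huv), hH.trans hj huv⟩

theorem rep_levels (hI : I.Good) (hH : I.IsHierarchy H) (hv : v < I.n) :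
    I.rep H I.levels v = I.root := by
  simp [rep, verts, hH.root_alive, hH.top hv hI.root_lt]

theorem rep_zero (hI : I.Good) (hH : I.IsHierarchy H) (hv : alive H v = true) :
    I.rep H 0 v = v :=
  (hH.zero (hH.rep_spec hI (Nat.zero_le _) hv).2).symm

/-- A representative also represents its clusters of lower levels. -/
theorem rep_rep (hI : I.Good) (hH : I.IsHierarchy H) {i : ℕ} (hij : i ≤ j) (hj : j ≤ I.levels)
    (hv : alive H v = true) : I.rep H i (I.rep H j v) = I.rep H j v := by
  have h1 := hH.rep_spec hI hj hv
  have h2 := hH.find?_rep hI (hij.trans hj) h1.1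
  have h3 := find?_eq_of_imp (q := fun u => alive H u && same H i (I.rep H j v) u) (fun x _ hx => by
    simp only [Bool.and_eq_true] at hx ⊢
    exact ⟨hx.1, hH.trans hj h1.2 (hH.mono_le hij hj hx.2)⟩) (hH.find?_rep hI hj hv) (by
    simp [h1.1, hH.same_refl (hij.trans hj) h1.1])
  rw [h2] at h3
  exact Option.some.inj h3

theorem lev_spec (hI : I.Good) (hH : I.IsHierarchy H) (hv : alive H v = true) (hr : v ≠ I.root) :
    1 ≤ I.lev H v ∧ I.lev H v ≤ I.levels ∧ I.rep H (I.lev H v) v ≠ v ∧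
      ∀ i < I.lev H v, I.rep H i v = v := by
  unfold lev
  rw [hv, cond_true]
  cases h : (List.range (I.levels + 1)).find? fun j => !Nat.beq (I.rep H j v) v with
  | none =>
    rw [List.find?_eq_none] at h
    have h1 := h I.levels (by simp)
    rw [hH.rep_levels hI (hH.lt hv)] at h1
    simp only [Bool.not_eq_true', Bool.not_eq_false, Nat.beq_eq] at h1
    exact absurd h1.symm hr
  | some j =>
    rw [List.find?_range_eq_some] at h
    obtain ⟨h1, h2, h3⟩ := h
    have h1' : I.rep H j v ≠ v := fun h => by simp [beq_iff.2 h] at h1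
    have h3' : ∀ i < j, I.rep H i v = v := fun i hi => by simpa using h3 i hi
    refine ⟨?_, by simpa using Nat.le_of_lt_succ (List.mem_range.1 h2), h1', h3'⟩
    rcases Nat.eq_zero_or_pos j with rfl | h
    · exact absurd (hH.rep_zero hI hv) h1'
    · exact h

theorem lev_le (hI : I.Good) (hH : I.IsHierarchy H) (hr : v ≠ I.root) :
    1 ≤ I.lev H v ∧ I.lev H v ≤ I.levels := by
  by_cases hv : alive H v = true
  · exact ⟨(hH.lev_spec hI hv hr).1, (hH.lev_spec hI hv hr).2.1⟩
  · have : I.lev H v = I.levels := by simp [lev, hv]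
    rw [this]
    exact ⟨hI.levels_pos, le_rfl⟩

theorem par_eq (hv : alive H v = true) : I.par H v = I.rep H (I.lev H v) v := by
  simp [par, hv]

theorem par_lt (hI : I.Good) (hH : I.IsHierarchy H) (v : ℕ) (hr : v ≠ I.root) :
    I.par H v < I.n := by
  by_cases hv : alive H v = true
  · rw [par_eq hv]
    exact hH.lt (hH.rep_spec hI (hH.lev_le hI hr).2 hv).1
  · simpa [par, hv] using hI.root_lt

/-- The parent represents its cluster at level `lev v`, hence by `rep_rep` also at all lower levels,
so it cannot stop representing itself there. -/
theorem lev_lt_lev_par (hI : I.Good) (hH : I.IsHierarchy H) (hr : v ≠ I.root)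
    (hp : I.par H v ≠ I.root) : I.lev H v < I.lev H (I.par H v) := by
  by_cases hv : alive H v = true
  · have h1 := hH.lev_spec hI hv hr
    rw [par_eq hv] at hp ⊢
    have h2 := hH.lev_spec hI (hH.rep_spec hI h1.2.1 hv).1 hp
    by_contra! hle
    exact h2.2.2.1 (hH.rep_rep hI hle h1.2.1 hv)
  · simp [par, hv] at hp

theorem same_par (hI : I.Good) (hH : I.IsHierarchy H) (hv : v < I.n) (hr : v ≠ I.root) :
    same H (I.lev H v) (I.par H v) v = true := by
  by_cases ha : alive H v = true
  · rw [par_eq ha, same_comm]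
    exact (hH.rep_spec hI (hH.lev_le hI hr).2 ha).2
  · have : I.lev H v = I.levels ∧ I.par H v = I.root := by simp [lev, par, ha]
    rw [this.1, this.2]
    exact hH.top hI.root_lt hv

/-- Moving to the next level either keeps the representative or replaces it by its parent. -/
theorem rep_succ (hI : I.Good) (hH : I.IsHierarchy H) (hj : j < I.levels)
    (hu : alive H u = true) (hne : I.rep H (j + 1) u ≠ I.rep H j u) :
    I.rep H j u ≠ I.root ∧ I.lev H (I.rep H j u) = j + 1 ∧
      I.par H (I.rep H j u) = I.rep H (j + 1) u := by
  have h1 := hH.rep_spec hI hj.le hu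
  have h2 : I.rep H (j + 1) (I.rep H j u) = I.rep H (j + 1) u :=
    hH.rep_congr hj (same_comm.1 (hH.mono hj h1.2))
  have h3 : I.rep H j u ≠ I.root := by
    intro h
    apply hne
    rw [← h2, h]
    have : I.rep H I.levels I.root = I.root := hH.rep_levels hI hI.root_lt
    have h4 := hH.rep_rep hI (i := j + 1) (j := I.levels) hj le_rfl hH.root_alive
    rwa [this] at h4
  have h4 := hH.lev_spec hI h1.1 h3
  have h5 : I.lev H (I.rep H j u) = j + 1 := by
    refine le_antisymm ?_ ?_
    · by_contra! hlt
      exact hne (h2.symm.trans (h4.2.2.2 _ hlt))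
    · by_contra! hlt
      exact h4.2.2.1 (hH.rep_rep hI (by omega) hj.le hu)
  exact ⟨h3, h5, by rw [par_eq h1.1, h5, h2]⟩

end IsHierarchy

/-! ### The nodes of the tree -/

variable {I : Inst}

theorem mem_nodes {x : ℕ × ℕ} : x ∈ I.nodes ↔
    x = (0, I.root) ∨ (x.1 < I.rounds ∧ x.2 < I.n ∧ x.2 ≠ I.root) := by
  obtain ⟨i, v⟩ := x
  simp [nodes, mem_others]

theorem nodup_nodes : I.nodes.Nodup := by
  have h : I.others.Nodup := List.nodup_range.filter _
  rw [nodes, List.nodup_cons]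
  refine ⟨by simp [mem_others], ?_⟩
  exact List.nodup_range.product h

theorem snd_lt_of_mem_nodes (hI : I.Good) {x : ℕ × ℕ} (hx : x ∈ I.nodes) : x.2 < I.n := by
  rcases mem_nodes.1 hx with rfl | h
  · exact hI.root_lt
  · exact h.2.1

theorem eq_root_iff {x : ℕ × ℕ} (hx : x ∈ I.nodes) : x.2 = I.root ↔ x = (0, I.root) := by
  rcases mem_nodes.1 hx with rfl | h
  · simp
  · exact ⟨fun h' => absurd h' h.2.2, fun h' => by rw [h']⟩

theorem isHierarchy_getD (hI : I.Good) {i : ℕ} (hi : i < I.rounds) :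
    I.IsHierarchy (I.hierarchies.getD i []) := by
  rw [List.getD_eq_getElem _ _ (by rwa [length_hierarchies hI])]
  exact isHierarchy_of_mem hI (List.getElem_mem _)

theorem nPar_eq (Hs : List (List (List (List ℕ)))) (x : ℕ × ℕ) : I.nPar Hs x =
    if I.par (Hs.getD x.1 []) x.2 = I.root then (0, I.root)
    else (x.1, I.par (Hs.getD x.1 []) x.2) := by
  unfold nPar
  split_ifs with h
  · rw [beq_iff.2 h, cond_true]
  · rw [show Nat.beq (I.par (Hs.getD x.1 []) x.2) I.root = false by
      rw [← Bool.not_eq_true, Nat.beq_eq]; exact h, cond_false]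

theorem nPar_snd (Hs : List (List (List (List ℕ)))) (x : ℕ × ℕ) :
    (I.nPar Hs x).2 = I.par (Hs.getD x.1 []) x.2 := by
  rw [nPar_eq]; split_ifs with h
  · exact h.symm
  · rfl

theorem nLev_eq (Hs : List (List (List (List ℕ)))) (x : ℕ × ℕ) : I.nLev Hs x =
    if x.2 = I.root then I.levels + 1 else I.lev (Hs.getD x.1 []) x.2 := by
  unfold nLev
  split_ifs with h
  · rw [beq_iff.2 h, cond_true]
  · rw [show Nat.beq x.2 I.root = false by
      rw [← Bool.not_eq_true, Nat.beq_eq]; exact h, cond_false]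

theorem isChild_iff (Hs : List (List (List (List ℕ)))) (x y : ℕ × ℕ) :
    I.isChild Hs x y = true ↔ x.2 ≠ I.root ∧ I.nPar Hs x = y := by
  simp only [isChild, Bool.and_eq_true, Bool.not_eq_true', ← Bool.not_eq_true, Nat.beq_eq,
    Prod.ext_iff, ne_eq]

theorem nPar_mem (hI : I.Good) {x : ℕ × ℕ} (hx : x ∈ I.nodes) (hr : x.2 ≠ I.root) :
    I.nPar I.hierarchies x ∈ I.nodes := by
  rcases mem_nodes.1 hx with rfl | h
  · exact absurd rfl hr
  · rw [nPar_eq]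
    split_ifs with hp
    · simp [nodes]
    · exact mem_nodes.2 (.inr ⟨h.1, (isHierarchy_getD hI h.1).par_lt hI _ hr, hp⟩)

theorem nLev_lt (hI : I.Good) {x : ℕ × ℕ} (hx : x ∈ I.nodes) (hr : x.2 ≠ I.root) :
    I.nLev I.hierarchies x < I.nLev I.hierarchies (I.nPar I.hierarchies x) := by
  rcases mem_nodes.1 hx with rfl | h
  · exact absurd rfl hr
  · have hH := isHierarchy_getD hI h.1
    rw [nLev_eq, if_neg hr, nPar_eq]
    split_ifs with hp
    · rw [nLev_eq, if_pos rfl]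
      have := (hH.lev_le hI hr).2
      omega
    · rw [nLev_eq, if_neg hp]
      exact hH.lev_lt_lev_par hI hr hp

theorem nLev_bounds (hI : I.Good) {x : ℕ × ℕ} (hx : x ∈ I.nodes) (hr : x.2 ≠ I.root) :
    1 ≤ I.nLev I.hierarchies x ∧ I.nLev I.hierarchies x ≤ I.levels := by
  rcases mem_nodes.1 hx with rfl | h
  · exact absurd rfl hr
  · rw [nLev_eq, if_neg hr]
    exact (isHierarchy_getD hI h.1).lev_le hI hr

end Inst

end HopRepTree

namespace HopRepTree

theorem sum_biUnion_le {ι α : Type*} [DecidableEq α] (s : Finset ι) (t : ι → Finset α)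
    (f : α → ℕ) : ∑ a ∈ s.biUnion t, f a ≤ ∑ i ∈ s, ∑ a ∈ t i, f a := by
  classical
  induction s using Finset.induction_on with
  | empty => simp
  | insert i s hi ih =>
    rw [Finset.biUnion_insert, Finset.sum_insert hi]
    have := Finset.sum_union_inter (s₁ := t i) (s₂ := s.biUnion t) (f := f)
    omega

/-! ### Walks with a bounded number of edges -/

namespace HopLE

variable {n : ℕ} {F F' : Finset (Sym2 (Fin n))} {u v x : Fin n} {a b : ℝ}

theorem mono (h : HopLE F u v a) (hab : a ≤ b) : HopLE F u v b :=
  let ⟨p, hp⟩ := h; ⟨p, hp.trans hab⟩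

theorem refl (u : Fin n) : HopLE F u u 0 := ⟨.nil, by simp⟩

theorem symm (h : HopLE F u v a) : HopLE F v u a :=
  let ⟨p, hp⟩ := h; ⟨p.reverse, by simpa using hp⟩

theorem trans (h : HopLE F u v a) (h' : HopLE F v x b) : HopLE F u x (a + b) := by
  obtain ⟨p, hp⟩ := h
  obtain ⟨q, hq⟩ := h'
  exact ⟨p.append q, by rw [SimpleGraph.Walk.length_append]; push_cast; linarith⟩

theorem of_mem (h : s(u, v) ∈ F) (hne : u ≠ v) : HopLE F u v 1 :=
  ⟨.cons ((SimpleGraph.fromEdgeSet_adj _).2 ⟨h, hne⟩) .nil, by simp⟩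

theorem exists_isPath (h : HopLE F u v a) :
    ∃ p : (SimpleGraph.fromEdgeSet (F : Set (Sym2 (Fin n)))).Walk u v, p.IsPath ∧
      (p.length : ℝ) ≤ a := by
  obtain ⟨p, hp⟩ := h
  exact ⟨p.bypass, p.bypass_isPath, le_trans (by exact_mod_cast p.length_bypass_le_length) hp⟩

/-- This justifies cutting the hop bound at n: a walk can be replaced by a path, which has fewer
than n edges. -/
theorem min_card {h : ℕ} (hF : HopLE F u v h) : HopLE F u v (min n h : ℕ) := by
  obtain ⟨p, hp, hl⟩ := hF.exists_isPath
  refine ⟨p, ?_⟩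
  have h1 := hp.length_lt
  rw [Fintype.card_fin] at h1
  have h2 : p.length ≤ h := by exact_mod_cast hl
  exact_mod_cast le_min h1.le h2

/-- A walk that is given as a list of vertices. -/
theorem of_list {l : List ℕ} (hl : ∀ y ∈ (v : ℕ) :: l, y < n)
    (hx : ((v : ℕ) :: l).getLast? = some (x : ℕ))
    (h : ∀ a b : Fin n, ((a : ℕ), (b : ℕ)) ∈ steps (v :: l) → a ≠ b → s(a, b) ∈ F) :
    HopLE F v x l.length := by
  induction l generalizing v with
  | nil =>
    obtain rfl : v = x := Fin.ext (by simpa using hx)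
    simpa using refl v
  | cons y l ih =>
    have hy : y < n := hl y (by simp)
    have h1 := ih (v := ⟨y, hy⟩) (fun z hz => hl z (List.mem_cons_of_mem _ hz)) (by simpa using hx)
      (fun a b hab => h a b (by rw [steps_cons_cons]; exact List.mem_cons_of_mem _ hab))
    by_cases hvy : v = ⟨y, hy⟩
    · rw [hvy]; exact h1.mono (by simp)
    · have h2 := of_mem (h v ⟨y, hy⟩ (by rw [steps_cons_cons]; simp) hvy) hvy
      exact (h2.trans h1).mono (by push_cast [List.length_cons]; linarith)

end HopLE

namespace Inst

/-- The weight matrix of the instance is that of the graph. -/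
def Represents (I : Inst) (G : WGraph I.n) : Prop :=
  ∀ u v : Fin I.n, u ≠ v → entry I.mat u v = G.weight s(u, v)

variable {I : Inst}

def node (I : Inst) (x : Fin I.nodes.length) : ℕ × ℕ := I.nodes.get x

theorem node_mem (x : Fin I.nodes.length) : I.node x ∈ I.nodes := List.get_mem _ _

theorem node_injective : Function.Injective I.node := List.nodup_iff_injective_get.1 nodup_nodes

theorem exists_node {p : ℕ × ℕ} (hp : p ∈ I.nodes) : ∃ x, I.node x = p := List.mem_iff_get.1 hp

theorem length_nodes_pos : 0 < I.nodes.length := by simp [nodes]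

open Classical in
/-- The tree on the positions of the list of nodes. -/
noncomputable def ranked (hI : I.Good) : RankedTree I.nodes.length where
  root := ⟨0, length_nodes_pos⟩
  parent x := if h : ∃ y, I.node y = I.nPar I.hierarchies (I.node x) then h.choose else x
  lev x := I.nLev I.hierarchies (I.node x)
  lt x hx := by
    have hr : (I.node x).2 ≠ I.root := fun h => hx (node_injective ((eq_root_iff (node_mem x)).1 h))
    have h := exists_node (nPar_mem hI (node_mem x) hr)
    rw [dif_pos h, h.choose_spec]
    exact nLev_lt hI (node_mem x) hr

variable (hI : I.Good) {x y : Fin I.nodes.length}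

theorem eq_ranked_root_iff : x = (ranked hI).root ↔ (I.node x).2 = I.root := by
  rw [eq_root_iff (node_mem x)]
  exact ⟨fun h => by rw [h]; rfl, fun h => node_injective h⟩

theorem node_parent (hx : x ≠ (ranked hI).root) :
    I.node ((ranked hI).parent x) = I.nPar I.hierarchies (I.node x) := by
  have h := exists_node (nPar_mem hI (node_mem x) fun h => hx ((eq_ranked_root_iff hI).2 h))
  simp only [ranked]
  rw [dif_pos h, h.choose_spec]

theorem isChild_node_iff : I.isChild I.hierarchies (I.node x) (I.node y) = true ↔
    x ≠ (ranked hI).root ∧ (ranked hI).parent x = y := by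
  rw [isChild_iff, ne_eq, ← eq_ranked_root_iff hI]
  refine and_congr_right fun hx => ?_
  rw [← node_parent hI hx]
  exact node_injective.eq_iff

/-- The rank rises along the parents from at least 1 to `levels + 1` at the root. -/
theorem depth_le : (ranked hI).depth x ≤ I.levels := by
  by_cases hx : x = (ranked hI).root
  · rw [hx, RankedTree.depth_root]; omega
  · have h1 := (ranked hI).depth_add_lev_le x
    have h2 := nLev_bounds hI (node_mem x) fun h => hx ((eq_ranked_root_iff hI).2 h)
    have h3 : (ranked hI).lev (ranked hI).root = I.levels + 1 := by
      have : I.node (ranked hI).root = (0, I.root) := rfl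
      change I.nLev I.hierarchies (I.node (ranked hI).root) = _
      rw [this, nLev_eq, if_pos rfl]
    have h4 : (ranked hI).lev x = I.nLev I.hierarchies (I.node x) := rfl
    omega

theorem node_of_ne_root (hx : x ≠ (ranked hI).root) :
    (I.node x).1 < I.rounds ∧ (I.node x).2 < I.n ∧ (I.node x).2 ≠ I.root := by
  have hr : (I.node x).2 ≠ I.root := fun h => hx ((eq_ranked_root_iff hI).2 h)
  rcases mem_nodes.1 (node_mem x) with h | h
  · rw [h] at hr; exact absurd rfl hr
  · exact h

/-- The vertex of which `x` is a copy. -/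
def vert (x : Fin I.nodes.length) : Fin I.n := ⟨(I.node x).2, snd_lt_of_mem_nodes hI (node_mem x)⟩

def copies (v : Fin I.n) : Finset (Fin I.nodes.length) :=
  Finset.univ.filter fun x => vert hI x = v

theorem mem_copies {v : Fin I.n} : x ∈ copies hI v ↔ vert hI x = v := by simp [copies]

/-- The copy of `v` in the `i`-th tree. -/
def nodeOf (I : Inst) (i v : ℕ) : ℕ × ℕ := if v = I.root then (0, I.root) else (i, v)

theorem nodeOf_snd (i v : ℕ) : (I.nodeOf i v).2 = v := by
  unfold nodeOf; split_ifs with h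
  · exact h.symm
  · rfl

theorem nodeOf_mem {i v : ℕ} (hi : i < I.rounds) (hv : v < I.n) : I.nodeOf i v ∈ I.nodes := by
  unfold nodeOf; split_ifs with h
  · simp [nodes]
  · exact mem_nodes.2 (.inr ⟨hi, hv, h⟩)

theorem rounds_pos (hI : I.Good) : 0 < I.rounds := by
  have := hI.ell_pos; unfold rounds; omega

theorem copies_nonempty (v : Fin I.n) : (copies hI v).Nonempty := by
  obtain ⟨x, hx⟩ := exists_node (nodeOf_mem (rounds_pos hI) v.2)
  exact ⟨x, (mem_copies hI).2 (Fin.ext (by simp only [vert]; rw [hx, nodeOf_snd]))⟩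

theorem isVertexMapping : IsVertexMapping (copies hI) where
  injective u v h := by
    obtain ⟨x, hx⟩ := copies_nonempty hI u
    have hx' := h ▸ hx
    exact ((mem_copies hI).1 hx).symm.trans ((mem_copies hI).1 hx')
  nonempty := copies_nonempty hI
  disjoint u v huv := Finset.disjoint_left.2 fun x hu hv =>
    huv (((mem_copies hI).1 hu).symm.trans ((mem_copies hI).1 hv))
  cover x := ⟨_, (mem_copies hI).2 rfl⟩

theorem card_copies_root {r : Fin I.n} (hr : I.root = r) : (copies hI r).card = 1 := by
  rw [Finset.card_eq_one]
  refine ⟨(ranked hI).root, ?_⟩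
  ext x
  rw [mem_copies, Finset.mem_singleton, eq_ranked_root_iff hI, hr, Fin.ext_iff]
  rfl

theorem root_mem_copies {r : Fin I.n} (hr : I.root = r) : (ranked hI).root ∈ copies hI r := by
  rw [mem_copies, Fin.ext_iff, ← hr]
  exact (eq_ranked_root_iff hI).1 rfl

theorem card_copies_le (v : Fin I.n) : (copies hI v).card ≤ I.rounds := by
  rw [← Finset.card_range I.rounds]
  refine Finset.card_le_card_of_injOn (fun x => (I.node x).1) (fun x _ => ?_) fun x hx y hy h => ?_
  · by_cases hx : x = (ranked hI).root
    · exact hx ▸ Finset.mem_coe.2 (Finset.mem_range.2 (rounds_pos hI))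
    · simpa using (node_of_ne_root hI hx).1
  · have h1 := (mem_copies hI).1 hx
    have h2 := (mem_copies hI).1 hy
    exact node_injective (Prod.ext h (congrArg Fin.val (h1.trans h2.symm)))

/-! ### From the tree to the graph -/

open Classical in
/-- The edges of the walk that corresponds to the tree edge above `x`. -/
noncomputable def walkEdges (I : Inst) (x : Fin I.nodes.length) : Finset (Sym2 (Fin I.n)) :=
  Finset.univ.filter fun e => ∃ a b : Fin I.n, e = s(a, b) ∧
    I.onWalk I.hierarchies (I.node x) a b = true

theorem onWalk_iff {Hs : List (List (List (List ℕ)))} {p : ℕ × ℕ} {a b : ℕ} :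
    I.onWalk Hs p a b = true ↔ a ≠ b ∧
      ((a, b) ∈ steps (I.edgeWalk Hs p) ∨ (b, a) ∈ steps (I.edgeWalk Hs p)) := by
  simp only [onWalk, Bool.and_eq_true, Bool.not_eq_true', ← Bool.not_eq_true, beq_iff,
    List.any_eq_true, Bool.or_eq_true, ne_eq]
  refine and_congr_right fun _ => ⟨?_, ?_⟩
  · rintro ⟨⟨q1, q2⟩, hq, ⟨rfl, rfl⟩ | ⟨rfl, rfl⟩⟩
    · exact .inl hq
    · exact .inr hq
  · rintro (h | h)
    · exact ⟨_, h, .inl ⟨rfl, rfl⟩⟩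
    · exact ⟨_, h, .inr ⟨rfl, rfl⟩⟩

theorem hopLE_edgeWalk (hx : x ≠ (ranked hI).root) {A : Finset (Sym2 (Fin I.n))}
    (hA : I.walkEdges x ⊆ A) :
    HopLE A (vert hI x) (vert hI ((ranked hI).parent x)) (I.hopRadius + 1 : ℕ) := by
  have hv := snd_lt_of_mem_nodes hI (node_mem x)
  have hp := snd_lt_of_mem_nodes hI (node_mem ((ranked hI).parent x))
  have hpe := node_parent hI hx
  obtain ⟨l, h1, h2, h3, h4⟩ := lightWalk_eq_cons (M := I.mat) hp I.hopRadius hv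
  have h5 : I.edgeWalk I.hierarchies (I.node x) = (I.node x).2 :: l := by
    rw [edgeWalk, ← hpe]; exact h1
  rw [← h2]
  refine HopLE.of_list (v := vert hI x) (l := l) h4 h3 fun a b hab hne => hA ?_
  refine Finset.mem_filter.2 ⟨Finset.mem_univ _, a, b, rfl, onWalk_iff.2 ⟨?_, .inl ?_⟩⟩
  · exact fun h => hne (Fin.ext h)
  · rw [h5]; exact hab

/-- A walk may repeat edges, which only increases its weight compared with that of its set of edges.
-/
theorem sum_steps_le {n : ℕ} (G : WGraph n) (M : List (List ℕ))
    (hM : ∀ u v : Fin n, u ≠ v → entry M u v = G.weight s(u, v)) (S : List (ℕ × ℕ))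
    (E : Finset (Sym2 (Fin n)))
    (hE : ∀ e ∈ E, ∃ a b : Fin n, e = s(a, b) ∧ a ≠ b ∧ ((a : ℕ), (b : ℕ)) ∈ S) :
    setWeight G.weight E ≤ (S.map fun q => entry M q.1 q.2).sum := by
  classical
  induction S generalizing E with
  | nil =>
    have : E = ∅ := Finset.eq_empty_of_forall_notMem fun e he => by
      obtain ⟨a, b, -, -, h⟩ := hE e he
      simp at h
    simp [this, setWeight]
  | cons q S ih =>
    rw [setWeight, ← Finset.sum_filter_add_sum_filter_not E
      fun e => ∃ a b : Fin n, e = s(a, b) ∧ a ≠ b ∧ ((a : ℕ), (b : ℕ)) = q]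
    rw [List.map_cons, List.sum_cons]
    refine add_le_add ?_ (ih _ fun e he => ?_)
    · by_cases hq : ∃ a b : Fin n, a ≠ b ∧ ((a : ℕ), (b : ℕ)) = q
      · obtain ⟨a, b, hab, rfl⟩ := hq
        rw [hM a b hab, ← Finset.sum_singleton G.weight s(a, b)]
        refine Finset.sum_le_sum_of_subset fun e he => ?_
        obtain ⟨-, a', b', rfl, -, h⟩ := Finset.mem_filter.1 he
        simp only [Prod.mk.injEq, Fin.val_inj] at h
        rw [h.1, h.2]; simp
      · rw [Finset.filter_false_of_mem fun e _ ⟨a, b, _, h⟩ => hq ⟨a, b, h⟩]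
        simp
    · rw [Finset.mem_filter] at he
      obtain ⟨a, b, rfl, hab, h⟩ := hE e he.1
      refine ⟨a, b, rfl, hab, (List.mem_cons.1 h).resolve_left fun h => he.2 ⟨a, b, rfl, hab, h⟩⟩

/-- A vertex and its parent share a cluster at the level of the edge, so some walk of weight at most
2^lev obeys the hop bound, and the stored walk is a lightest one. -/
theorem setWeight_walkEdges_le {G : WGraph I.n} (hG : I.Represents G)
    (hx : x ≠ (ranked hI).root) :
    setWeight G.weight (I.walkEdges x) ≤ 2 ^ (ranked hI).lev x := by
  obtain ⟨hi, hv, hr⟩ := node_of_ne_root hI hx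
  have hH := isHierarchy_getD hI hi
  have h1 : setWeight G.weight (I.walkEdges x) ≤
      walkWt I.mat (I.edgeWalk I.hierarchies (I.node x)) := by
    refine sum_steps_le G I.mat hG _ _ fun e he => ?_
    obtain ⟨a, b, rfl, h⟩ := (Finset.mem_filter.1 he).2
    obtain ⟨hne, h | h⟩ := onWalk_iff.1 h
    · exact ⟨a, b, rfl, fun h => hne (by rw [h]), h⟩
    · exact ⟨b, a, Sym2.eq_swap, fun h => hne (by rw [h]), h⟩
  have hlev : (ranked hI).lev x = I.lev (I.hierarchies.getD (I.node x).1 []) (I.node x).2 := by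
    change I.nLev _ _ = _
    rw [nLev_eq, if_neg hr]
  obtain ⟨W, h2, h3⟩ := hH.conn (hH.lev_le hI hr).2 (hH.same_par hI hv hr)
  rw [hlev]
  refine h1.trans (le_trans ?_ h3)
  rw [edgeWalk, nPar_snd]
  exact hopDist_le hI.isWeightMatrix h2 (Nat.le_succ _)

open Classical in
noncomputable def treeToGraph (F' : Finset (Sym2 (Fin I.nodes.length))) :
    Finset (Sym2 (Fin I.n)) :=
  Finset.univ.filter fun e => ∃ x, x ≠ (ranked hI).root ∧ s(x, (ranked hI).parent x) ∈ F' ∧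
    e ∈ I.walkEdges x

theorem mem_treeToGraph {F' : Finset (Sym2 (Fin I.nodes.length))} {e : Sym2 (Fin I.n)} :
    e ∈ treeToGraph hI F' ↔ ∃ x, x ≠ (ranked hI).root ∧ s(x, (ranked hI).parent x) ∈ F' ∧
      e ∈ I.walkEdges x := by simp [treeToGraph]

theorem isMonotone_treeToGraph : IsMonotoneEdgeMapping (ranked hI).toWTree.edges
    (completeEdges I.n) (treeToGraph hI) where
  maps F' _ e he := by
    obtain ⟨x, -, -, he⟩ := (mem_treeToGraph hI).1 he
    obtain ⟨a, b, rfl, h⟩ := (Finset.mem_filter.1 he).2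
    refine Finset.mem_filter.2 ⟨Finset.mem_univ _, ?_⟩
    rw [Sym2.mk_isDiag_iff]
    exact fun h' => (onWalk_iff.1 h).1 (by rw [h'])
  mono A B hAB _ e he := by
    obtain ⟨x, h1, h2, h3⟩ := (mem_treeToGraph hI).1 he
    exact (mem_treeToGraph hI).2 ⟨x, h1, hAB h2, h3⟩

theorem cost_treeToGraph {G : WGraph I.n} (hG : I.Represents G)
    (F' : Finset (Sym2 (Fin I.nodes.length))) :
    setWeight G.weight (treeToGraph hI F') ≤ setWeight (ranked hI).toWTree.weight F' := by
  classical
  set X := Finset.univ.filter fun x => x ≠ (ranked hI).root ∧ s(x, (ranked hI).parent x) ∈ F'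
  have hX : ∀ x ∈ X, x ≠ (ranked hI).root ∧ s(x, (ranked hI).parent x) ∈ F' := fun x hx =>
    (Finset.mem_filter.1 hx).2
  calc setWeight G.weight (treeToGraph hI F')
      ≤ ∑ e ∈ X.biUnion I.walkEdges, G.weight e := by
        refine Finset.sum_le_sum_of_subset fun e he => ?_
        obtain ⟨x, h1, h2, h3⟩ := (mem_treeToGraph hI).1 he
        exact Finset.mem_biUnion.2 ⟨x, Finset.mem_filter.2 ⟨Finset.mem_univ _, h1, h2⟩, h3⟩
    _ ≤ ∑ x ∈ X, setWeight G.weight (I.walkEdges x) := sum_biUnion_le _ _ _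
    _ ≤ ∑ x ∈ X, (ranked hI).toWTree.weight s(x, (ranked hI).parent x) :=
        Finset.sum_le_sum fun x hx => by
          rw [RankedTree.weight_parent _ (hX x hx).1]
          exact setWeight_walkEdges_le hI hG (hX x hx).1
    _ = ∑ e ∈ X.image fun x => s(x, (ranked hI).parent x), (ranked hI).toWTree.weight e :=
        (Finset.sum_image fun x hx y hy h =>
          (ranked hI).edge_injective (hX x hx).1 (hX y hy).1 h).symm
    _ ≤ setWeight (ranked hI).toWTree.weight F' :=
        Finset.sum_le_sum_of_subset fun e he => by
          obtain ⟨x, hx, rfl⟩ := Finset.mem_image.1 he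
          exact (hX x hx).2

/-- A tree path has at most 2·levels edges, each replaced by a walk of at most `hopRadius + 1`
steps. -/
theorem hop_treeToGraph {F' : Finset (Sym2 (Fin I.nodes.length))}
    (hF' : F' ⊆ (ranked hI).toWTree.edges) (h : ConnectedBy F' x y) :
    HopLE (treeToGraph hI F') (vert hI x) (vert hI y)
      (2 * I.levels * (I.hopRadius + 1) : ℕ) := by
  have key : ∀ {x y} (p : (SimpleGraph.fromEdgeSet (F' : Set (Sym2 _))).Walk x y),
      HopLE (treeToGraph hI F') (vert hI x) (vert hI y)
        (p.length * (I.hopRadius + 1 : ℕ)) := by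
    intro x y p
    induction p with
    | nil => simpa using HopLE.refl _
    | @cons a b c hab p ih =>
      have hmem : s(a, b) ∈ F' := ((SimpleGraph.fromEdgeSet_adj _).1 hab).1
      have h1 : HopLE (treeToGraph hI F') (vert hI a) (vert hI b) (I.hopRadius + 1 : ℕ) := by
        obtain ⟨z, hz, he⟩ := (ranked hI).mem_edges.1 (hF' hmem)
        have h2 := hopLE_edgeWalk hI hz (A := treeToGraph hI F') fun e h =>
          (mem_treeToGraph hI).2 ⟨z, hz, he ▸ hmem, h⟩
        rcases Sym2.eq_iff.1 he with ⟨rfl, rfl⟩ | ⟨rfl, rfl⟩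
        · exact h2
        · exact h2.symm
      refine (h1.trans ih).mono (le_of_eq ?_)
      rw [SimpleGraph.Walk.length_cons]; push_cast; ring
  obtain ⟨p⟩ := h
  refine (key p.bypass).mono ?_
  have := (ranked hI).length_le hF' (fun x => depth_le hI) p.bypass_isPath
  exact_mod_cast Nat.mul_le_mul_right _ this

end Inst

end HopRepTree

namespace HopRepTree

namespace Inst

variable {I : Inst} (hI : I.Good) {x y : Fin I.nodes.length}

/-! ### From the graph to the tree -/

/-- `F` contains a short path between vertices that are separated by the edge above `x`. -/
def Used (I : Inst) (F : Finset (Sym2 (Fin I.n))) (x : Fin I.nodes.length) : Prop :=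
  ∃ u v : Fin I.n, I.separates I.hierarchies (I.node x) u v = true ∧ HopLE F u v I.hop

open Classical in
noncomputable def graphToTree (F : Finset (Sym2 (Fin I.n))) :
    Finset (Sym2 (Fin I.nodes.length)) :=
  (Finset.univ.filter fun x => x ≠ (ranked hI).root ∧ I.Used F x).image
    fun x => s(x, (ranked hI).parent x)

theorem mem_graphToTree {F : Finset (Sym2 (Fin I.n))} {e : Sym2 (Fin I.nodes.length)} :
    e ∈ graphToTree hI F ↔
      ∃ x, x ≠ (ranked hI).root ∧ I.Used F x ∧ e = s(x, (ranked hI).parent x) := by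
  simp only [graphToTree, Finset.mem_image, Finset.mem_filter, Finset.mem_univ, true_and, and_assoc,
    eq_comm (a := e)]

theorem Used.mono {F F' : Finset (Sym2 (Fin I.n))} (h : I.Used F x) (hF : F ⊆ F') :
    I.Used F' x := by
  obtain ⟨u, v, h, p, hp⟩ := h
  exact ⟨u, v, h, p.mapLe (SimpleGraph.fromEdgeSet_mono (by exact_mod_cast hF)), by simpa using hp⟩

theorem isMonotone_graphToTree : IsMonotoneEdgeMapping (completeEdges I.n)
    (ranked hI).toWTree.edges (graphToTree hI) where
  maps F _ e he := by
    obtain ⟨x, hx, -, rfl⟩ := (mem_graphToTree hI).1 he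
    exact (ranked hI).mem_edges.2 ⟨x, hx, rfl⟩
  mono A B hAB _ e he := by
    obtain ⟨x, hx, hu, rfl⟩ := (mem_graphToTree hI).1 he
    exact (mem_graphToTree hI).2 ⟨x, hx, hu.mono hAB, rfl⟩

theorem separates_iff {Hs : List (List (List (List ℕ)))} {p : ℕ × ℕ} {u v : ℕ} :
    I.separates Hs p u v = true ↔
      (alive (Hs.getD p.1 []) p.2 = true ∧ alive (Hs.getD p.1 []) u = true ∧
        alive (Hs.getD p.1 []) v = true) ∧
      same (Hs.getD p.1 []) (I.nLev Hs p - 1) p.2 u = true ∧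
      ¬ same (Hs.getD p.1 []) (I.nLev Hs p - 1) p.2 v = true := by
  simp only [separates, Bool.and_eq_true, Bool.not_eq_true', Bool.not_eq_true]

/-- Going up level by level, the representative of the cluster of u changes only to its own parent.
As long as v lies outside that cluster, the pair (u, v) itself selects the tree edge. -/
theorem connectedBy_rep {i : ℕ} (hi : i < I.rounds) {F : Finset (Sym2 (Fin I.n))} {u v : Fin I.n}
    (hu : alive (I.hierarchies.getD i []) u = true) (hv : alive (I.hierarchies.getD i []) v = true)
    (huv : HopLE F u v I.hop) {j : ℕ} (hj : j ≤ I.levels)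
    (hsep : ∀ j' < j, ¬ same (I.hierarchies.getD i []) j' u v = true)
    (hx : I.node x = I.nodeOf i u)
    (hy : I.node y = I.nodeOf i (I.rep (I.hierarchies.getD i []) j u)) :
    ConnectedBy (graphToTree hI F) x y := by
  have hH := isHierarchy_getD hI hi
  induction j generalizing y with
  | zero =>
    rw [hH.rep_zero hI hu, ← hx] at hy
    rw [node_injective hy]
    exact SimpleGraph.Reachable.refl _
  | succ j ih =>
    have hr := hH.rep_spec hI (by omega : j ≤ I.levels) hu
    obtain ⟨z, hz⟩ := exists_node (nodeOf_mem (v := I.rep (I.hierarchies.getD i []) j u) hi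
      (hH.lt hr.1))
    have h1 := ih (by omega) (fun j' hj' => hsep j' (by omega)) hz
    by_cases hne : I.rep (I.hierarchies.getD i []) (j + 1) u = I.rep (I.hierarchies.getD i []) j u
    · rw [hne, ← hz] at hy
      rwa [node_injective hy]
    · obtain ⟨h2, h3, h4⟩ := hH.rep_succ hI hj hu hne
      rw [nodeOf, if_neg h2] at hz
      have hzr : z ≠ (ranked hI).root := fun h => h2 (by
        rw [eq_ranked_root_iff hI, hz] at h; exact h)
      have hp : (ranked hI).parent z = y := node_injective (by
        rw [node_parent hI hzr, hz, hy, nPar_eq, h4, nodeOf])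
      refine h1.trans (SimpleGraph.Adj.reachable ?_)
      rw [SimpleGraph.fromEdgeSet_adj]
      refine ⟨Finset.mem_coe.2 ((mem_graphToTree hI).2 ⟨z, hzr, ⟨u, v, ?_, huv⟩, by rw [hp]⟩), ?_⟩
      · rw [separates_iff, hz, nLev_eq, if_neg h2, h3]
        refine ⟨⟨hr.1, hu, hv⟩, same_comm.1 hr.2, fun h => hsep j (by omega) ?_⟩
        exact hH.trans (by omega) hr.2 h
      · rintro rfl
        rw [hz, nodeOf] at hy
        split_ifs at hy with h
        · exact h2 (congrArg Prod.snd hy)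
        · exact hne (congrArg Prod.snd hy).symm

/-- In a round where both survive, both climb to the first level at which they share a cluster, and
there they meet at the common representative. -/
theorem hop_graphToTree {F : Finset (Sym2 (Fin I.n))} {u v : Fin I.n} (huv : HopLE F u v I.hop) :
    ∃ u' ∈ copies hI u, ∃ v' ∈ copies hI v, ConnectedBy (graphToTree hI F) u' v' := by
  classical
  obtain ⟨i, hi, hu, hv⟩ := exists_alive hI u.2 v.2
  have hH := isHierarchy_getD hI hi
  have hex : ∃ j, same (I.hierarchies.getD i []) j u v = true := ⟨_, hH.top u.2 v.2⟩
  have hj : Nat.find hex ≤ I.levels := Nat.find_le (hH.top u.2 v.2)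
  have hmin : ∀ j' < Nat.find hex, ¬ same (I.hierarchies.getD i []) j' u v = true :=
    fun j' => Nat.find_min hex
  have hrep := hH.rep_congr hj (Nat.find_spec hex)
  obtain ⟨x, hx⟩ := exists_node (nodeOf_mem hi u.2)
  obtain ⟨y, hy⟩ := exists_node (nodeOf_mem hi v.2)
  obtain ⟨z, hz⟩ := exists_node (nodeOf_mem (v := I.rep (I.hierarchies.getD i []) (Nat.find hex) u)
    hi (hH.lt (hH.rep_spec hI hj hu).1))
  refine ⟨x, (mem_copies hI).2 (Fin.ext (by simp only [vert]; rw [hx, nodeOf_snd])), y,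
    (mem_copies hI).2 (Fin.ext (by simp only [vert]; rw [hy, nodeOf_snd])), ?_⟩
  have h1 := connectedBy_rep hI hi hu hv huv hj hmin hx hz
  have h2 := connectedBy_rep hI hi hv hu huv.symm hj
    (fun j' hj' h => hmin j' hj' (same_comm.1 h)) hy (by rw [hz, hrep])
  exact h1.trans h2.symm

/-- `z` is close to the cluster of `v` at level `j`. -/
def Near (I : Inst) (H : List (List (List ℕ))) (j v z : ℕ) : Prop :=
  ∃ y, alive H y = true ∧ same H j v y = true ∧
    ∃ k W, Conn I.mat I.n y z k W ∧ k ≤ I.hop ∧ 8 * I.rings * W ≤ 2 ^ j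

/-- Two approaches to z of at most hop steps concatenate to a walk of at most 2·hop steps, and two
weights with factor 8 add up to one with factor 4. This is why balls are padded by 2·hop steps. -/
theorem IsHierarchy.same_of_near {H : List (List (List ℕ))} {j v v' z : ℕ} (hI : I.Good)
    (hH : I.IsHierarchy H) (hj : j ≤ I.levels) (h : I.Near H j v z) (h' : I.Near H j v' z) :
    same H j v v' = true := by
  obtain ⟨y, h1, h2, k, W, h3, h4, h5⟩ := h
  obtain ⟨y', h1', h2', k', W', h3', h4', h5'⟩ := h'
  have h6 := hH.sep hj h1 h1' (h3.trans (h3'.symm hI.isWeightMatrix)) (by omega) (by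
    rw [mul_add]
    rw [mul_assoc] at h5 h5' ⊢
    rw [mul_assoc]
    omega)
  exact hH.trans hj (hH.trans hj h2 h6) (same_comm.1 h2')

open Classical in
/-- A short walk that leaves a cluster has a heavy part near this cluster. -/
theorem lt_sum_edges {H : List (List (List ℕ))} {j v : ℕ} {G : WGraph I.n} (hG : I.Represents G)
    (hH : I.IsHierarchy H) (hj : j ≤ I.levels) {F : Finset (Sym2 (Fin I.n))} {u a b : Fin I.n}
    (hu : alive H u = true) (hb : alive H b = true) (hvu : same H j v u = true)
    (hvb : ¬ same H j v b = true)
    (p : (SimpleGraph.fromEdgeSet (F : Set (Sym2 (Fin I.n)))).Walk a b) {k W : ℕ}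
    (h : Conn I.mat I.n u a k W) (hk : k + p.length ≤ I.hop) :
    2 ^ j < 8 * I.rings *
      (W + ((p.edges.filter fun e => ∃ z : Fin I.n, z ∈ e ∧ I.Near H j v z).map G.weight).sum) := by
  induction p generalizing k W with
  | nil =>
    rw [SimpleGraph.Walk.length_nil] at hk
    -- A walk that stays light up to its end at b would force b into the cluster.
    by_contra! hlt
    refine hvb (hH.trans hj hvu (hH.sep hj hu hb h (by omega) (le_trans ?_ hlt)))
    simp only [SimpleGraph.Walk.edges_nil, List.filter_nil, List.map_nil, List.sum_nil, add_zero]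
    gcongr
    norm_num
  | @cons a c b hac p ih =>
    rw [SimpleGraph.Walk.length_cons] at hk
    by_cases hW : 8 * I.rings * W ≤ 2 ^ j
    · have hne : a ≠ c := hac.ne
      have h1 := ih hb hvb (h.step c.2) (by omega)
      rw [hG a c hne] at h1
      have ha : ∃ z : Fin I.n, z ∈ s(a, c) ∧ I.Near H j v z :=
        -- While the prefix is light its end a is near the cluster, so the next edge is counted;
        -- once the prefix is heavy nothing more is needed.
        ⟨a, by simp, u, hu, hvu, k, W, h, by omega, hW⟩
      rw [SimpleGraph.Walk.edges_cons, List.filter_cons_of_pos (by simpa using ha), List.map_cons,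
        List.sum_cons, ← add_assoc]
      exact h1
    · exact lt_of_lt_of_le (not_le.1 hW) (by gcongr; omega)

open Classical in
theorem lt_setWeight {H : List (List (List ℕ))} {j v : ℕ} {G : WGraph I.n} (hG : I.Represents G)
    (hH : I.IsHierarchy H) (hj : j ≤ I.levels) {F : Finset (Sym2 (Fin I.n))} {a b : Fin I.n}
    (ha : alive H a = true) (hb : alive H b = true) (hva : same H j v a = true)
    (hvb : ¬ same H j v b = true) (h : HopLE F a b I.hop) :
    2 ^ j < 8 * I.rings * setWeight G.weight (F.filter fun e => ∃ z ∈ e, I.Near H j v z) := by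
  obtain ⟨p, hp, hl⟩ := h.exists_isPath
  have h1 := lt_sum_edges hG hH hj ha hb hva hvb p (.refl a.2)
    (by rw [zero_add]; exact_mod_cast hl)
  refine lt_of_lt_of_le h1 (Nat.mul_le_mul_left _ ?_)
  rw [zero_add, ← List.sum_toFinset _ (hp.edges_nodup.filter _)]
  refine Finset.sum_le_sum_of_subset fun e he => ?_
  simp only [List.mem_toFinset, List.mem_filter, decide_eq_true_eq] at he
  refine Finset.mem_filter.2 ⟨?_, he.2⟩
  have := p.edges_subset_edgeSet he.1
  rw [SimpleGraph.edgeSet_fromEdgeSet] at this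
  exact_mod_cast this.1

open Classical in
/-- Every edge touches at most two of a family of disjoint sets. -/
theorem sum_touching_le {ι α : Type*} [Fintype α] (X : Finset ι) (Z : ι → α → Prop)
    (hZ : ∀ i ∈ X, ∀ i' ∈ X, ∀ z, Z i z → Z i' z → i = i') (w : Sym2 α → ℕ) (F : Finset (Sym2 α)) :
    ∑ i ∈ X, ∑ e ∈ F.filter (fun e => ∃ z ∈ e, Z i z), w e ≤ 2 * ∑ e ∈ F, w e := by
  simp_rw [Finset.sum_filter]
  rw [Finset.sum_comm, Finset.mul_sum]
  refine Finset.sum_le_sum fun e _ => ?_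
  rw [← Finset.sum_filter, Finset.sum_const, smul_eq_mul]
  refine Nat.mul_le_mul_right _ ?_
  induction e with
  | _ a b =>
    have hone : ∀ z, (X.filter fun i => Z i z).card ≤ 1 := fun z =>
      Finset.card_le_one.2 fun i hi i' hi' => by
        rw [Finset.mem_filter] at hi hi'
        exact hZ i hi.1 i' hi'.1 z hi.2 hi'.2
    have hsub : (X.filter fun i => ∃ z ∈ s(a, b), Z i z) ⊆
        (X.filter fun i => Z i a) ∪ X.filter fun i => Z i b := fun i hi => by
      simpa [Finset.mem_filter, and_or_left] using hi
    have := (Finset.card_le_card hsub).trans (Finset.card_union_le _ _)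
    have := hone a
    have := hone b
    omega

-- The weight of the edge above x is 2^(j+1), and x still represents its own cluster at level j;
-- that cluster is the one which the path leaves.
open Classical in
theorem Used.lt_setWeight {G : WGraph I.n} (hG : I.Represents G) {F : Finset (Sym2 (Fin I.n))}
    {j : ℕ} (hx : x ≠ (ranked hI).root) (hF : I.Used F x)
    (hl : I.nLev I.hierarchies (I.node x) = j + 1) :
    I.rep (I.hierarchies.getD (I.node x).1 []) j (I.node x).2 = (I.node x).2 ∧
      2 ^ j < 8 * I.rings * setWeight G.weight (F.filter fun e => ∃ z ∈ e,
        I.Near (I.hierarchies.getD (I.node x).1 []) j (I.node x).2 z) := by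
  obtain ⟨hi, -, hr⟩ := node_of_ne_root hI hx
  have hH := isHierarchy_getD hI hi
  obtain ⟨u, v, hs, huv⟩ := hF
  rw [separates_iff, hl, Nat.add_sub_cancel] at hs
  rw [nLev_eq, if_neg hr] at hl
  have hlev := hH.lev_spec hI hs.1.1 hr
  rw [hl] at hlev
  exact ⟨hlev.2.2.2 j j.lt_succ_self, Inst.lt_setWeight hG hH
    (j.le_succ.trans hlev.2.1) hs.1.2.1 hs.1.2.2 hs.2.1 hs.2.2 huv⟩

-- Within one tree and one level, distinct nodes represent distinct clusters, whose near sets are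
-- disjoint. The constant 32 is 8 from the heavy part, 2 from 2^(j+1) against 2^j, and 2 from the
-- two ends of an edge.
open Classical in
theorem sum_used_le {G : WGraph I.n} (hG : I.Represents G) (F : Finset (Sym2 (Fin I.n))) {i l : ℕ}
    (hi : i < I.rounds) (hl : l ∈ Finset.Icc 1 I.levels) (X : Finset (Fin I.nodes.length))
    (hX : ∀ x ∈ X, (x ≠ (ranked hI).root ∧ I.Used F x) ∧ (I.node x).1 = i ∧
      (ranked hI).lev x = l) :
    ∑ x ∈ X, 2 ^ (ranked hI).lev x ≤ 32 * I.rings * setWeight G.weight F := by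
  rw [Finset.mem_Icc] at hl
  obtain ⟨j, rfl⟩ := Nat.exists_eq_add_of_le' hl.1
  have hH := isHierarchy_getD hI hi
  have hj : j ≤ I.levels := j.le_succ.trans hl.2
  have hX' : ∀ x ∈ X, I.rep (I.hierarchies.getD i []) j (I.node x).2 = (I.node x).2 ∧
      2 ^ j < 8 * I.rings * setWeight G.weight
        (F.filter fun e => ∃ z ∈ e, I.Near (I.hierarchies.getD i []) j (I.node x).2 z) := by
    intro x hx
    obtain ⟨⟨h1, h2⟩, h3, h4⟩ := hX x hx
    have := h2.lt_setWeight hI hG h1 h4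
    rwa [h3] at this
  have h := sum_touching_le X
    (fun x (z : Fin I.n) => I.Near (I.hierarchies.getD i []) j (I.node x).2 z)
    (fun x hx x' hx' z hz hz' => by
      have h3 := hH.rep_congr hj (hH.same_of_near hI hj hz hz')
      rw [(hX' x hx).1, (hX' x' hx').1] at h3
      exact node_injective (Prod.ext ((hX x hx).2.1.trans (hX x' hx').2.1.symm) h3))
    G.weight F
  calc ∑ x ∈ X, 2 ^ (ranked hI).lev x
      ≤ ∑ x ∈ X, 16 * I.rings * setWeight G.weight
        (F.filter fun e => ∃ z ∈ e, I.Near (I.hierarchies.getD i []) j (I.node x).2 z) :=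
        Finset.sum_le_sum fun x hx => by
          have h2 := (hX' x hx).2
          rw [(hX x hx).2.2, pow_succ]
          calc 2 ^ j * 2 ≤ _ := Nat.mul_le_mul_right 2 h2.le
            _ = _ := by ring
    _ = 16 * I.rings * ∑ x ∈ X, setWeight G.weight
        (F.filter fun e => ∃ z ∈ e, I.Near (I.hierarchies.getD i []) j (I.node x).2 z) :=
        (Finset.mul_sum _ _ _).symm
    _ ≤ 16 * I.rings * (2 * setWeight G.weight F) := by
        refine Nat.mul_le_mul_left _ ?_
        simp only [setWeight]
        convert h
    _ = 32 * I.rings * setWeight G.weight F := by ring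

theorem cost_graphToTree {G : WGraph I.n} (hG : I.Represents G) (F : Finset (Sym2 (Fin I.n))) :
    setWeight (ranked hI).toWTree.weight (graphToTree hI F) ≤
      I.rounds * I.levels * (32 * I.rings) * setWeight G.weight F := by
  classical
  set X := Finset.univ.filter fun x => x ≠ (ranked hI).root ∧ I.Used F x
  have hX : ∀ x ∈ X, x ≠ (ranked hI).root := fun x hx => ((Finset.mem_filter.1 hx).2).1
  calc setWeight (ranked hI).toWTree.weight (graphToTree hI F)
      = ∑ x ∈ X, (ranked hI).toWTree.weight s(x, (ranked hI).parent x) := by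
        rw [setWeight, graphToTree]
        exact Finset.sum_image fun x hx y hy h =>
          (ranked hI).edge_injective (hX x hx) (hX y hy) h
    _ = ∑ x ∈ X, 2 ^ (ranked hI).lev x :=
        Finset.sum_congr rfl fun x hx => RankedTree.weight_parent _ (hX x hx)
    _ = ∑ q ∈ Finset.range I.rounds ×ˢ Finset.Icc 1 I.levels,
          ∑ x ∈ X with ((I.node x).1, (ranked hI).lev x) = q, 2 ^ (ranked hI).lev x :=
        (Finset.sum_fiberwise_of_maps_to (fun x hx => by
          rw [Finset.mem_product, Finset.mem_range, Finset.mem_Icc]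
          have h := node_of_ne_root hI (hX x hx)
          exact ⟨h.1, nLev_bounds hI (node_mem x) h.2.2⟩) _).symm
    _ ≤ ∑ q ∈ Finset.range I.rounds ×ˢ Finset.Icc 1 I.levels,
          32 * I.rings * setWeight G.weight F := Finset.sum_le_sum fun q hq => by
        rw [Finset.mem_product, Finset.mem_range] at hq
        refine sum_used_le hI hG F hq.1 hq.2 _ fun x hx => ?_
        rw [Finset.mem_filter, Prod.ext_iff] at hx
        exact ⟨(Finset.mem_filter.1 hx.1).2, hx.2⟩
    _ = I.rounds * I.levels * (32 * I.rings) * setWeight G.weight F := by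
        rw [Finset.sum_const, Finset.card_product, Finset.card_range, Nat.card_Icc, smul_eq_mul]
        simp only [Nat.add_sub_cancel]
        ring

end Inst

end HopRepTree

namespace HopRepTree

open Enc

/-! ### Encodings -/

theorem enc_ofFn {α : Type} [Enc α] {n : ℕ} (f : Fin n → α) :
    enc (List.ofFn f) = .ofVec fun i => enc (f i) := by
  change Data.ofList ((List.ofFn f).map enc) = _
  rw [List.map_ofFn]; rfl

theorem enc_ofFn_ofFn {α : Type} [Enc α] {n : ℕ} (f : Fin n → Fin n → α) :
    enc (List.ofFn fun i => List.ofFn (f i)) = .ofMatrix fun i j => enc (f i j) := by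
  rw [enc_ofFn]; simp only [enc_ofFn]; rfl

theorem range_map_eq_ofFn {α : Type} (n : ℕ) (f : ℕ → α) :
    (List.range n).map f = List.ofFn fun i : Fin n => f i := by
  apply List.ext_getElem <;> simp

theorem map_eq_ofFn_get {α β : Type} (l : List α) (f : α → β) :
    l.map f = List.ofFn fun i => f (l.get i) := by
  apply List.ext_getElem <;> simp

theorem getD_ofFn {α : Type} {n : ℕ} (f : Fin n → α) (i : Fin n) (d : α) :
    (List.ofFn f).getD i d = f i := by
  simp

theorem bentry_ofFn {n : ℕ} (f : Fin n → Fin n → Bool) (i j : Fin n) :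
    bentry (List.ofFn fun i => List.ofFn (f i)) i j = f i j := by
  simp [bentry]

theorem entry_ofFn {n : ℕ} (f : Fin n → Fin n → ℕ) (i j : Fin n) :
    entry (List.ofFn fun i => List.ofFn (f i)) i j = f i j := by
  simp [entry]

/-- The adjacency matrix of a set of edges. -/
def adjList {n : ℕ} (F : Finset (Sym2 (Fin n))) : List (List Bool) :=
  List.ofFn fun i => List.ofFn fun j => decide (s(i, j) ∈ F)

theorem enc_adjList {n : ℕ} (F : Finset (Sym2 (Fin n))) : enc (adjList F) = .ofEdgeSet F :=
  enc_ofFn_ofFn _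

theorem maskAny_ofFn {n : ℕ} (f g : Fin n → Fin n → Bool) :
    maskAny (List.ofFn fun i => List.ofFn (f i)) (List.ofFn fun i => List.ofFn (g i)) = true ↔
      ∃ i j, f i j = true ∧ g i j = true := by
  simp only [maskAny, List.any_eq_true, List.mem_range, List.length_ofFn, Bool.and_eq_true]
  constructor
  · rintro ⟨i, hi, j, hj, h1, h2⟩
    rw [getD_ofFn _ ⟨i, hi⟩, List.length_ofFn] at hj
    exact ⟨⟨i, hi⟩, ⟨j, hj⟩, by rwa [← bentry_ofFn f], by rwa [← bentry_ofFn g]⟩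
  · rintro ⟨i, j, h1, h2⟩
    exact ⟨i, i.2, j, by rw [getD_ofFn, List.length_ofFn]; exact j.2, by rwa [bentry_ofFn],
      by rwa [bentry_ofFn]⟩

theorem natOfBits_bits (cap a : ℕ) : natOfBits cap a.bits = min cap a := by
  rw [natOfBits, List.foldl_reverse]
  induction a using Nat.binaryRec' with
  | zero => simp
  | bit b a h ih =>
    rw [Nat.bits_append_bit _ _ h, List.foldr_cons, ih]
    cases b <;> simp [Nat.bit] <;> omega

theorem two_pow_bits (j : ℕ) : (2 ^ j).bits = List.replicate j false ++ [true] := by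
  induction j with
  | zero => simp
  | succ j ih =>
    rw [pow_succ', Nat.bit0_bits _ (by positivity), ih, List.replicate_succ, List.cons_append]

theorem ceilPow_spec {n : ℕ} (hn : 2 ≤ n) : ∃ l, ceilPow n = (2 ^ l, l) ∧ 1 ≤ l ∧ n ≤ 2 ^ l ∧
    2 ^ l < 2 * n := by
  have key : ∀ i, ∃ l, (fun st : ℕ × ℕ => bif Nat.ble n st.1 then st
      else (2 * st.1, st.2 + 1))^[i] (1, 0) = (2 ^ l, l) ∧ (n ≤ 2 ^ l ∨ i ≤ l) ∧
      2 ^ l < 2 * n := by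
    intro i
    induction i with
    | zero => exact ⟨0, rfl, .inr le_rfl, by omega⟩
    | succ i ih =>
      obtain ⟨l, h1, h2, h3⟩ := ih
      rw [Function.iterate_succ_apply', h1]
      by_cases h : n ≤ 2 ^ l
      · exact ⟨l, by simp [Nat.ble_eq_true_of_le h], .inl h, h3⟩
      · refine ⟨l + 1, ?_, .inr (by omega), by rw [pow_succ]; omega⟩
        have : Nat.ble n (2 ^ l) = false := by rwa [← Bool.not_eq_true, Nat.ble_eq]
        simp [this, pow_succ']
  obtain ⟨l, h1, h2, h3⟩ := key n
  have h4 : n ≤ 2 ^ l := h2.elim id fun h =>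
    Nat.lt_two_pow_self.le.trans (Nat.pow_le_pow_right (by norm_num) h)
  refine ⟨l, h1, ?_, h4, h3⟩
  rcases Nat.eq_zero_or_pos l with rfl | h
  · omega
  · exact h

/-! ### Hop distances as distances for zero-one weights -/

section

variable {n : ℕ} (F : Finset (Sym2 (Fin n)))

/-- Weight `0` for the edges of `F` and `1` for the others. -/
def zeroOne : List (List ℕ) :=
  List.ofFn fun i : Fin n => List.ofFn fun j : Fin n => if i = j ∨ s(i, j) ∈ F then 0 else 1

theorem entry_zeroOne (i j : Fin n) :
    entry (zeroOne F) i j = if i = j ∨ s(i, j) ∈ F then 0 else 1 := entry_ofFn _ i j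

theorem isWeightMatrix_zeroOne : IsWeightMatrix (zeroOne F) n where
  symm u hu v hv := by
    rw [entry_zeroOne F ⟨u, hu⟩ ⟨v, hv⟩, entry_zeroOne F ⟨v, hv⟩ ⟨u, hu⟩]
    simp only [Sym2.eq_swap (a := (⟨u, hu⟩ : Fin n)), eq_comm (a := (⟨u, hu⟩ : Fin n))]
  diag u hu := by rw [entry_zeroOne F ⟨u, hu⟩ ⟨u, hu⟩, if_pos (.inl rfl)]

theorem conn_zeroOne {u v : Fin n}
    (p : (SimpleGraph.fromEdgeSet (F : Set (Sym2 (Fin n)))).Walk u v) :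
    Conn (zeroOne F) n u v p.length 0 := by
  induction p with
  | nil => exact .refl (Fin.is_lt _)
  | @cons a b c hab p ih =>
    have h := (Conn.single (M := zeroOne F) a.2 b.2).trans ih
    rw [entry_zeroOne, if_pos (.inr ((SimpleGraph.fromEdgeSet_adj _).1 hab).1)] at h
    simpa [add_comm] using h

/-- Weight 0 means that only edges of F and idle steps are used. Index `h - 1` stands for h steps,
which requires h ≥ 1. -/
theorem hopDist_zeroOne_eq_zero_iff {h : ℕ} (hh : 1 ≤ h) (u v : Fin n) :
    hopDist (zeroOne F) n u (h - 1) v = 0 ↔ HopLE F u v h := by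
  constructor
  · intro h0
    obtain ⟨l, h1, h2, h3, h4⟩ := lightWalk_eq_cons (M := zeroOne F) u.2 (h - 1) v.2
    rw [hopDist, h1, walkWt, List.sum_eq_zero_iff] at h0
    have h5 := HopLE.of_list (F := F) h4 h3 fun a b hab hne => by
      have := h0 _ (List.mem_map.2 ⟨_, hab, rfl⟩)
      rw [entry_zeroOne] at this
      by_contra hF
      simp [hne, hF] at this
    rw [h2, Nat.sub_add_cancel hh] at h5
    exact h5.symm
  · rintro ⟨p, hp⟩
    have hp' : p.length ≤ h := by exact_mod_cast hp
    exact Nat.le_zero.1 (hopDist_le (isWeightMatrix_zeroOne F) (conn_zeroOne F p) (by omega))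

theorem hopMat_adjList (h : ℕ) : hopMat h (adjList F) = List.ofFn fun u : Fin n =>
    List.ofFn fun v : Fin n => Nat.beq (hopDist (zeroOne F) n u (h - 1) v) 0 := by
  have hl : (adjList F).length = n := List.length_ofFn
  have hz : ((List.range n).map fun a => (List.range n).map fun b =>
      bif Nat.beq a b || bentry (adjList F) a b then 0 else 1) = zeroOne F := by
    rw [range_map_eq_ofFn]
    simp only [range_map_eq_ofFn, zeroOne]
    congr 1; funext i; congr 1; funext j
    rw [adjList, bentry_ofFn, cond_eq_ite]
    simp [Fin.ext_iff]
  rw [hopMat, hl, hz, range_map_eq_ofFn]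
  simp only [range_map_eq_ofFn]

end

namespace Inst

variable {I : Inst} (hI : I.Good) {x y : Fin I.nodes.length}

theorem nodes_map_eq_ofFn {α : Type} (f : ℕ × ℕ → α) :
    I.nodes.map f = List.ofFn fun x => f (I.node x) := map_eq_ofFn_get _ _

theorem treeEntry_node [Decidable ((ranked hI).toWTree.graph.Adj x y)] :
    I.treeEntry I.hierarchies (I.node x) (I.node y) =
      (if (ranked hI).toWTree.graph.Adj x y then (ranked hI).toWTree.weight s(x, y) else 0).bits := by
  have h : (ranked hI).toWTree.graph.Adj x y ↔
      (I.isChild I.hierarchies (I.node x) (I.node y) ||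
        I.isChild I.hierarchies (I.node y) (I.node x)) = true := by
    rw [Bool.or_eq_true, isChild_node_iff hI, isChild_node_iff hI]
    exact (ranked hI).adj_iff
  rw [treeEntry, cond_eq_ite]
  split_ifs with h1 h2 h2
  · exact (two_pow_bits _).symm
  · exact absurd (h.2 h1) h2
  · exact absurd (h.1 h2) h1
  · simp

/-- The part of the output that describes the mappings. -/
def mappings (I : Inst) (Hs : List (List (List (List ℕ)))) :
    List (List Bool) × ℕ × List (List (List (List Bool))) × List (List (List (List Bool))) :=
  (embedWith I Hs).2

theorem enc_embedWith : enc (embedWith I I.hierarchies) =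
    .cons (ranked hI).toWTree.encode (enc (I.mappings I.hierarchies)) := by
  have h : enc (embedWith I I.hierarchies).1 = (ranked hI).toWTree.encode := by
    classical
    have h : (I.nodes.map fun p => I.nodes.map fun q => I.treeEntry I.hierarchies p q) =
        List.ofFn fun x => List.ofFn fun y => (if (ranked hI).toWTree.graph.Adj x y then
          (ranked hI).toWTree.weight s(x, y) else 0).bits := by
      rw [nodes_map_eq_ofFn]
      simp only [nodes_map_eq_ofFn]
      congr 1; funext x; congr 1; funext y
      exact treeEntry_node hI
    rw [embedWith, WTree.encode, enc_pair, h, enc_ofFn_ofFn]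
    congr 1
  rw [← h]; rfl

theorem vertexEval_embedWith (v : Fin I.n) :
    enc (vertexEval (embedWith I I.hierarchies, (v : ℕ).bits)) = .ofVertexSet (copies hI v) := by
  have h : vertexEval (embedWith I I.hierarchies, (v : ℕ).bits) =
      List.ofFn fun x => decide (x ∈ copies hI v) := by
    simp only [vertexEval, embedWith, range_map_eq_ofFn, List.length_ofFn, natOfBits_bits]
    rw [min_eq_right v.2.le, getD_ofFn, nodes_map_eq_ofFn]
    congr 1; funext x
    rw [Bool.eq_iff_iff, beq_iff, decide_eq_true_eq, mem_copies, Fin.ext_iff]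
    rfl
  rw [h, enc_ofFn]; rfl

theorem edgeEvalGT_embedWith (hh : 1 ≤ I.hop) (F : Finset (Sym2 (Fin I.n))) :
    enc (edgeEvalGT (embedWith I I.hierarchies, adjList F)) = .ofEdgeSet (graphToTree hI F) := by
  rw [← enc_adjList]
  congr 1
  simp only [edgeEvalGT, embedWith, nodes_map_eq_ofFn, Function.comp_def, adjList,
    sepMask, range_map_eq_ofFn, List.map_ofFn]
  congr 1; funext x; congr 1; funext y
  change maskAny _ (hopMat _ (adjList F)) = _
  rw [hopMat_adjList, Bool.eq_iff_iff, maskAny_ofFn, decide_eq_true_eq, mem_graphToTree]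
  simp only [Bool.or_eq_true, Bool.and_eq_true, beq_iff, hopDist_zeroOne_eq_zero_iff F hh,
    isChild_node_iff hI]
  constructor
  · rintro ⟨u, v, ⟨⟨hx, hxy⟩, hs⟩ | ⟨⟨hy, hxy⟩, hs⟩, huv⟩
    · exact ⟨x, hx, ⟨u, v, hs, huv⟩, by rw [hxy]⟩
    · exact ⟨y, hy, ⟨u, v, hs, huv⟩, by rw [hxy, Sym2.eq_swap]⟩
  · rintro ⟨z, hz, ⟨u, v, hs, huv⟩, h⟩
    rcases Sym2.eq_iff.1 h with ⟨rfl, rfl⟩ | ⟨rfl, rfl⟩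
    · exact ⟨u, v, .inl ⟨⟨hz, rfl⟩, hs⟩, huv⟩
    · exact ⟨u, v, .inr ⟨⟨hz, rfl⟩, hs⟩, huv⟩

theorem mem_walkEdges {a b : Fin I.n} : s(a, b) ∈ I.walkEdges x ↔
    I.onWalk I.hierarchies (I.node x) a b = true := by
  simp only [walkEdges, Finset.mem_filter, Finset.mem_univ, true_and]
  refine ⟨?_, fun h => ⟨a, b, rfl, h⟩⟩
  rintro ⟨a', b', h, h'⟩
  rcases Sym2.eq_iff.1 h with ⟨rfl, rfl⟩ | ⟨rfl, rfl⟩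
  · exact h'
  · rw [onWalk_iff] at h' ⊢
    exact ⟨h'.1.symm, h'.2.symm⟩

theorem edgeEvalTG_embedWith (F' : Finset (Sym2 (Fin I.nodes.length))) :
    enc (edgeEvalTG (embedWith I I.hierarchies, adjList F')) = .ofEdgeSet (treeToGraph hI F') := by
  rw [← enc_adjList]
  congr 1
  simp only [edgeEvalTG, embedWith, range_map_eq_ofFn, Function.comp_def, adjList,
    walkMask, nodes_map_eq_ofFn, List.map_ofFn]
  congr 1; funext a; congr 1; funext b
  rw [Bool.eq_iff_iff, maskAny_ofFn, decide_eq_true_eq, mem_treeToGraph]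
  simp only [Bool.or_eq_true, Bool.and_eq_true, decide_eq_true_eq, isChild_node_iff hI,
    mem_walkEdges]
  constructor
  · rintro ⟨x, y, ⟨⟨hx, rfl⟩, hw⟩ | ⟨⟨hy, rfl⟩, hw⟩, h⟩
    · exact ⟨x, hx, h, hw⟩
    · exact ⟨y, hy, Sym2.eq_swap ▸ h, hw⟩
  · rintro ⟨x, hx, h, hw⟩
    exact ⟨x, _, .inl ⟨⟨hx, rfl⟩, hw⟩, h⟩

end Inst

end HopRepTree

namespace HopRepTree

open Enc

/-! ### The input -/

def inputData {n : ℕ} (G : WGraph n) (r : Fin n) (h : ℕ) {N : ℕ} (ρ : Fin N → Bool) : InputData :=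
  ((h.bits, (r : ℕ).bits,
    List.ofFn fun i => List.ofFn fun j => (if i = j then 0 else G.weight s(i, j)).bits),
    List.ofFn ρ)

theorem enc_inputData {n : ℕ} (G : WGraph n) (r : Fin n) (h : ℕ) {N : ℕ} (ρ : Fin N → Bool) :
    enc (inputData G r h ρ) = withBits (G.encode r h) ρ := by
  rw [inputData, withBits, WGraph.encode, enc_pair, enc_pair, enc_pair, enc_ofFn_ofFn, enc_ofFn]
  rfl

/-- The instance of the algorithm that belongs to the input. -/
def Inst.ofGraph {n : ℕ} (k : ℕ) (G : WGraph n) (r : Fin n) (h l : ℕ) : Inst where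
  n := n
  root := r
  hop := min n h
  ell := l
  levels := k * l + 2
  cap := 4 * (2 ^ l) ^ (k + 6)
  mat := List.ofFn fun i : Fin n => List.ofFn fun j => if i = j then 0 else G.weight s(i, j)

section

variable {n : ℕ} {G : WGraph n} {k l : ℕ} (r : Fin n) (h : ℕ)

theorem weight_le_pow (hw : ∀ e ∈ completeEdges n, G.weight e ≤ n ^ k) (i j : Fin n) :
    (if i = j then 0 else G.weight s(i, j)) ≤ n ^ k := by
  split_ifs with hij
  · exact Nat.zero_le _
  · exact hw _ (Finset.mem_filter.2 ⟨Finset.mem_univ _, by rwa [Sym2.mk_isDiag_iff]⟩)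

theorem mkInst_inputData (hw : ∀ e ∈ completeEdges n, G.weight e ≤ n ^ k)
    (hl : ceilPow n = (2 ^ l, l)) {N : ℕ} (ρ : Fin N → Bool) :
    mkInst k (inputData G r h ρ) = Inst.ofGraph k G r h l := by
  have hm : ((List.ofFn fun i : Fin n => List.ofFn fun j =>
      (if i = j then 0 else G.weight s(i, j)).bits).map fun row =>
        row.map fun b => natOfBits (n ^ k) b) =
      List.ofFn fun i : Fin n => List.ofFn fun j => if i = j then 0 else G.weight s(i, j) := by
    simp only [List.map_ofFn, Function.comp_def, natOfBits_bits, min_eq_right (weight_le_pow hw _ _)]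
  simp only [mkInst, inputData, List.length_ofFn, natOfBits_bits, hl, hm, min_eq_right r.2.le,
    Inst.ofGraph]

theorem Inst.good_ofGraph (hn : 2 ≤ n) (hw : ∀ e ∈ completeEdges n, G.weight e ≤ n ^ k)
    (hl : 1 ≤ l) (hnl : n ≤ 2 ^ l) : (Inst.ofGraph k G r h l).Good := by
  have hentry : ∀ u v (hu : u < n) (hv : v < n), entry (Inst.ofGraph k G r h l).mat u v =
      if (⟨u, hu⟩ : Fin n) = ⟨v, hv⟩ then 0 else G.weight s(⟨u, hu⟩, ⟨v, hv⟩) :=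
    fun u v hu hv => entry_ofFn _ ⟨u, hu⟩ ⟨v, hv⟩
  have hpow : (4 : ℕ) * (2 ^ l) ^ (k + 6) = 2 ^ (l * (k + 6) + 2) := by
    rw [← pow_mul, pow_add]; ring
  have hcap : (Inst.ofGraph k G r h l).cap = 2 ^ (l * (k + 6) + 2) := hpow
  refine ⟨⟨fun u hu v hv => ?_, fun u hu => ?_⟩, fun u hu v hv huv => ?_, r.2, hn, hl, hnl, ?_, ?_,
    fun u hu v hv => ?_, ?_⟩
  · rw [hentry u v hu hv, hentry v u hv hu]
    simp only [Sym2.eq_swap (a := (⟨u, hu⟩ : Fin n)), eq_comm (a := (⟨u, hu⟩ : Fin n))]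
  · rw [hentry u u hu hu, if_pos rfl]
  · have hne : (⟨u, hu⟩ : Fin n) ≠ ⟨v, hv⟩ := fun h => huv (congrArg Fin.val h)
    rw [hentry u v hu hv, if_neg hne]
    exact G.weight_pos _ (by rwa [Sym2.mk_isDiag_iff])
  · rw [hcap]
    refine Nat.pow_le_pow_right (by norm_num) ?_
    change k * l + 2 ≤ _
    linarith [mul_comm k l]
  · rw [hcap]
    refine Nat.pow_le_pow_right (by norm_num) ?_
    change 6 * l ≤ _
    have := Nat.zero_le (k * l)
    linarith [mul_comm k l]
  · rw [hentry u v hu hv]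
    refine (weight_le_pow hw _ _).trans ((Nat.pow_le_pow_left hnl k).trans ?_)
    rw [← pow_mul]
    refine Nat.pow_le_pow_right (by norm_num) ?_
    change _ ≤ k * l + 2
    linarith [mul_comm k l]
  · exact Nat.le_add_left 1 _

theorem Inst.represents_ofGraph : (Inst.ofGraph k G r h l).Represents G := fun u v huv =>
  (entry_ofFn (fun i j : Fin n => if i = j then 0 else G.weight s(i, j)) u v).trans (if_neg huv)

end

/-! ### The parameters of the embedding -/

/-- From 2^l < 2n ≤ n² follows l·log 2 ≤ 2·log n, and log 2 > 2/3. -/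
theorem le_three_mul_log {n l : ℕ} (hn : 2 ≤ n) (hl : 2 ^ l < 2 * n) :
    (l : ℝ) ≤ 3 * Real.log n := by
  have hn' : (2 : ℝ) ≤ n := by exact_mod_cast hn
  have h1 : (2 : ℝ) ^ l ≤ (n : ℝ) ^ 2 := by
    have : (2 : ℝ) ^ l ≤ 2 * n := by exact_mod_cast hl.le
    nlinarith
  have h2 := Real.log_le_log (by positivity) h1
  rw [Real.log_pow, Real.log_pow] at h2
  have h3 := Real.log_two_gt_d9
  have h4 : (0 : ℝ) ≤ l := Nat.cast_nonneg l
  push_cast at h2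
  nlinarith

namespace Inst

theorem rings_bound {I : Inst} {k : ℕ} (hl : 1 ≤ I.ell) (hk : I.levels = k * I.ell + 2) :
    I.rounds * I.levels * (32 * I.rings) ≤ 12288 * (k + 2) ^ 2 * I.ell ^ 3 := by
  have h1 : I.levels ≤ (k + 2) * I.ell := by rw [hk]; linarith
  calc I.rounds * I.levels * (32 * I.rings)
      ≤ I.rounds * ((k + 2) * I.ell) * (32 * I.rings) := by gcongr
    _ = 12288 * (k + 2) * I.ell ^ 3 := by unfold rounds rings; ring
    _ ≤ 12288 * (k + 2) ^ 2 * I.ell ^ 3 := by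
        gcongr
        exact Nat.le_self_pow (by norm_num) _

theorem hop_bound {I : Inst} {k h : ℕ} (hl : 1 ≤ I.ell) (hk : I.levels = k * I.ell + 2)
    (hh : I.hop ≤ h) (h1 : 1 ≤ h) :
    2 * I.levels * (I.hopRadius + 1) ≤ 12288 * (k + 2) ^ 2 * I.ell ^ 3 * h := by
  have h2 : I.levels ≤ (k + 2) * I.ell := by rw [hk]; linarith
  have h3 : 1 ≤ I.levels := by omega
  have h4 : 1 ≤ I.levels * I.ell * h := Nat.mul_pos (Nat.mul_pos h3 hl) h1
  calc 2 * I.levels * (I.hopRadius + 1)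
      = 2 * I.levels * (3 + 256 * (I.levels * I.ell * I.hop)) := by
        unfold hopRadius rings; ring
    _ ≤ 2 * I.levels * (3 * (I.levels * I.ell * h) + 256 * (I.levels * I.ell * h)) := by
        gcongr; omega
    _ = 518 * I.levels ^ 2 * I.ell * h := by ring
    _ ≤ 12288 * ((k + 2) * I.ell) ^ 2 * I.ell * h := by gcongr; norm_num
    _ = 12288 * (k + 2) ^ 2 * I.ell ^ 3 * h := by ring

variable {I : Inst} (hI : I.Good)

theorem isRepTreeEmbedding {G : WGraph I.n} (hG : I.Represents G) {r : Fin I.n}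
    (hr : I.root = r) {h : ℕ} (hh : I.hop = min I.n h) {α β : ℝ}
    (hα : ((I.rounds * I.levels * (32 * I.rings) : ℕ) : ℝ) ≤ α)
    (hβ : ((2 * I.levels * (I.hopRadius + 1) : ℕ) : ℝ) ≤ β * h) :
    IsRepTreeEmbedding G r h α β (ranked hI).toWTree (copies hI) (graphToTree hI)
      (treeToGraph hI) where
  vertexMapping := isVertexMapping hI
  edgeMapping_GT := isMonotone_graphToTree hI
  edgeMapping_TG := isMonotone_treeToGraph hI
  cost_GT F _ := by
    refine le_trans ?_ (mul_le_mul_of_nonneg_right hα (Nat.cast_nonneg _))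
    exact_mod_cast cost_graphToTree hI hG F
  cost_TG F' _ := cost_treeToGraph hI hG F'
  hop_GT F _ u v huv := hop_graphToTree hI (hh ▸ huv.min_card)
  hop_TG F' hF' u' v' h' u v hu hv := by
    rw [mem_copies] at hu hv
    rw [← hu, ← hv]
    exact (hop_treeToGraph hI hF' h').mono hβ
  root_mapping := card_copies_root hI hr

theorem weight_le_of_mem_edges {e : Sym2 (Fin I.nodes.length)}
    (he : e ∈ (ranked hI).toWTree.edges) : (ranked hI).toWTree.weight e ≤ 2 ^ I.levels := by
  obtain ⟨x, hx, rfl⟩ := (ranked hI).mem_edges.1 he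
  rw [RankedTree.weight_parent _ hx]
  exact Nat.pow_le_pow_right (by norm_num)
    (nLev_bounds hI (node_mem x) (node_of_ne_root hI hx).2.2).2

end Inst

theorem RunsIn.computesIn {p : Prog} {x y : Data} {B : ℕ} {time : Polynomial ℕ}
    (h : RunsIn p x y B) (hB : B ≤ time.eval x.size) : ComputesIn p time x y :=
  let ⟨t, ht, hle⟩ := h; ⟨t, ht, hle.trans hB⟩

theorem coinProb_eq_one {N : ℕ} {P : (Fin N → Bool) → Prop} (h : ∀ ρ, P ρ) :
    coinProb N P = 1 := by
  rw [coinProb, Nat.card_congr (Equiv.subtypeUnivEquiv h)]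
  simp

theorem size_withBits {x : Data} {N : ℕ} (hN : N = 0) (ρ : Fin N → Bool) :
    (withBits x ρ).size = x.size + 2 := by
  subst hN; rfl

end HopRepTree

/-! ### The main theorem -/

open HopRepTree HopRepTree.Enc

theorem mainTheorem7 (k c : ℕ) :
    ∃ (C : ℝ) (K : ℕ) (alg evalφ evalGT evalTG : HopRepTree.Prog)
      (bits time : Polynomial ℕ),
      0 < C ∧
      ∀ (n : ℕ), 2 ≤ n → ∀ (G : HopRepTree.WGraph n),
        (∀ e ∈ HopRepTree.completeEdges n, G.weight e ≤ n ^ k) →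
        ∀ (r : Fin n) (h : ℕ), 1 ≤ h →
          -- the algorithm always halts in polynomial time
          (∀ ρ : Fin (bits.eval (G.encode r h).size) → Bool,
            ∃ (y : HopRepTree.Data) (t : ℕ),
              HopRepTree.Run alg (HopRepTree.withBits (G.encode r h) ρ) y t ∧
              t ≤ time.eval (G.encode r h).size) ∧
          -- with high probability its output is a tree followed by a description of the mappings
          1 - 1 / (n : ℝ) ^ c ≤
            HopRepTree.coinProb (bits.eval (G.encode r h).size) fun ρ =>
              ∃ (m : ℕ) (T : HopRepTree.WTree m) (aux : HopRepTree.Data) (t : ℕ)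
                (φ : Fin n → Finset (Fin m))
                (πGT : Finset (Sym2 (Fin n)) → Finset (Sym2 (Fin m)))
                (πTG : Finset (Sym2 (Fin m)) → Finset (Sym2 (Fin n))),
                HopRepTree.Run alg (HopRepTree.withBits (G.encode r h) ρ)
                  (.cons T.encode aux) t ∧
                HopRepTree.IsRepTreeEmbedding G r h
                  (C * Real.log n ^ 3) (C * Real.log n ^ 3) T φ πGT πTG ∧
                HopRepTree.IsEfficient evalφ evalGT evalTG time (.cons T.encode aux)
                  T φ πGT πTG ∧
                T.WellSeparated ∧
                (∀ e ∈ T.edges, T.weight e ≤ n ^ K) ∧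
                T.root ∈ φ r ∧
                ∀ v, ((φ v).card : ℝ) ≤ C * Real.log n := by
  classical
  obtain ⟨alg, P, hP⟩ := PTF.embed k
  obtain ⟨evφ, Pφ, hφ⟩ := PTF.vertexEval
  obtain ⟨evGT, PGT, hGT⟩ := PTF.edgeEvalGT
  obtain ⟨evTG, PTG, hTG⟩ := PTF.edgeEvalTG
  -- Here 331776 = 12288·27, where 27 comes from l³ ≤ (3·log n)³. The zero polynomial means that no
  -- random bits are used; the empty bit string still adds 2 to the size of the input, hence the
  -- shift by 2 in the running time.
  refine ⟨331776 * ((k : ℝ) + 2) ^ 2, 2 * k + 2, alg, evφ, evGT, evTG, 0,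
    P.comp (Polynomial.X + 2) + (Pφ + (PGT + PTG)), by positivity, ?_⟩
  intro n hn G hw r h hh
  obtain ⟨l, hceil, hl, hnl, hln⟩ := ceilPow_spec hn
  set I : Inst := Inst.ofGraph k G r h l
  have hI : I.Good := Inst.good_ofGraph r h hn hw hl hnl
  have hrun : ∀ ρ : Fin ((0 : Polynomial ℕ).eval (G.encode r h).size) → Bool,
      RunsIn alg (withBits (G.encode r h) ρ) (enc (embedWith I I.hierarchies))
        (P.eval ((G.encode r h).size + 2)) := by
    intro ρ
    have h1 := hP (inputData G r h ρ)
    rw [esize, enc_inputData, size_withBits Polynomial.eval_zero, embed,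
      mkInst_inputData r h hw hceil] at h1
    exact h1
  have hlog := le_three_mul_log hn hln
  have hlog0 : 0 ≤ Real.log n := Real.log_natCast_nonneg n
  have hlog3 : ((12288 * (k + 2) ^ 2 * l ^ 3 : ℕ) : ℝ) ≤
      331776 * ((k : ℝ) + 2) ^ 2 * Real.log n ^ 3 := by
    have h3 : (l : ℝ) ^ 3 ≤ (3 * Real.log n) ^ 3 := pow_le_pow_left₀ (Nat.cast_nonneg l) hlog 3
    push_cast
    calc (12288 : ℝ) * ((k : ℝ) + 2) ^ 2 * (l : ℝ) ^ 3
        ≤ 12288 * ((k : ℝ) + 2) ^ 2 * (3 * Real.log n) ^ 3 := by gcongr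
      _ = _ := by ring
  refine ⟨fun ρ => ?_, ?_⟩
  · obtain ⟨t, ht, hle⟩ := hrun ρ
    refine ⟨_, t, ht, hle.trans ?_⟩
    simp [Polynomial.eval_comp]
  rw [coinProb_eq_one]
  · have : (0 : ℝ) ≤ 1 / (n : ℝ) ^ c := by positivity
    linarith
  intro ρ
  obtain ⟨t, ht, -⟩ := hrun ρ
  rw [Inst.enc_embedWith hI] at ht
  refine ⟨I.nodes.length, (Inst.ranked hI).toWTree, enc (I.mappings I.hierarchies), t,
    Inst.copies hI, Inst.graphToTree hI, Inst.treeToGraph hI, ht, ?_, ?_,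
    (Inst.ranked hI).wellSeparated, fun e he => ?_, Inst.root_mem_copies hI rfl, fun v => ?_⟩
  · refine Inst.isRepTreeEmbedding hI (Inst.represents_ofGraph r h) rfl rfl
      (le_trans ?_ hlog3) ?_
    · exact_mod_cast Inst.rings_bound hI.ell_pos rfl
    · refine le_trans ?_ (mul_le_mul_of_nonneg_right hlog3 (Nat.cast_nonneg h))
      exact_mod_cast Inst.hop_bound hI.ell_pos rfl (min_le_right n h) hh
  · have hle : ∀ s, Pφ.eval s ≤ (P.comp (Polynomial.X + 2) + (Pφ + (PGT + PTG))).eval s ∧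
        PGT.eval s ≤ (P.comp (Polynomial.X + 2) + (Pφ + (PGT + PTG))).eval s ∧
        PTG.eval s ≤ (P.comp (Polynomial.X + 2) + (Pφ + (PGT + PTG))).eval s := fun s => by
      simp only [Polynomial.eval_add]; omega
    rw [← Inst.enc_embedWith hI]
    refine ⟨fun v => ?_, fun F _ => ?_, fun F' _ => ?_⟩
    · have h1 := hφ (embedWith I I.hierarchies, (v : ℕ).bits)
      rw [Inst.vertexEval_embedWith hI v] at h1
      exact h1.computesIn (hle _).1
    · have h1 := hGT (embedWith I I.hierarchies, adjList (n := I.n) F)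
      rw [Inst.edgeEvalGT_embedWith hI (le_min (by omega) hh) F, esize, enc_pair,
        enc_adjList (n := I.n) F] at h1
      exact h1.computesIn (hle _).2.1
    · have h1 := hTG (embedWith I I.hierarchies, adjList F')
      rw [Inst.edgeEvalTG_embedWith hI F', esize, enc_pair, enc_adjList] at h1
      exact h1.computesIn (hle _).2.2
  · refine (Inst.weight_le_of_mem_edges hI he).trans ?_
    -- The exponent 2k + 2 arises from (2^l)^k ≤ n^(2k) and 4 ≤ n².
    have h2 : 2 ^ l ≤ n ^ 2 := hln.le.trans (by rw [pow_two]; gcongr)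
    calc 2 ^ (k * l + 2) = (2 ^ l) ^ k * 2 ^ 2 := by rw [pow_add, ← pow_mul, mul_comm k]
      _ ≤ (n ^ 2) ^ k * n ^ 2 := by gcongr
      _ = n ^ (2 * k + 2) := by rw [← pow_mul, ← pow_add]
  · have h1 : ((Inst.copies hI v).card : ℝ) ≤ (6 * l : ℕ) := by
      exact_mod_cast Inst.card_copies_le hI v
    push_cast at h1
    have h2 : (4 : ℝ) ≤ ((k : ℝ) + 2) ^ 2 := by
      have : (0 : ℝ) ≤ k := Nat.cast_nonneg k
      nlinarith
    nlinarith
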